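/- **Setting.** Let $p$ be a prime, $q=p^r$ with $r\ge 1$, let $\mathbb F_q=\mathbb Z_p[\theta]$ be the field with $q$ elements with $\mathbb Z_p$-basis $1,\theta,\dots,\theta^{r-1}$, and fix a bijection $\varphi:\{0,\dots,q-1\}\to\mathbb F_q$ with $\varphi(0)=0$. Write $\eta_i(c)\in\{0,\dots,p-1\}$ for the $i$-th coordinate of $\varphi(c)$ in this basis. For $k=\sum_{l=0}^{m-1}\kappa_l q^l$ and $x=\sum_{l\ge1}x_lq^{-l}\in[0,1)$ (base $q$ expansions, infinitely many $x_l\ne q-1$) put $\mathrm{wal}_k(x)=\exp\big(\tfrac{2\pi \mathrm i}{p}\sum_{l=0}^{m-1}\sum_{i=1}^r\eta_i(\kappa_l)\eta_i(x_{l+1})\big)$, and for $\boldsymbol k\in\mathbb N_0^s$ put $\mathrm{wal}_{\boldsymbol k}(\boldsymbol x)=\prod_j\mathrm{wal}_{k_j}(x_j)$ and $\hat f(\boldsymbol k)=\int_{[0,1)^s}f\,\overline{\mathrm{wal}_{\boldsymbol k}}$. Let $\mathcal S=\{1,\dots,s\}$ and let $\boldsymbol\gamma=(\gamma_u)_{u\subseteq\mathcal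 S}$ be nonnegative reals. For an integer $\delta\ge1$, $0<\lambda\le1$ and $k=\kappa_1q^{a_1-1}+\dots+\kappa_vq^{a_v-1}$ with $\kappa_i\in\{1,\dots,q-1\}$, $a_1>\dots>a_v\ge1$, let $\mu_{q,\delta+\lambda}(k)=a_1+\dots+a_v$ if $v\le\delta$ and $a_1+\dots+a_\delta+\lambda a_{\delta+1}$ if $v>\delta$; let $\mu_{q,\delta+\lambda}(\boldsymbol k)=\sum_j\mu_{q,\delta+\lambda}(k_j)$ and $\operatorname{supp}\boldsymbol k=\{j:k_j\ne0\}$. Put $$\|f\|_{\mathcal E_{s,q,\delta+\lambda,\boldsymbol\gamma}}=\max_{u\subseteq\mathcal S,\ \gamma_u\ne0}\gamma_u^{-1}\sup_{\operatorname{supp}\boldsymbol k=u}|\hat f(\boldsymbol k)|\,q^{\mu_{q,\delta+\lambda}(\boldsymbol k)} .$$ The Walsh space $\mathcal E_{s,q,\delta+\lambda,\boldsymbol\gamma}$ consists of the $f\in L_2([0,1)^s)$ for which this is finite and $\hat f(\boldsymbol k)=0$ whenever $\gamma_{\operatorname{supp}\boldsymbol k}=0$. **Variation.** For real $\mathfrak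 p,\mathfrak q,\mathfrak r\ge1$ and a finite set $u$ of coordinates, let $V_{\lambda,\mathfrak p}(g)=\sup_{\mathcal P}\big(\sum_{J\in\mathcal P}\mathrm{Vol}(J)\,\big|\Delta(g,J)/\mathrm{Vol}(J)^\lambda\big|^{\mathfrak p}\big)^{1/\mathfrak p}$ for $g:[0,1)^u\to\mathbb R$, where $\mathcal P$ runs over finite families of disjoint half-open boxes with vertices in $[0,1)^u$ and $\Delta(g,J)$ is the alternating sum of $g$ over the vertices of $J$ (for $u=\emptyset$ this is $|g|$). If $g$ is integrable, let $V_{\lambda,\mathfrak p,\mathfrak q}(g)=\big(\sum_{w\subseteq u}V_{\lambda,\mathfrak p}(g_w)^{\mathfrak q}\big)^{1/\mathfrak q}$ with $g_w(\boldsymbol x_w)=\int_{[0,1)^{u\setminus w}} g\,d\boldsymbol x_{u\setminus w}$; otherwise let it be $\infty$. For $\boldsymbol\tau\in\{0,\dots,\delta\}^s$ let $f^{(\boldsymbol\tau)}=\partial^{\tau_1+\dots+\tau_s}f/\partial x_1^{\tau_1}\cdots\partial x_s^{\tau_s}$ (one-sided at the faces $x_j=0$), $u(\boldsymbol\tau)=\{j:\tau_j=\delta\}$,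 $v(\boldsymbol\tau)=\{j:\tau_j>0\}$, and let $g_{\boldsymbol\tau}=f^{(\boldsymbol\tau)}(\cdot,\boldsymbol 0_{\mathcal S\setminus u(\boldsymbol\tau)})$, a function on $[0,1)^{u(\boldsymbol\tau)}$. With $0/0=0$ and $c/0=\infty$ for $c>0$, put $$N_{\delta,\lambda,\boldsymbol\gamma}(f)=\Big(\sum_{\boldsymbol\tau\in\{0,\dots,\delta\}^s}\gamma_{v(\boldsymbol\tau)}^{-1}\,V_{\lambda,\mathfrak p,\mathfrak q}(g_{\boldsymbol\tau})^{\mathfrak r}\Big)^{1/\mathfrak r},$$ $$\|f\|_{\mathrm{sob},\delta+1,\boldsymbol\gamma}=\Big(\sum_{\boldsymbol\tau\in\{0,\dots,\delta\}^s}\gamma_{v(\boldsymbol\tau)}^{-1}\sum_{w\subseteq u(\boldsymbol\tau)}\int_{[0,1)^w}\Big|\int_{[0,1)^{u(\boldsymbol\tau)\setminus w}}\frac{\partial^{|w|}g_{\boldsymbol\tau}}{\partial\boldsymbol x_w}\,d\boldsymbol x_{u(\boldsymbol\tau)\setminus w}\Big|^2d\boldsymbol x_w\Big)^{1/2},$$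 the norm of the weighted anchored Sobolev space. Here the derivatives of $g_{\boldsymbol\tau}$ are understood in the absolutely continuous sense: $h\in L_2$ is $\partial^{|w|}g/\partial\boldsymbol x_w$ if, with the variables outside $w$ fixed, $h$ is integrable and $\Delta(g,J)=\int_Jh$ for all boxes $J$ in the variables of $w$ (upper vertex counted with sign $+$); the norm is $\infty$ if such a derivative does not exist. **Statement.** Let $\delta\ge1$ and $\boldsymbol\gamma$ be given. There is a constant $C_{\delta,q,s,\boldsymbol\gamma}>0$ (for the fixed $\mathbb F_q,\theta,\varphi$), independent of $\lambda,\mathfrak p,\mathfrak q,\mathfrak r$ and $f$, such that for all $0<\lambda\le1$, all real $\mathfrak p,\mathfrak q,\mathfrak r\ge1$ and every $f:[0,1)^s\to\mathbb R$ whose partial mixed derivatives up to order $\delta$ in each variable exist, $$\|f\|_{\mathcal E_{s,q,\delta+\lambda,\boldsymbol\gamma}}\le C_{\delta,q,s,\boldsymbol\gamma}\,N_{\delta,\lambda,\boldsymbol\gamma}(f).$$ If moreover $N_{\delta,\lambda,\boldsymbol\gamma}(f)<\infty$ and $\hat f(\boldsymbol k)=0$ whenever $\gamma_{\operatorname{supp}\boldsymbol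 k}=0$, then $f\in\mathcal E_{s,q,\delta+\lambda,\boldsymbol\gamma}$. In particular, for every such $f$ also $\|f\|_{\mathcal E_{s,q,\delta+1,\boldsymbol\gamma}}\le C_{\delta,q,s,\boldsymbol\gamma}\|f\|_{\mathrm{sob},\delta+1,\boldsymbol\gamma}$, and if $\|f\|_{\mathrm{sob},\delta+1,\boldsymbol\gamma}<\infty$ and $\hat f(\boldsymbol k)=0$ whenever $\gamma_{\operatorname{supp}\boldsymbol k}=0$, then $f\in\mathcal E_{s,q,\delta+1,\boldsymbol\gamma}$. -/

import Mathlib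

open MeasureTheory Set
open scoped ENNReal NNReal

noncomputable section

namespace WalshSmooth

/-! ## Cubes, boxes, splitting of coordinates -/

/-- The half-open unit cube `[0,1)^ι`. -/
def cube (ι : Type*) : Set (ι → ℝ) := Set.pi univ fun _ => Ico (0 : ℝ) 1

/-- The half-open box `∏ j, [a j, b j)`. -/
def box {ι : Type*} (a b : ι → ℝ) : Set (ι → ℝ) := Set.pi univ fun j => Ico (a j) (b j)

/-- The point whose coordinates in `w` are those of `x` and whose other coordinates are those
of `z`. -/
def glue {ι : Type*} [DecidableEq ι] (w : Finset ι) (x : {j // j ∈ w} → ℝ)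
    (z : {j // j ∉ w} → ℝ) : ι → ℝ :=
  fun j => if h : j ∈ w then x ⟨j, h⟩ else z ⟨j, h⟩

/-! ## Walsh functions over the additive group of a finite field -/

section Walsh

variable {p : ℕ} {F : Type*} [Field F] [Algebra (ZMod p) F] {q : ℕ} [NeZero q]

/-- The `k`-th Walsh function on `[0,1)` over `F` with respect to the bijection `φ`. Here
`θ.basis` is the basis `1, θ, θ ^ 2, …` of `F` over `ℤ/p`, `Fin.ofNat q (k / q ^ l)` is the digit
`κ_l` of `k` and `Real.digits x q l` is the digit `x_{l+1}` of `x`. -/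
def wal (θ : PowerBasis (ZMod p) F) (φ : Fin q ≃ F) (k : ℕ) (x : ℝ) : ℂ :=
  Complex.exp (2 * Real.pi * Complex.I / p *
    ∑ l ∈ Finset.range (Nat.digits q k).length, ∑ i : Fin θ.dim,
      ((θ.basis.repr (φ (Fin.ofNat q (k / q ^ l))) i).val : ℂ) *
        ((θ.basis.repr (φ (Real.digits x q l)) i).val : ℂ))

/-- Multivariate Walsh functions. -/
def walVec (θ : PowerBasis (ZMod p) F) (φ : Fin q ≃ F) {s : ℕ} (k : Fin s → ℕ)
    (x : Fin s → ℝ) : ℂ :=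
  ∏ j, wal θ φ (k j) (x j)

/-- The Walsh coefficient `∫ f(x) conj(wal_k(x)) dx` over `[0,1)^s`. -/
def walshCoeff (θ : PowerBasis (ZMod p) F) (φ : Fin q ≃ F) {s : ℕ} (f : (Fin s → ℝ) → ℝ)
    (k : Fin s → ℕ) : ℂ :=
  ∫ x in cube (Fin s), (f x : ℂ) * (starRingEnd ℂ) (walVec θ φ k x)

end Walsh

/-- For `k = κ_1 q^(a_1-1) + ⋯ + κ_v q^(a_v-1)` with nonzero digits and `a_1 > ⋯ > a_v ≥ 1` this is
`a_1 + ⋯ + a_v` if `v ≤ δ` and `a_1 + ⋯ + a_δ + lam * a_(δ+1)` if `v > δ`. In the recursion,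
`Nat.log q k + 1` is `a_1` and `k % q ^ Nat.log q k` is `k` without its leading digit. -/
def mu (q : ℕ) (lam : ℝ) : ℕ → ℕ → ℝ
  | 0, k => if k = 0 then 0 else lam * (Nat.log q k + 1)
  | δ + 1, k => if k = 0 then 0 else (Nat.log q k + 1) + mu q lam δ (k % q ^ Nat.log q k)

/-- `r_{q,ϑ}(k) = q ^ (-∑ j, μ_{q,ϑ}(k j))`, where `ϑ = δ + lam` with `δ` an integer and
`0 < lam ≤ 1`, that is, `δ = ⌈ϑ⌉ - 1`. -/
def rWeight (q : ℕ) (ϑ : ℝ) {s : ℕ} (k : Fin s → ℕ) : ℝ :=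
  (q : ℝ) ^ (-∑ j, mu q (ϑ - (⌈ϑ⌉₊ - 1 : ℕ)) (⌈ϑ⌉₊ - 1) (k j))

/-- The set of coordinates in which `k` does not vanish. -/
def supp {s : ℕ} (k : Fin s → ℕ) : Finset (Fin s) := Finset.univ.filter fun j => k j ≠ 0

section WalshSpace

variable {p : ℕ} {F : Type*} [Field F] [Algebra (ZMod p) F] {q : ℕ} [NeZero q]

/-- The norm of the Walsh space, as an extended nonnegative number: the maximum over all `u` with
`γ u ≠ 0` of `(γ u)⁻¹ * sup |f̂(k)| / r_{q,ϑ}(k)`, the supremum running over the `k` that are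
nonzero exactly in the coordinates in `u`. -/
def walshNorm (θ : PowerBasis (ZMod p) F) (φ : Fin q ≃ F) {s : ℕ} (ϑ : ℝ)
    (γ : Finset (Fin s) → ℝ≥0) (f : (Fin s → ℝ) → ℝ) : ℝ≥0∞ :=
  ⨆ (u : Finset (Fin s)) (_ : γ u ≠ 0), (γ u : ℝ≥0∞)⁻¹ *
    ⨆ (k : Fin s → ℕ) (_ : supp k = u), ENNReal.ofReal (‖walshCoeff θ φ f k‖ / rWeight q ϑ k)

/-- If `γ u = 0`, all Walsh coefficients of `f` belonging to `u` vanish. -/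
def CoeffVanish (θ : PowerBasis (ZMod p) F) (φ : Fin q ≃ F) {s : ℕ}
    (γ : Finset (Fin s) → ℝ≥0) (f : (Fin s → ℝ) → ℝ) : Prop :=
  ∀ k : Fin s → ℕ, γ (supp k) = 0 → walshCoeff θ φ f k = 0

/-- Membership in the Walsh space: `f` is square integrable, its Walsh coefficients belonging to
sets of weight zero vanish, and its norm is finite. -/
def MemWalshSpace (θ : PowerBasis (ZMod p) F) (φ : Fin q ≃ F) {s : ℕ} (ϑ : ℝ)
    (γ : Finset (Fin s) → ℝ≥0) (f : (Fin s → ℝ) → ℝ) : Prop :=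
  MemLp f 2 (volume.restrict (cube (Fin s))) ∧ CoeffVanish θ φ γ f ∧ walshNorm θ φ ϑ γ f < ⊤

end WalshSpace

/-! ## The generalized Vitali and Hardy-Krause variations -/

section Variation

variable {ι : Type*} [Fintype ι] [DecidableEq ι]

/-- The alternating sum of `f` at the vertices of the box `∏ j, [a j, b j)`; `f b` has sign `+`. -/
def alternatingSum (f : (ι → ℝ) → ℝ) (a b : ι → ℝ) : ℝ :=
  ∑ v : Finset ι, (-1) ^ v.card * f (fun j => if j ∈ v then a j else b j)

/-- The box `∏ j, [a j, b j)` is nonempty and all its vertices lie in `[0,1)^ι`. -/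
def IsSubbox (a b : ι → ℝ) : Prop := ∀ j, 0 ≤ a j ∧ a j < b j ∧ b j < 1

/-- A finite family of pairwise disjoint boxes with vertices in `[0,1)^ι`; a pair `(a, b)` stands
for the box `∏ j, [a j, b j)`. -/
def IsBoxFamily (P : Finset ((ι → ℝ) × (ι → ℝ))) : Prop :=
  (∀ J ∈ P, IsSubbox J.1 J.2) ∧
    (P : Set ((ι → ℝ) × (ι → ℝ))).PairwiseDisjoint fun J => box J.1 J.2

/-- The volume of the box `∏ j, [a j, b j)`. -/
def boxVol (a b : ι → ℝ) : ℝ := ∏ j, (b j - a j)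

/-- The generalized Vitali variation. As all summands are nonnegative and a finite family of
disjoint boxes can be completed to a partition into boxes, families of disjoint boxes give the same
supremum as partitions; only vertices in `[0,1)^ι`, the domain of `f`, occur. If `ι` is empty, the
value is `|f|` at the only point. -/
def vitaliVar (lam pp : ℝ) (f : (ι → ℝ) → ℝ) : ℝ≥0∞ :=
  ⨆ (P : Finset ((ι → ℝ) × (ι → ℝ))) (_ : IsBoxFamily P), ENNReal.ofReal
    ((∑ J ∈ P, boxVol J.1 J.2 *
      (|alternatingSum f J.1 J.2| / boxVol J.1 J.2 ^ lam) ^ pp) ^ (1 / pp))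

/-- The projection `f_w(x_w) = ∫ f(x_w, z) dz`, the other coordinates being integrated out. -/
def proj (w : Finset ι) (f : (ι → ℝ) → ℝ) : ({j // j ∈ w} → ℝ) → ℝ :=
  fun x => ∫ z in cube {j // j ∉ w}, f (glue w x z)

open scoped Classical in
/-- The (unweighted) generalized Hardy-Krause variation; it is finite only for integrable
functions, as it is built from integrals of `f`. The summand of `w = ∅` is `|∫ f|`. -/
def hkVar (lam pp qq : ℝ) (f : (ι → ℝ) → ℝ) : ℝ≥0∞ :=
  if IntegrableOn f (cube ι) then
    (∑ w : Finset ι, vitaliVar lam pp (proj w f) ^ qq) ^ (1 / qq)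
  else ⊤

/-- The function `h` on `[0,1)^ι` is the mixed derivative `∂^|w| g / ∂x_w` of `g` in the absolutely
continuous sense: `h` is square integrable, and with the coordinates outside `w` fixed the
alternating sums of `g` over boxes are the integrals of `h` over these boxes. -/
def HasMixedDeriv (w : Finset ι) (g h : (ι → ℝ) → ℝ) : Prop :=
  MemLp h 2 (volume.restrict (cube ι)) ∧
    ∀ z ∈ cube {j // j ∉ w},
      IntegrableOn (fun t => h (glue w t z)) (cube {j // j ∈ w}) ∧
      ∀ a b : {j // j ∈ w} → ℝ, IsSubbox a b →
        alternatingSum (fun t => g (glue w t z)) a b = ∫ t in box a b, h (glue w t z)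

/-- `∫ |∫ (∂^|w| g / ∂x_w)(x) dx_{ι∖w}|² dx_w`, which is `⊤` if the mixed derivative does not exist.
(The mixed derivative is determined almost everywhere, so that the infimum is over equal
values.) -/
def mixedSeminormSq (w : Finset ι) (g : (ι → ℝ) → ℝ) : ℝ≥0∞ :=
  ⨅ (h : (ι → ℝ) → ℝ) (_ : HasMixedDeriv w g h),
    ∫⁻ x in cube {j // j ∈ w}, ENNReal.ofReal ((proj w h x) ^ 2)

end Variation

/-! ## Partial mixed derivatives and the functional `N` -/

section Smooth

variable {s : ℕ}

/-- The partial derivative in the `j`-th variable on `[0,1)^s` (one-sided where `x j = 0`). -/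
def partialDeriv (j : Fin s) (f : (Fin s → ℝ) → ℝ) : (Fin s → ℝ) → ℝ :=
  fun x => derivWithin (fun t => f (Function.update x j t)) (Ico 0 1) (x j)

/-- The partial mixed derivative `∂^{τ_1 + ⋯ + τ_s} f / ∂x_1^{τ_1} ⋯ ∂x_s^{τ_s}`; the derivatives in
`x_s` are taken first and those in `x_1` last. -/
def mixedPartial (τ : Fin s → ℕ) (f : (Fin s → ℝ) → ℝ) : (Fin s → ℝ) → ℝ :=
  (List.finRange s).foldr (fun j g => (partialDeriv j)^[τ j] g) f

/-- The partial mixed derivatives of `f` up to order `δ` in each variable exist on `[0,1)^s`: each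
differentiation that occurs in `mixedPartial τ f` for some `τ ∈ {0,…,δ}^s` is possible. -/
def HasMixedPartials (δ : ℕ) (f : (Fin s → ℝ) → ℝ) : Prop :=
  ∀ (τ : Fin s → ℕ) (j : Fin s), (∀ i, τ i ≤ δ) → τ j < δ → (∀ i < j, τ i = 0) →
    ∀ x ∈ cube (Fin s), DifferentiableWithinAt ℝ
      (fun t => mixedPartial τ f (Function.update x j t)) (Ico 0 1) (x j)

/-- `u(τ) = {j : τ_j = δ}`. -/
def topSet {δ : ℕ} (τ : Fin s → Fin (δ + 1)) : Finset (Fin s) :=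
  Finset.univ.filter fun j => (τ j : ℕ) = δ

/-- `v(τ) = {j : τ_j > 0}`. -/
def posSet {δ : ℕ} (τ : Fin s → Fin (δ + 1)) : Finset (Fin s) :=
  Finset.univ.filter fun j => 0 < (τ j : ℕ)

/-- The function `f^(τ)(·, 0)` of the variables `x_j`, `j ∈ u(τ)`, the others being set to `0`. -/
def anchored {δ : ℕ} (τ : Fin s → Fin (δ + 1)) (f : (Fin s → ℝ) → ℝ) :
    ({j // j ∈ topSet τ} → ℝ) → ℝ :=
  fun x => mixedPartial (fun j => (τ j : ℕ)) f (glue (topSet τ) x 0)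

/-- The functional `N_{δ,lam,γ}(f)` with the exponents `pp, qq, rr`. In `ℝ≥0∞` one has `0 / 0 = 0`
and `c / 0 = ⊤` for `c ≠ 0`. If `u(τ) = ∅`, the variation is `|f^(τ)(0)|`. -/
def smoothN (δ : ℕ) (lam pp qq rr : ℝ) (γ : Finset (Fin s) → ℝ≥0) (f : (Fin s → ℝ) → ℝ) : ℝ≥0∞ :=
  (∑ τ : Fin s → Fin (δ + 1),
    hkVar lam pp qq (anchored τ f) ^ rr / (γ (posSet τ) : ℝ≥0∞)) ^ (1 / rr)

/-- The norm of the weighted anchored Sobolev space of smoothness `δ + 1` in each variable. -/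
def sobolevNorm (δ : ℕ) (γ : Finset (Fin s) → ℝ≥0) (f : (Fin s → ℝ) → ℝ) : ℝ≥0∞ :=
  (∑ τ : Fin s → Fin (δ + 1),
    (∑ w : Finset {j // j ∈ topSet τ}, mixedSeminormSq w (anchored τ f)) /
      (γ (posSet τ) : ℝ≥0∞)) ^ (1 / 2 : ℝ)

end Smooth

end WalshSmooth

end

/-!
The Walsh coefficients of a function decay because iterated primitives of Walsh functions do.

*Taylor's formula.* If the terms on the right-hand side of the inequality are finite, `f` is a sum
over `τ ∈ {0,…,δ}^s` of integrals of `f^(τ)` against products of the kernels `(x - t)₊ ^ n / n!`,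
where the variables with `τ_j < δ` are set to `0` and those with `τ_j = δ` are integrated
(`taylor_mixedPartial`). The top order derivatives need not be continuous: a function that is
differentiable everywhere is the integral of its derivative as soon as the latter is integrable
(`eq_add_integral_derivIco`). By Fubini's theorem a Walsh coefficient becomes the sum over `τ` of
integrals of `f^(τ)(·, 0)` against products of iterated primitives `∫ x in t..1` of conjugate Walsh
functions, evaluated at `0` in the variables with `τ_j < δ` (`integral_mul_prod_taylor`,
`integral_mixedPartial_mul_prod`).

*One variable.* On each interval of length `q ^ (-b)`, where `k < q ^ b`, the `k`-th Walsh function is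
a multiple of a fixed profile, the multiples being its own values (`WalshProfile`). If `a` is the
position of the leading digit of `k`, orthogonality of the additive characters of `F` makes the mean
over intervals of length `q ^ (1 - a)` vanish. Hence a primitive gains the factor `q ^ (1 - a)`, and it
has again a profile, now for `k` without its leading digit (`WalshProfile.primitive`). After `δ`
integrations the factor is comparable with `q ^ (-(a_1 + ⋯ + a_δ))`, and the function still has mean
zero on the intervals of length `q ^ (1 - a_(δ+1))` (`WalshProfile.exists_oscBound`). At `0` the
primitives vanish as long as digits are left (`WalshProfile.norm_bint_iterate_zero_le`).

*Oscillation against variation.* A bounded function of mean zero on `[0,1)` is the marginal of a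
bounded antisymmetric kernel that charges only pairs of points at distance at least `1 / 4`
(`exists_isDiffKernel`). Used in all cells of a grid and in all coordinates, this turns an integral of
`g` against a product of such functions into an average of sums of differences of `g` over disjoint
boxes whose volumes are comparable with those of the cells (`norm_integral_mul_prod_le`). These
sums are bounded by the generalized Vitali variation through Jensen's inequality
(`diffBound_of_vitaliVar`) and by the `L²` norm of the mixed derivative
(`diffBound_of_mixedSeminormSq`); restricting to pairs of distant points is what makes the constant
independent of `lam` and of the exponents. Primitives with a nonzero mean occur only if `k` has at
most `δ` nonzero digits; splitting off the means leads to the projections `g_w`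
(`norm_integral_mul_prod_osc_le`).
-/

namespace WalshSmooth

/-! ### Walsh functions and the digits of their arguments -/

section Digits

theorem digits_cell {q : ℕ} [NeZero q] {l i : ℕ} (hi : i < l) (m : ℕ) {z : ℝ}
    (hz : z ∈ Ico (0 : ℝ) 1) :
    Real.digits ((m + z) / q ^ l) q i = Fin.ofNat q (m / q ^ (l - 1 - i)) := by
  have hq : (q : ℝ) ≠ 0 := Nat.cast_ne_zero.2 (NeZero.ne q)
  unfold Real.digits
  congr 1
  have h1 : (m + z) / (q : ℝ) ^ l * q ^ (i + 1) = (m + z) / ((q ^ (l - 1 - i) : ℕ) : ℝ) := by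
    have : (q : ℝ) ^ l = q ^ (l - 1 - i) * q ^ (i + 1) := by
      rw [← pow_add]; congr 1; omega
    rw [this]
    push_cast
    field_simp
  rw [h1, Nat.floor_div_natCast]
  congr 1
  rw [Nat.floor_eq_iff (by have := hz.1; positivity)]
  exact ⟨by linarith [hz.1], by linarith [hz.2]⟩

theorem ofNat_mod_div {q : ℕ} [NeZero q] {l n : ℕ} (h : l < n) (k : ℕ) :
    Fin.ofNat q (k % q ^ n / q ^ l) = Fin.ofNat q (k / q ^ l) := by
  ext
  simp only [Fin.val_ofNat]
  have : q ^ n = q ^ l * q ^ (n - l) := by rw [← pow_add]; congr 1; omega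
  rw [this, Nat.mod_mul_right_div_self, Nat.mod_mod_of_dvd]
  exact dvd_pow_self q (by omega)

end Digits

section Walsh

variable {p : ℕ} [Fact p.Prime] {F : Type*} [Field F] [Algebra (ZMod p) F] {q : ℕ}

/-- The factor of the Walsh functions belonging to one pair of digits, as an additive character of
`F` evaluated at `φ d`. -/
noncomputable def digitChar (θ : PowerBasis (ZMod p) F) (φ : Fin q ≃ F) (κ d : Fin q) : ℂ :=
  Complex.exp (2 * Real.pi * Complex.I / p * ∑ i : Fin θ.dim,
      ((θ.basis.repr (φ κ) i).val : ℂ) * ((θ.basis.repr (φ d) i).val : ℂ))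

theorem wal_eq_prod [NeZero q] (θ : PowerBasis (ZMod p) F) (φ : Fin q ≃ F) (k : ℕ) (x : ℝ) :
    wal θ φ k x = ∏ l ∈ Finset.range (Nat.digits q k).length,
      digitChar θ φ (Fin.ofNat q (k / q ^ l)) (Real.digits x q l) := by
  simp only [wal, digitChar, Finset.mul_sum, Complex.exp_sum]

theorem one_lt_of_equiv (φ : Fin q ≃ F) : 1 < q := by
  have : Nontrivial (Fin q) := φ.nontrivial
  exact Fin.nontrivial_iff_two_le.1 this

theorem norm_digitChar (θ : PowerBasis (ZMod p) F) (φ : Fin q ≃ F) (κ d : Fin q) :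
    ‖digitChar θ φ κ d‖ = 1 := by
  rw [digitChar, Complex.norm_exp]
  have : (2 * Real.pi * Complex.I / p * ∑ i : Fin θ.dim,
      ((θ.basis.repr (φ κ) i).val : ℂ) * ((θ.basis.repr (φ d) i).val : ℂ)) =
      ((2 * Real.pi / p * ∑ i : Fin θ.dim,
      ((θ.basis.repr (φ κ) i).val : ℝ) * ((θ.basis.repr (φ d) i).val : ℝ) : ℝ) : ℂ) *
        Complex.I := by
    push_cast; ring
  rw [this, Complex.re_ofReal_mul, Complex.I_re, mul_zero, Real.exp_zero]

variable [NeZero q]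

theorem digitChar_zero_left (θ : PowerBasis (ZMod p) F) {φ : Fin q ≃ F} (hφ : φ 0 = 0)
    (d : Fin q) : digitChar θ φ 0 d = 1 := by
  simp [digitChar, hφ]

theorem digitChar_zero_right (θ : PowerBasis (ZMod p) F) {φ : Fin q ≃ F} (hφ : φ 0 = 0)
    (d : Fin q) : digitChar θ φ d 0 = 1 := by
  simp [digitChar, hφ]

/-- Orthogonality of the additive characters of `F`. -/
theorem sum_digitChar (θ : PowerBasis (ZMod p) F) {φ : Fin q ≃ F} (hφ : φ 0 = 0) {κ : Fin q}
    (hκ : κ ≠ 0) : ∑ d, digitChar θ φ κ d = 0 := by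
  classical
  have : Fintype F := Fintype.ofEquiv _ φ
  set a := θ.basis.repr (φ κ) with ha
  let ψ : AddChar F ℂ :=
    { toFun := fun y => ∏ i, ZMod.stdAddChar (a i * θ.basis.repr y i)
      map_zero_eq_one' := by simp
      map_add_eq_mul' := fun x y => by
        simp [mul_add, AddChar.map_add_eq_mul, Finset.prod_mul_distrib] }
  have hψ : ∀ d, digitChar θ φ κ d = ψ (φ d) := by
    intro d
    change _ = ∏ i, ZMod.stdAddChar (a i * θ.basis.repr (φ d) i)
    rw [digitChar, Finset.mul_sum, Complex.exp_sum]
    refine Finset.prod_congr rfl fun i _ => ?_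
    have h1 : a i * θ.basis.repr (φ d) i =
        (((a i).val * (θ.basis.repr (φ d) i).val : ℕ) : ℤ) := by simp
    rw [h1, ZMod.stdAddChar_coe]
    congr 1
    push_cast
    ring
  have hne : ψ ≠ 1 := by
    have h0 : φ κ ≠ 0 := fun h => hκ (φ.injective (h.trans hφ.symm))
    have : ∃ i, a i ≠ 0 := by
      by_contra! h
      exact h0 (θ.basis.repr.injective (by ext i; simpa using h i))
    obtain ⟨i, hi⟩ := this
    intro h1
    have h2 : ψ (θ.basis i) = 1 := by rw [h1]; rfl
    have h3 : ψ (θ.basis i) = ZMod.stdAddChar (a i) := by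
      change ∏ j, ZMod.stdAddChar (a j * θ.basis.repr (θ.basis i) j) = _
      rw [Finset.prod_eq_single i]
      · rw [Module.Basis.repr_self]
        simp
      · intro j _ hj
        rw [Module.Basis.repr_self, Finsupp.single_eq_of_ne hj]
        simp
      · simp
    rw [h3] at h2
    exact hi (ZMod.injective_stdAddChar (h2.trans (AddChar.map_zero_eq_one _).symm))
  simp_rw [hψ]
  rw [Equiv.sum_comp φ (fun y => ψ y)]
  exact AddChar.sum_eq_zero_of_ne_one hne

variable (θ : PowerBasis (ZMod p) F) {φ : Fin q ≃ F}

theorem wal_eq_prod_of_lt (hφ : φ 0 = 0) {k L : ℕ} (hk : k < q ^ L) (x : ℝ) :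
    wal θ φ k x = ∏ l ∈ Finset.range L,
      digitChar θ φ (Fin.ofNat q (k / q ^ l)) (Real.digits x q l) := by
  have hq := one_lt_of_equiv φ
  rw [wal_eq_prod]
  refine Finset.prod_subset ?_ ?_
  · exact Finset.range_subset_range.2 ((Nat.digits_length_le_iff hq k).2 hk)
  · intro l _ hl
    have h1 : k < q ^ l :=
      (Nat.digits_length_le_iff hq k).1 (by simpa using hl)
    rw [Nat.div_eq_of_lt h1]
    exact digitChar_zero_left θ hφ _

theorem norm_wal (φ : Fin q ≃ F) (k : ℕ) (x : ℝ) : ‖wal θ φ k x‖ = 1 := by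
  rw [wal_eq_prod, norm_prod]
  exact Finset.prod_eq_one fun l _ => norm_digitChar θ φ _ _

theorem measurable_wal (φ : Fin q ≃ F) (k : ℕ) : Measurable (wal θ φ k) := by
  have : wal θ φ k = fun x => ∏ l ∈ Finset.range (Nat.digits q k).length,
      digitChar θ φ (Fin.ofNat q (k / q ^ l)) (Real.digits x q l) :=
    funext fun x => wal_eq_prod θ φ k x
  rw [this]
  refine Finset.measurable_prod _ fun l _ => ?_
  have h2 : Measurable fun n : ℕ => digitChar θ φ (Fin.ofNat q (k / q ^ l)) (Fin.ofNat q n) :=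
    measurable_of_countable _
  exact h2.comp (Nat.measurable_floor.comp (measurable_id.mul_const _))

/-- A Walsh function with index below `q ^ l` is constant on the intervals of length `q ^ (-l)`. -/
theorem wal_cell (hφ : φ 0 = 0) {k l : ℕ} (hk : k < q ^ l) (m : ℕ) {z : ℝ}
    (hz : z ∈ Ico (0 : ℝ) 1) :
    wal θ φ k ((m + z) / q ^ l) = wal θ φ k (m / q ^ l) := by
  rw [wal_eq_prod_of_lt θ hφ hk, wal_eq_prod_of_lt θ hφ hk]
  refine Finset.prod_congr rfl fun i hi => ?_
  have h0 := digits_cell (q := q) (Finset.mem_range.1 hi) m (z := 0) (by simp)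
  rw [add_zero] at h0
  rw [digits_cell (Finset.mem_range.1 hi) m hz, h0]

theorem wal_zero_right (hφ : φ 0 = 0) (k : ℕ) : wal θ φ k 0 = 1 := by
  rw [wal_eq_prod]
  refine Finset.prod_eq_one fun l _ => ?_
  have : Real.digits (0 : ℝ) q l = 0 := by simp [Real.digits]
  rw [this, digitChar_zero_right θ hφ]

/-- The leading digit of `k` reads only the digit `c` of the argument, the rest of `k` reads only
the digits in `m`. -/
theorem wal_split (hφ : φ 0 = 0) (k m : ℕ) (c : Fin q) :
    wal θ φ k ((m * q + c : ℕ) / q ^ (Nat.log q k + 1)) =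
      wal θ φ (k % q ^ Nat.log q k) (m / q ^ Nat.log q k) *
        digitChar θ φ (Fin.ofNat q (k / q ^ Nat.log q k)) c := by
  have hq := one_lt_of_equiv φ
  have hq0 : 0 < q := by omega
  set n := Nat.log q k
  have h0 : ∀ l i j : ℕ, i < l → Real.digits ((j : ℝ) / q ^ l) q i =
      Fin.ofNat q (j / q ^ (l - 1 - i)) := by
    intro l i j hi
    have := digits_cell (q := q) hi j (z := 0) (by simp)
    rwa [add_zero] at this
  rw [wal_eq_prod_of_lt θ hφ (Nat.lt_pow_succ_log_self hq k),
    wal_eq_prod_of_lt θ hφ (Nat.mod_lt k (pow_pos hq0 n)), Finset.prod_range_succ]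
  congr 1
  · refine Finset.prod_congr rfl fun i hi => ?_
    have hi := Finset.mem_range.1 hi
    rw [ofNat_mod_div hi, h0 _ _ _ (by omega), h0 _ _ _ hi]
    congr 2
    have : q ^ (n + 1 - 1 - i) = q * q ^ (n - 1 - i) := by
      rw [← pow_succ']; congr 1; omega
    rw [this, ← Nat.div_div_eq_div_mul]
    congr 1
    rw [mul_comm, Nat.mul_add_div hq0, Nat.div_eq_of_lt c.2, add_zero]
  · rw [h0 _ _ _ (by omega)]
    congr 1
    ext
    simp [n, Nat.mod_eq_of_lt c.2]

end Walsh

/-! ### Iterated integrals of Walsh functions -/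

/-- The primitive `t ↦ ∫ x in t..1, Φ x`, the adjoint of the primitive vanishing at `0`. -/
noncomputable def bint (Φ : ℝ → ℂ) (t : ℝ) : ℂ := ∫ x in t..1, Φ x

theorem continuous_bint {Φ : ℝ → ℂ} (hΦ : ∀ a b, IntervalIntegrable Φ volume a b) :
    Continuous (bint Φ) := by
  have : bint Φ = fun t => -∫ x in (1 : ℝ)..t, Φ x := by
    ext t
    exact intervalIntegral.integral_symm _ _
  rw [this]
  exact (intervalIntegral.continuous_primitive hΦ 1).neg

theorem intervalIntegrable_bint {Φ : ℝ → ℂ} (hΦ : ∀ a b, IntervalIntegrable Φ volume a b) :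
    ∀ a b, IntervalIntegrable (bint Φ) volume a b :=
  fun a b => (continuous_bint hΦ).intervalIntegrable a b

theorem norm_bint_le {Φ : ℝ → ℂ} {B : ℝ} (hB : ∀ t ∈ Icc (0 : ℝ) 1, ‖Φ t‖ ≤ B) :
    ∀ t ∈ Icc (0 : ℝ) 1, ‖bint Φ t‖ ≤ B := by
  intro t ht
  have hB0 : 0 ≤ B := (norm_nonneg _).trans (hB t ht)
  have h1 := intervalIntegral.norm_integral_le_of_norm_le_const (f := Φ) (a := t) (b := 1) (C := B)
    (fun x hx => hB x (by
      rw [uIoc_of_le ht.2] at hx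
      exact ⟨ht.1.trans hx.1.le, hx.2⟩))
  refine h1.trans ?_
  rw [abs_of_nonneg (by linarith [ht.2])]
  nlinarith [ht.1]

theorem norm_bint_iterate_le {Φ : ℝ → ℂ} {B : ℝ} (hB : ∀ t ∈ Icc (0 : ℝ) 1, ‖Φ t‖ ≤ B) (n : ℕ) :
    ∀ t ∈ Icc (0 : ℝ) 1, ‖bint^[n] Φ t‖ ≤ B := by
  induction n generalizing Φ with
  | zero => simpa using hB
  | succ n ih => exact ih (norm_bint_le hB)

theorem intervalIntegrable_bint_iterate {Φ : ℝ → ℂ}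
    (hΦ : ∀ a b, IntervalIntegrable Φ volume a b) (n : ℕ) :
    ∀ a b, IntervalIntegrable (bint^[n] Φ) volume a b := by
  induction n generalizing Φ with
  | zero => simpa using hΦ
  | succ n ih => exact ih (intervalIntegrable_bint hΦ)

/-- A function on `[0,1]` bounded by `M` whose deviation from its mean has mean zero on all
intervals `[m / q ^ e, (m + 1) / q ^ e)`; for `e > 0` the mean itself vanishes. -/
structure OscBound (q : ℕ) (K : ℝ → ℂ) (e : ℕ) (M : ℝ) : Prop where
  bound : ∀ t ∈ Icc (0 : ℝ) 1, ‖K t‖ ≤ M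
  int : ∀ a b, IntervalIntegrable K volume a b
  cell : ∀ m < q ^ e, ∫ x in (m / q ^ e : ℝ)..((m + 1) / q ^ e), (K x - ∫ y in (0 : ℝ)..1, K y) = 0
  mean : e = 0 ∨ ∫ y in (0 : ℝ)..1, K y = 0

theorem OscBound.of_bound {q : ℕ} {K : ℝ → ℂ} {M : ℝ} (hB : ∀ t ∈ Icc (0 : ℝ) 1, ‖K t‖ ≤ M)
    (hK : ∀ a b, IntervalIntegrable K volume a b) : OscBound q K 0 M where
  bound := hB
  int := hK
  cell := by
    intro m hm
    obtain rfl : m = 0 := by simpa using hm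
    rw [intervalIntegral.integral_sub (hK _ _) (by simp)]
    simp
  mean := Or.inl rfl

theorem mu_zero_right (q : ℕ) (lam : ℝ) (d : ℕ) : mu q lam d 0 = 0 := by
  cases d <;> simp [mu]

theorem rpow_neg_mu_succ {q : ℕ} (hq : 0 < q) (lam : ℝ) (d : ℕ) {k : ℕ} (hk : k ≠ 0) :
    (q : ℝ) ^ (-mu q lam (d + 1) k) =
      (q * (q : ℝ) ^ Nat.log q k)⁻¹ * (q : ℝ) ^ (-mu q lam d (k % q ^ Nat.log q k)) := by
  have hq' : (0 : ℝ) < q := Nat.cast_pos.2 hq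
  simp only [mu, hk, if_false]
  rw [neg_add, Real.rpow_add hq', Real.rpow_neg hq'.le (_ + _), Real.rpow_add hq',
    Real.rpow_natCast, Real.rpow_one, mul_comm (q : ℝ)]

section Walsh

variable {p : ℕ} [Fact p.Prime] {F : Type*} [Field F] [Algebra (ZMod p) F] {q : ℕ} [NeZero q]
variable (θ : PowerBasis (ZMod p) F) {φ : Fin q ≃ F}

/-- On the intervals of length `q ^ (-b)` the function `Φ` is a multiple of one and the same
profile, the multiples being given by the complex conjugate of the `k`-th Walsh function. -/
def WalshProfile (θ : PowerBasis (ZMod p) F) (φ : Fin q ≃ F) (k b : ℕ) (Φ : ℝ → ℂ) : Prop :=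
  ∀ m < q ^ b, ∀ y ∈ Ico (0 : ℝ) 1,
    Φ ((m + y) / q ^ b) = (starRingEnd ℂ) (wal θ φ k (m / q ^ b)) * Φ (y / q ^ b)

theorem walshProfile_wal (hφ : φ 0 = 0) {k b : ℕ} (hk : k < q ^ b) :
    WalshProfile θ φ k b fun x => (starRingEnd ℂ) (wal θ φ k x) := by
  intro m _ y hy
  have h0 := wal_cell θ hφ hk 0 hy
  simp only [CharP.cast_eq_zero, zero_add, zero_div] at h0
  simp only [wal_cell θ hφ hk m hy, h0, wal_zero_right θ hφ, map_one, mul_one]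

theorem exists_cell {N : ℕ} (hN : 0 < N) {z : ℝ} (hz : z ∈ Ico (0 : ℝ) 1) :
    ∃ m < N, ∃ y ∈ Ico (0 : ℝ) 1, z = (m + y) / N := by
  have hN' : (0 : ℝ) < N := Nat.cast_pos.2 hN
  have h0 : 0 ≤ z * N := mul_nonneg hz.1 hN'.le
  refine ⟨⌊z * N⌋₊, ?_, z * N - ⌊z * N⌋₊, ⟨?_, ?_⟩, ?_⟩
  · rw [Nat.floor_lt h0]
    nlinarith [hz.2]
  · linarith [Nat.floor_le h0]
  · linarith [Nat.lt_floor_add_one (z * N)]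
  · field_simp
    ring

/-- A profile on a fine grid is also a profile on each coarser grid that still resolves `k`. -/
theorem WalshProfile.of_le (hφ : φ 0 = 0) {k b l : ℕ} {Φ : ℝ → ℂ} (h : WalshProfile θ φ k b Φ)
    (hk : k < q ^ l) (hl : l ≤ b) : WalshProfile θ φ k l Φ := by
  have hq : 0 < q := Nat.pos_of_ne_zero (NeZero.ne q)
  have hq' : (0 : ℝ) < q := Nat.cast_pos.2 hq
  intro m hm z hz
  obtain ⟨m', hm', y, hy, rfl⟩ := exists_cell (pow_pos hq (b - l)) hz
  have hpow : (q : ℝ) ^ b = q ^ l * q ^ (b - l) := by rw [← pow_add]; congr 1; omega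
  have hpowN : q ^ b = q ^ l * q ^ (b - l) := by rw [← pow_add]; congr 1; omega
  have e1 : ((m : ℝ) + (m' + y) / (q ^ (b - l) : ℕ)) / q ^ l =
      ((m * q ^ (b - l) + m' : ℕ) + y) / q ^ b := by
    rw [hpow]; push_cast; field_simp; ring
  have e2 : ((m' : ℝ) + y) / (q ^ (b - l) : ℕ) / q ^ l = (m' + y) / q ^ b := by
    rw [hpow]; push_cast; field_simp
  have hz' : ((m' : ℝ) / q ^ (b - l)) ∈ Ico (0 : ℝ) 1 := by
    refine ⟨by positivity, ?_⟩
    rw [div_lt_one (by positivity)]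
    exact_mod_cast hm'
  have e3 : ((m * q ^ (b - l) + m' : ℕ) : ℝ) / q ^ b = (m + m' / q ^ (b - l)) / q ^ l := by
    rw [hpow]; push_cast; field_simp
  have e4 : (m' : ℝ) / q ^ b = ((0 : ℕ) + m' / q ^ (b - l)) / q ^ l := by
    rw [hpow]; push_cast; field_simp; ring
  have hlt : m * q ^ (b - l) + m' < q ^ b := by
    rw [hpowN]
    calc m * q ^ (b - l) + m' < m * q ^ (b - l) + q ^ (b - l) := by omega
      _ = (m + 1) * q ^ (b - l) := by ring
      _ ≤ _ := Nat.mul_le_mul_right _ hm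
  have hlt' : m' < q ^ b := by
    rw [hpowN]
    exact hm'.trans_le (Nat.le_mul_of_pos_left _ (pow_pos hq l))
  rw [e1, e2, h _ hlt y hy, h _ hlt' y hy, e3, e4, wal_cell θ hφ hk _ hz', wal_cell θ hφ hk _ hz',
    Nat.cast_zero, zero_div, wal_zero_right θ hφ, map_one, one_mul]

/-- Splitting off the leading digit of `k`. -/
theorem WalshProfile.mod (hφ : φ 0 = 0) {k : ℕ} {Φ : ℝ → ℂ}
    (h : WalshProfile θ φ k (Nat.log q k + 1) Φ) :
    WalshProfile θ φ (k % q ^ Nat.log q k) (Nat.log q k) Φ := by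
  have hq : 0 < q := Nat.pos_of_ne_zero (NeZero.ne q)
  have hq' : (0 : ℝ) < q := Nat.cast_pos.2 hq
  intro m hm z hz
  obtain ⟨c, hc, y, hy, rfl⟩ := exists_cell hq hz
  have s1 := wal_split θ hφ k m ⟨c, hc⟩
  have s2 := wal_split θ hφ k 0 ⟨c, hc⟩
  set n := Nat.log q k
  have e1 : ((m : ℝ) + (c + y) / q) / q ^ n = ((m * q + c : ℕ) + y) / q ^ (n + 1) := by
    rw [pow_succ]; push_cast; field_simp; ring
  have e2 : ((c : ℝ) + y) / q / q ^ n = ((0 * q + c : ℕ) + y) / q ^ (n + 1) := by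
    rw [pow_succ]; push_cast; field_simp; ring
  have hlt : m * q + c < q ^ (n + 1) := by
    rw [pow_succ]
    calc m * q + c < (m + 1) * q := by rw [add_mul, one_mul]; omega
      _ ≤ _ := Nat.mul_le_mul_right _ hm
  have hlt' : 0 * q + c < q ^ (n + 1) := by
    rw [pow_succ, zero_mul, zero_add]
    exact hc.trans_le (Nat.le_mul_of_pos_left _ (pow_pos hq n))
  rw [e1, e2, h _ hlt y hy, h _ hlt' y hy, s1, s2, Nat.cast_zero, zero_div, wal_zero_right θ hφ,
    one_mul, map_mul, mul_assoc]

/-- The integral from an interior point to the right end of a cell inherits the profile. -/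
theorem WalshProfile.integral_tail {k b : ℕ} {Φ : ℝ → ℂ} (h : WalshProfile θ φ k b Φ) {m : ℕ}
    (hm : m < q ^ b) {z : ℝ} (hz : z ∈ Icc (0 : ℝ) 1) :
    ∫ x in ((m + z) / q ^ b : ℝ)..((m + 1) / q ^ b), Φ x =
      (starRingEnd ℂ) (wal θ φ k (m / q ^ b)) * ∫ x in (z / q ^ b : ℝ)..(1 / q ^ b), Φ x := by
  have hq' : (0 : ℝ) < q := Nat.cast_pos.2 (Nat.pos_of_ne_zero (NeZero.ne q))
  have hqb : (0 : ℝ) < q ^ b := by positivity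
  rw [add_comm (m : ℝ) z, add_comm (m : ℝ) 1, add_div, add_div,
    ← intervalIntegral.integral_comp_add_right, ← intervalIntegral.integral_const_mul]
  refine intervalIntegral.integral_congr_ae ?_
  have hne : ∀ᵐ x : ℝ, x ≠ 1 / q ^ b := by simp [ae_iff, measure_singleton]
  filter_upwards [hne] with x hx hx'
  rw [uIoc_of_le (by gcongr; exact hz.2)] at hx'
  have h1 : x * q ^ b ∈ Ico (0 : ℝ) 1 := by
    have h2 : 0 ≤ x := (div_nonneg hz.1 hqb.le).trans hx'.1.le
    have h3 : x < 1 / q ^ b := lt_of_le_of_ne hx'.2 hx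
    exact ⟨by positivity, by rwa [lt_div_iff₀ hqb] at h3⟩
  have h2 := h m hm _ h1
  have e1 : ((m : ℝ) + x * q ^ b) / q ^ b = x + m / q ^ b := by field_simp; ring
  have e2 : x * (q : ℝ) ^ b / q ^ b = x := by field_simp
  rwa [e1, e2] at h2

/-- The leading digit of `k` makes the profile of a lower level have mean zero. -/
theorem WalshProfile.integral_eq_zero (hφ : φ 0 = 0) {k : ℕ} (hk : k ≠ 0) {Φ : ℝ → ℂ}
    (hΦ : ∀ a b, IntervalIntegrable Φ volume a b)
    (h : WalshProfile θ φ k (Nat.log q k + 1) Φ) {m : ℕ} (hm : m < q ^ Nat.log q k) :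
    ∫ x in (m / q ^ Nat.log q k : ℝ)..((m + 1) / q ^ Nat.log q k), Φ x = 0 := by
  have hq1 : 1 < q := one_lt_of_equiv φ
  have hq : 0 < q := by omega
  have hq' : (0 : ℝ) < q := Nat.cast_pos.2 hq
  have h0 := (WalshProfile.mod θ hφ h).integral_tail θ hm (z := 0) (by simp)
  rw [add_zero] at h0
  rw [h0]
  have s : ∀ c : Fin q, _ := fun c => wal_split θ hφ k 0 c
  have hlast : Fin.ofNat q (k / q ^ Nat.log q k) ≠ 0 := by
    have h1 : 0 < k / q ^ Nat.log q k := Nat.div_pos (Nat.pow_log_le_self q hk) (pow_pos hq _)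
    have h2 : k / q ^ Nat.log q k < q := by
      rw [Nat.div_lt_iff_lt_mul (pow_pos hq _), ← pow_succ']
      exact Nat.lt_pow_succ_log_self hq1 k
    intro h3
    have h4 := congrArg Fin.val h3
    simp only [Fin.val_ofNat, Fin.val_zero, Nat.mod_eq_of_lt h2] at h4
    omega
  set n := Nat.log q k
  have hsum : ∑ c ∈ Finset.range q, ∫ x in ((c : ℕ) / q ^ (n + 1) : ℝ)..((c + 1 : ℕ) / q ^ (n + 1)), Φ x
      = ∫ x in (0 / q ^ n : ℝ)..(1 / q ^ n), Φ x := by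
    rw [intervalIntegral.sum_integral_adjacent_intervals
      (a := fun c : ℕ => (c : ℝ) / q ^ (n + 1)) (fun c _ => hΦ _ _)]
    congr 1
    · simp
    · rw [pow_succ]; field_simp
  rw [← hsum, Finset.sum_range]
  have hc : ∀ c : Fin q, ∫ x in ((c : ℕ) / q ^ (n + 1) : ℝ)..(((c : ℕ) + 1 : ℕ) / q ^ (n + 1)), Φ x =
      (starRingEnd ℂ) (digitChar θ φ (Fin.ofNat q (k / q ^ n)) c) *
        ∫ x in (0 / q ^ (n + 1) : ℝ)..(1 / q ^ (n + 1)), Φ x := by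
    intro c
    have hlt : (c : ℕ) < q ^ (n + 1) := by
      rw [pow_succ]
      exact c.2.trans_le (Nat.le_mul_of_pos_left _ (pow_pos hq n))
    have h1 := h.integral_tail θ hlt (z := 0) (by simp)
    have h2 := s c
    simp only [zero_mul, zero_add, Nat.cast_zero, zero_div, wal_zero_right θ hφ, one_mul] at h2
    rw [add_zero, h2] at h1
    push_cast
    exact h1
  rw [Finset.sum_congr rfl fun c _ => hc c, ← Finset.sum_mul, ← map_sum, sum_digitChar θ hφ hlast]
  simp

section Step

variable {k : ℕ} {Φ : ℝ → ℂ}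

/-- If `Φ` has mean zero on all cells, its primitive only depends on `Φ` in the present cell. -/
theorem bint_eq_of_cells {N : ℕ} (hΦ : ∀ a b, IntervalIntegrable Φ volume a b)
    (hz : ∀ m < N, ∫ x in (m / N : ℝ)..((m + 1) / N), Φ x = 0) {m : ℕ} (hm : m < N) (z : ℝ) :
    bint Φ ((m + z) / N) = ∫ x in ((m + z) / N : ℝ)..((m + 1) / N), Φ x := by
  have hN : (N : ℝ) ≠ 0 := Nat.cast_ne_zero.2 (by omega)
  have h1 : ∫ x in ((m + 1) / N : ℝ)..1, Φ x = 0 := by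
    have h2 := intervalIntegral.sum_integral_adjacent_intervals_Ico (μ := volume) (f := Φ)
      (a := fun c : ℕ => (c : ℝ) / N) (m := m + 1) (n := N) hm (fun c _ => hΦ _ _)
    rw [Finset.sum_eq_zero] at h2
    · rw [div_self hN] at h2
      push_cast at h2
      exact h2.symm
    · intro c hc
      have := hz c (Finset.mem_Ico.1 hc).2
      push_cast
      exact this
  rw [bint, ← intervalIntegral.integral_add_adjacent_intervals (hΦ _ ((m + 1) / N)) (hΦ _ _), h1,
    add_zero]

theorem bint_zero_of_cells {N : ℕ} (hN : 0 < N) (hΦ : ∀ a b, IntervalIntegrable Φ volume a b)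
    (hz : ∀ m < N, ∫ x in (m / N : ℝ)..((m + 1) / N), Φ x = 0) : bint Φ 0 = 0 := by
  have h1 := bint_eq_of_cells hΦ hz hN 0
  have h2 := hz 0 hN
  simp only [Nat.cast_zero, zero_add, zero_div] at h1 h2
  rw [h1, h2]

/-- Mean zero on the cells gains their length, the reciprocal of `N`. -/
theorem norm_bint_le_of_cells {N : ℕ} (hN : 0 < N) (hΦ : ∀ a b, IntervalIntegrable Φ volume a b)
    (hz : ∀ m < N, ∫ x in (m / N : ℝ)..((m + 1) / N), Φ x = 0) {B : ℝ}
    (hB : ∀ t ∈ Icc (0 : ℝ) 1, ‖Φ t‖ ≤ B) : ∀ t ∈ Icc (0 : ℝ) 1, ‖bint Φ t‖ ≤ B / N := by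
  have hN' : (0 : ℝ) < N := Nat.cast_pos.2 hN
  have hB0 : 0 ≤ B := (norm_nonneg _).trans (hB 0 (by simp))
  intro t ht
  rcases ht.2.eq_or_lt with rfl | ht1
  · simp only [bint, intervalIntegral.integral_same, norm_zero]
    positivity
  obtain ⟨m, hm, z, hz', rfl⟩ := exists_cell hN ⟨ht.1, ht1⟩
  rw [bint_eq_of_cells hΦ hz hm]
  have hm' : (m : ℝ) + 1 ≤ N := by exact_mod_cast hm
  have hle : ((m : ℝ) + z) / N ≤ (m + 1) / N := by gcongr; exact hz'.2.le
  refine (intervalIntegral.norm_integral_le_of_norm_le_const (C := B) fun x hx => hB x ?_).trans ?_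
  · rw [uIoc_of_le hle] at hx
    exact ⟨ht.1.trans hx.1.le, hx.2.trans (by rwa [div_le_one hN'])⟩
  · rw [abs_of_nonneg (by linarith), ← sub_div, mul_div_assoc']
    gcongr
    nlinarith [hz'.1]

/-- Integration removes the leading digit of `k`. -/
theorem WalshProfile.primitive (hφ : φ 0 = 0) (hk : k ≠ 0)
    (hΦ : ∀ a b, IntervalIntegrable Φ volume a b)
    (h : WalshProfile θ φ k (Nat.log q k + 1) Φ) :
    WalshProfile θ φ (k % q ^ Nat.log q k) (Nat.log q k) (bint Φ) := by
  have hz : ∀ m < q ^ Nat.log q k, ∫ x in (m / (q ^ Nat.log q k : ℕ) : ℝ)..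
      ((m + 1) / (q ^ Nat.log q k : ℕ)), Φ x = 0 := by
    push_cast
    exact fun m hm => h.integral_eq_zero θ hφ hk hΦ hm
  have h' := WalshProfile.mod θ hφ h
  intro m hm y hy
  have h1 := bint_eq_of_cells hΦ hz hm y
  have h2 := bint_eq_of_cells hΦ hz (Nat.pos_of_ne_zero (by omega)) y (m := 0)
  have h3 := h'.integral_tail θ hm (z := y) ⟨hy.1, hy.2.le⟩
  push_cast at h1 h2
  simp only [zero_add] at h2
  rw [h1, h2, h3]

end Step

theorem WalshProfile.oscBound (hφ : φ 0 = 0) {k : ℕ} (hk : k ≠ 0) {Φ : ℝ → ℂ} {B : ℝ}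
    (hΦ : ∀ a b, IntervalIntegrable Φ volume a b) (hB : ∀ t ∈ Icc (0 : ℝ) 1, ‖Φ t‖ ≤ B)
    (h : WalshProfile θ φ k (Nat.log q k + 1) Φ) : OscBound q Φ (Nat.log q k) B := by
  have hz : ∀ m < q ^ Nat.log q k, ∫ x in (m / (q ^ Nat.log q k : ℕ) : ℝ)..
      ((m + 1) / (q ^ Nat.log q k : ℕ)), Φ x = 0 := by
    push_cast
    exact fun m hm => h.integral_eq_zero θ hφ hk hΦ hm
  have h0 : ∫ y in (0 : ℝ)..1, Φ y = 0 :=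
    bint_zero_of_cells (pow_pos (Nat.pos_of_ne_zero (NeZero.ne q)) _) hΦ hz
  refine ⟨hB, hΦ, fun m hm => ?_, Or.inr h0⟩
  simp only [h0, sub_zero]
  exact_mod_cast hz m hm

/-- The decay of the iterated integrals of Walsh functions, in the form needed for the top order
derivatives: each of the first `n` integrations removes the leading digit of the index and gains a
power of `q`, and the next digit is responsible for the oscillation. -/
theorem WalshProfile.exists_oscBound (hφ : φ 0 = 0) (lam : ℝ) (hlam : lam ≤ 1) (n : ℕ) :
    ∀ {k b : ℕ} {Φ : ℝ → ℂ} {B : ℝ}, k < q ^ b → (∀ a b, IntervalIntegrable Φ volume a b) →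
      (∀ t ∈ Icc (0 : ℝ) 1, ‖Φ t‖ ≤ B) → WalshProfile θ φ k b Φ →
      ∃ e M, OscBound q (bint^[n] Φ) e M ∧
        M * (q : ℝ) ^ (-(lam * e)) ≤ (q : ℝ) ^ (n + 1) * B * (q : ℝ) ^ (-mu q lam n k) := by
  have hq1 : 1 < q := one_lt_of_equiv φ
  have hq1' : (1 : ℝ) ≤ q := by exact_mod_cast hq1.le
  have hq' : (0 : ℝ) < q := by linarith
  induction n with
  | zero =>
    intro k b Φ B hk hΦ hB h
    have hB0 : 0 ≤ B := (norm_nonneg _).trans (hB 0 (by simp))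
    rcases eq_or_ne k 0 with rfl | hk0
    · refine ⟨0, B, OscBound.of_bound hB hΦ, ?_⟩
      rw [mu_zero_right]
      simp only [CharP.cast_eq_zero, mul_zero, neg_zero, Real.rpow_zero, mul_one, zero_add, pow_one]
      nlinarith
    · refine ⟨Nat.log q k, B, (h.of_le θ hφ (Nat.lt_pow_succ_log_self hq1 k)
        (Nat.log_lt_of_lt_pow hk0 hk)).oscBound θ hφ hk0 hΦ hB, ?_⟩
      simp only [mu, hk0, if_false, zero_add, pow_one]
      rw [mul_comm (q : ℝ) B, mul_assoc]
      gcongr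
      calc (q : ℝ) ^ (-(lam * Nat.log q k)) ≤ (q : ℝ) ^ (1 + -(lam * (Nat.log q k + 1))) :=
            Real.rpow_le_rpow_of_exponent_le hq1' (by linarith)
        _ = _ := by rw [Real.rpow_add hq', Real.rpow_one]
  | succ n ih =>
    intro k b Φ B hk hΦ hB h
    have hB0 : 0 ≤ B := (norm_nonneg _).trans (hB 0 (by simp))
    rcases eq_or_ne k 0 with rfl | hk0
    · refine ⟨0, B, OscBound.of_bound (norm_bint_iterate_le hB _)
        (intervalIntegrable_bint_iterate hΦ _), ?_⟩
      rw [mu_zero_right]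
      simp only [CharP.cast_eq_zero, mul_zero, neg_zero, Real.rpow_zero, mul_one]
      exact le_mul_of_one_le_left hB0 (one_le_pow₀ hq1')
    · have h1 := h.of_le θ hφ (Nat.lt_pow_succ_log_self hq1 k) (Nat.log_lt_of_lt_pow hk0 hk)
      have hz : ∀ m < q ^ Nat.log q k, ∫ x in (m / (q ^ Nat.log q k : ℕ) : ℝ)..
          ((m + 1) / (q ^ Nat.log q k : ℕ)), Φ x = 0 := by
        push_cast
        exact fun m hm => h1.integral_eq_zero θ hφ hk0 hΦ hm
      have hpos : 0 < q ^ Nat.log q k := pow_pos (by omega) _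
      obtain ⟨e, M, h2, h3⟩ := ih (Nat.mod_lt k hpos) (intervalIntegrable_bint hΦ)
        (norm_bint_le_of_cells hpos hΦ hz hB) (h1.primitive θ hφ hk0 hΦ)
      refine ⟨e, M, h2, h3.trans_eq ?_⟩
      rw [rpow_neg_mu_succ (by omega) lam _ hk0]
      push_cast
      field_simp
      ring

/-- The iterated integrals of Walsh functions at `0`: they vanish as long as there are digits left,
and otherwise they have the full decay. -/
theorem WalshProfile.norm_bint_iterate_zero_le (hφ : φ 0 = 0) (lam : ℝ) (n : ℕ) :
    ∀ {k b d : ℕ} {Φ : ℝ → ℂ} {B : ℝ}, n + 1 ≤ d → k < q ^ b →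
      (∀ a b, IntervalIntegrable Φ volume a b) →
      (∀ t ∈ Icc (0 : ℝ) 1, ‖Φ t‖ ≤ B) → WalshProfile θ φ k b Φ →
      ‖bint^[n + 1] Φ 0‖ ≤ (q : ℝ) ^ (n + 1) * B * (q : ℝ) ^ (-mu q lam d k) := by
  have hq1 : 1 < q := one_lt_of_equiv φ
  have hq1' : (1 : ℝ) ≤ q := by exact_mod_cast hq1.le
  have hq' : (0 : ℝ) < q := by linarith
  have hzero : ∀ {n d : ℕ} {Φ : ℝ → ℂ} {B : ℝ}, (∀ t ∈ Icc (0 : ℝ) 1, ‖Φ t‖ ≤ B) →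
      ‖bint^[n] Φ 0‖ ≤ (q : ℝ) ^ n * B * (q : ℝ) ^ (-mu q lam d 0) := by
    intro n d Φ B hB
    have hB0 : 0 ≤ B := (norm_nonneg _).trans (hB 0 (by simp))
    rw [mu_zero_right, neg_zero, Real.rpow_zero, mul_one]
    exact (norm_bint_iterate_le hB _ 0 (by simp)).trans
      (le_mul_of_one_le_left hB0 (one_le_pow₀ hq1'))
  induction n with
  | zero =>
    intro k b d Φ B hd hk hΦ hB h
    have hB0 : 0 ≤ B := (norm_nonneg _).trans (hB 0 (by simp))
    rcases eq_or_ne k 0 with rfl | hk0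
    · exact hzero hB
    · have h1 := h.of_le θ hφ (Nat.lt_pow_succ_log_self hq1 k) (Nat.log_lt_of_lt_pow hk0 hk)
      have hz : ∀ m < q ^ Nat.log q k, ∫ x in (m / (q ^ Nat.log q k : ℕ) : ℝ)..
          ((m + 1) / (q ^ Nat.log q k : ℕ)), Φ x = 0 := by
        push_cast
        exact fun m hm => h1.integral_eq_zero θ hφ hk0 hΦ hm
      have h2 := bint_zero_of_cells (pow_pos (by omega) _) hΦ hz
      simp only [zero_add, Function.iterate_one, h2, norm_zero]
      positivity
  | succ n ih =>
    intro k b d Φ B hd hk hΦ hB h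
    rcases eq_or_ne k 0 with rfl | hk0
    · exact hzero hB
    · obtain ⟨d, rfl⟩ : ∃ d', d = d' + 1 := ⟨d - 1, by omega⟩
      have h1 := h.of_le θ hφ (Nat.lt_pow_succ_log_self hq1 k) (Nat.log_lt_of_lt_pow hk0 hk)
      have hz : ∀ m < q ^ Nat.log q k, ∫ x in (m / (q ^ Nat.log q k : ℕ) : ℝ)..
          ((m + 1) / (q ^ Nat.log q k : ℕ)), Φ x = 0 := by
        push_cast
        exact fun m hm => h1.integral_eq_zero θ hφ hk0 hΦ hm
      have hpos : 0 < q ^ Nat.log q k := pow_pos (by omega) _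
      have h3 := ih (d := d) (by omega) (Nat.mod_lt k hpos) (intervalIntegrable_bint hΦ)
        (norm_bint_le_of_cells hpos hΦ hz hB) (h1.primitive θ hφ hk0 hΦ)
      rw [Function.iterate_succ_apply]
      refine h3.trans_eq ?_
      rw [rpow_neg_mu_succ (by omega) lam _ hk0]
      push_cast
      field_simp
      ring

end Walsh

/-! ### Functions of mean zero as superpositions of differences over long intervals -/

/-- Lebesgue measure on `[0,1)`. -/
noncomputable abbrev vol01 : Measure ℝ := volume.restrict (Ico 0 1)

instance : IsProbabilityMeasure vol01 := ⟨by simp [vol01]⟩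

/-- `W` is an antisymmetric kernel with marginal `K` that charges only pairs of points at distance
at least `1 / 4`: integrating a function against `K` amounts to integrating half of its differences
against `W`. -/
structure IsDiffKernel (K : ℝ → ℂ) (W : ℝ × ℝ → ℂ) (C : ℝ) : Prop where
  measurable : Measurable W
  bound : ∀ x, ‖W x‖ ≤ C
  antisymm : ∀ x, W x.swap = -W x
  far : ∀ x, W x ≠ 0 → 1 / 4 ≤ |x.1 - x.2|
  marginal : ∀ t ∈ Ico (0 : ℝ) 1, ∫ s, W (t, s) ∂vol01 = K t

theorem integrableOn_of_bound {K : ℝ → ℂ} {M : ℝ} {A : Set ℝ} (hA : MeasurableSet A)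
    (hAs : A ⊆ Ico 0 1) (hK : Measurable K) (hM : ∀ t ∈ Ico (0 : ℝ) 1, ‖K t‖ ≤ M) :
    IntegrableOn K A vol01 := by
  refine Measure.integrableOn_of_bounded (measure_ne_top _ _) hK.aestronglyMeasurable (M := M) ?_
  rw [ae_restrict_iff' hA]
  exact Filter.Eventually.of_forall fun t ht => hM t (hAs ht)

/-- A function of mean zero which vanishes outside two distant sets `A` and `B`. -/
theorem exists_isDiffKernel_of_two_sets {A B : Set ℝ} (hA : MeasurableSet A) (hB : MeasurableSet B)
    (hAs : A ⊆ Ico 0 1) (hBs : B ⊆ Ico 0 1) (hfar : ∀ t ∈ A, ∀ s ∈ B, 1 / 4 ≤ |t - s|)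
    (hAv : vol01.real A = 1 / 4) (hBv : vol01.real B = 1 / 2) {K : ℝ → ℂ} {M : ℝ}
    (hK : Measurable K) (hM : ∀ t ∈ Ico (0 : ℝ) 1, ‖K t‖ ≤ M)
    (hsupp : ∀ t, t ∉ A → t ∉ B → K t = 0)
    (h0 : ∫ t in A, K t ∂vol01 + ∫ t in B, K t ∂vol01 = 0) :
    ∃ W, IsDiffKernel K W (8 * M) := by
  classical
  have hdisj : ∀ t, t ∈ A → t ∉ B := by
    intro t h1 h2
    have := hfar t h1 t h2
    norm_num at this
  have hM0 : 0 ≤ M := (norm_nonneg _).trans (hM 0 (by simp))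
  have hKA := integrableOn_of_bound hA hAs hK hM
  have hKB := integrableOn_of_bound hB hBs hK hM
  set m := ∫ t in A, K t ∂vol01 with hm
  have hB' : ∫ t in B, K t ∂vol01 = -m := by linear_combination h0
  have hmle : ‖m‖ ≤ M / 4 := by
    have h1 := norm_setIntegral_le_of_norm_le_const (μ := vol01) (s := A) (f := K) (C := M)
      (measure_lt_top _ _) (fun t ht => hM t (hAs ht))
    rw [hAv] at h1
    linarith
  -- The coefficients `2` and `4` are the reciprocals of the measures of `B` and `A`; the constant
  -- `8 * m` compensates the terms that remain after integration over one of the two sets.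
  let w : ℝ → ℝ → ℂ := fun t s => 2 * K t - 4 * K s - 8 * m
  have hw : ∀ t ∈ A, ∀ s ∈ B, ‖w t s‖ ≤ 8 * M := by
    intro t ht s hs
    calc ‖w t s‖ ≤ ‖2 * K t‖ + ‖4 * K s‖ + ‖8 * m‖ :=
          (norm_sub_le _ _).trans (by gcongr; exact norm_sub_le _ _)
      _ = 2 * ‖K t‖ + 4 * ‖K s‖ + 8 * ‖m‖ := by simp
      _ ≤ _ := by linarith [hM t (hAs ht), hM s (hBs hs)]
  let W0 : ℝ → ℝ → ℂ := fun t s => A.indicator 1 t * B.indicator 1 s * w t s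
  have hW0 : ∀ t s, ¬ (t ∈ A ∧ s ∈ B) → W0 t s = 0 := by
    intro t s h
    by_cases ht : t ∈ A
    · have : s ∉ B := fun hs => h ⟨ht, hs⟩
      simp [W0, this]
    · simp [W0, ht]
  have hW0' : ∀ t ∈ A, ∀ s ∈ B, W0 t s = w t s := by
    intro t ht s hs
    simp [W0, ht, hs]
  have hmeas : Measurable fun x : ℝ × ℝ => W0 x.1 x.2 := by
    have i1 : Measurable (A.indicator (1 : ℝ → ℂ)) := measurable_one.indicator hA
    have i2 : Measurable (B.indicator (1 : ℝ → ℂ)) := measurable_one.indicator hB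
    have k1 : Measurable fun x : ℝ × ℝ => K x.1 := hK.comp measurable_fst
    have k2 : Measurable fun x : ℝ × ℝ => K x.2 := hK.comp measurable_snd
    exact Measurable.mul (Measurable.mul (i1.comp measurable_fst) (i2.comp measurable_snd))
      (((k1.const_mul 2).sub (k2.const_mul 4)).sub_const (8 * m))
  clear_value W0
  refine ⟨fun x => W0 x.1 x.2 - W0 x.2 x.1, ?_, ?_, ?_, ?_, ?_⟩
  · exact hmeas.sub (hmeas.comp measurable_swap)
  · rintro ⟨t, s⟩
    simp only
    by_cases h1 : t ∈ A ∧ s ∈ B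
    · rw [hW0 s t (fun h => hdisj _ h1.1 h.2), sub_zero, hW0' _ h1.1 _ h1.2]
      exact hw _ h1.1 _ h1.2
    · rw [hW0 t s h1, zero_sub, norm_neg]
      by_cases h2 : s ∈ A ∧ t ∈ B
      · rw [hW0' _ h2.1 _ h2.2]
        exact hw _ h2.1 _ h2.2
      · rw [hW0 s t h2, norm_zero]
        positivity
  · rintro ⟨t, s⟩
    simp
  · rintro ⟨t, s⟩ h
    simp only at h ⊢
    by_contra! h3
    have h1 : ¬ (t ∈ A ∧ s ∈ B) := fun h => absurd (hfar _ h.1 _ h.2) (not_le.2 h3)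
    have h2 : ¬ (s ∈ A ∧ t ∈ B) := fun h =>
      absurd (hfar _ h.1 _ h.2) (not_le.2 (by rwa [abs_sub_comm]))
    exact h (by rw [hW0 t s h1, hW0 s t h2, sub_zero])
  · intro t _
    by_cases ht : t ∈ A
    · have e1 : (fun s => W0 t s - W0 s t) = B.indicator fun s => w t s := by
        ext s
        rw [hW0 s t (fun h => hdisj _ ht h.2), sub_zero]
        by_cases hs : s ∈ B
        · simp [hW0' _ ht _ hs, hs]
        · simp [hW0 t s (fun h => hs h.2), hs]
      rw [e1, integral_indicator hB]
      have e2 : (fun s => w t s) = fun s => (2 * K t - 8 * m) - 4 * K s := by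
        ext s; simp only [w]; ring
      rw [e2, integral_sub (integrable_const _) (hKB.const_mul _), integral_const_mul, hB',
        setIntegral_const, hBv]
      simp only [Complex.real_smul]
      push_cast
      ring
    · by_cases ht' : t ∈ B
      · have e1 : (fun s => W0 t s - W0 s t) = A.indicator fun s => -w s t := by
          ext s
          rw [hW0 t s (fun h => ht h.1), zero_sub]
          by_cases hs : s ∈ A
          · simp [hW0' _ hs _ ht', hs]
          · simp [hW0 s t (fun h => hs h.1), hs]
        rw [e1, integral_indicator hA]
        have e2 : (fun s => -w s t) = fun s => (4 * K t + 8 * m) - 2 * K s := by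
          ext s; simp only [w]; ring
        rw [e2, integral_sub (integrable_const _) (hKA.const_mul _), integral_const_mul, ← hm,
          setIntegral_const, hAv]
        simp only [Complex.real_smul]
        push_cast
        ring
      · have e1 : (fun s => W0 t s - W0 s t) = fun _ => 0 := by
          ext s
          rw [hW0 t s (fun h => ht h.1), hW0 s t (fun h => ht' h.2), sub_zero]
        rw [e1, hsupp t ht ht', integral_zero]

theorem IsDiffKernel.add {K K' : ℝ → ℂ} {W W' : ℝ × ℝ → ℂ} {C C' : ℝ} (h : IsDiffKernel K W C)
    (h' : IsDiffKernel K' W' C') : IsDiffKernel (K + K') (W + W') (C + C') where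
  measurable := h.measurable.add h'.measurable
  bound x := (norm_add_le _ _).trans (add_le_add (h.bound x) (h'.bound x))
  antisymm x := by simp only [Pi.add_apply, h.antisymm, h'.antisymm]; ring
  far x hx := by
    by_cases h0 : W x = 0
    · refine h'.far x fun h1 => hx ?_
      simp [h0, h1]
    · exact h.far x h0
  marginal t ht := by
    have hi : ∀ {W : ℝ × ℝ → ℂ} {C : ℝ}, Measurable W → (∀ x, ‖W x‖ ≤ C) →
        Integrable (fun s => W (t, s)) vol01 := fun hm hb =>
      Integrable.of_bound (hm.comp measurable_prodMk_left).aestronglyMeasurable _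
        (Filter.Eventually.of_forall fun s => hb (t, s))
    simp only [Pi.add_apply]
    rw [integral_add (hi h.measurable h.bound) (hi h'.measurable h'.bound), h.marginal t ht,
      h'.marginal t ht]

theorem vol01_real_Ico {a b : ℝ} (h0 : 0 ≤ a) (hab : a ≤ b) (h1 : b ≤ 1) :
    vol01.real (Ico a b) = b - a := by
  rw [Measure.real, Measure.restrict_apply measurableSet_Ico,
    inter_eq_left.2 (Ico_subset_Ico h0 h1), Real.volume_Ico, ENNReal.toReal_ofReal (by linarith)]

/-- Every bounded function of mean zero has a difference kernel. Adjacent quarters of `[0,1)` are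
not distant, so that the mass of the second quarter is first moved to the fourth. -/
theorem exists_isDiffKernel {K : ℝ → ℂ} {M : ℝ} (hK : Measurable K)
    (hM : ∀ t ∈ Ico (0 : ℝ) 1, ‖K t‖ ≤ M) (h0 : ∫ t, K t ∂vol01 = 0) :
    ∃ W, IsDiffKernel K W (32 * M) := by
  have hM0 : 0 ≤ M := (norm_nonneg _).trans (hM 0 (by simp))
  set c := 4 * ∫ t in Ico (1 / 4 : ℝ) (1 / 2), K t ∂vol01 with hc
  have hint : ∀ {f : ℝ → ℂ} {N a b : ℝ}, 0 ≤ a → b ≤ 1 → Measurable f →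
      (∀ t ∈ Ico (0 : ℝ) 1, ‖f t‖ ≤ N) → IntegrableOn f (Ico a b) vol01 :=
    fun ha hb hf hN => integrableOn_of_bound measurableSet_Ico (Ico_subset_Ico ha hb) hf hN
  have hcM : ‖c‖ ≤ M := by
    have h1 := norm_setIntegral_le_of_norm_le_const (μ := vol01) (s := Ico (1 / 4 : ℝ) (1 / 2))
      (f := K) (C := M) (measure_lt_top _ _)
      (fun t ht => hM t ⟨by linarith [ht.1], by linarith [ht.2]⟩)
    rw [vol01_real_Ico (by norm_num) (by norm_num) (by norm_num)] at h1
    rw [hc, norm_mul]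
    norm_num at h1 ⊢
    linarith
  have hsplit : ∀ {f : ℝ → ℂ} {N a b d : ℝ}, 0 ≤ a → a ≤ b → b ≤ d → d ≤ 1 → Measurable f →
      (∀ t ∈ Ico (0 : ℝ) 1, ‖f t‖ ≤ N) → ∫ t in Ico a d, f t ∂vol01 =
        ∫ t in Ico a b, f t ∂vol01 + ∫ t in Ico b d, f t ∂vol01 := by
    intro f N a b d h1 h2 h3 h4 hf hN
    rw [← Ico_union_Ico_eq_Ico h2 h3]
    exact setIntegral_union (Ico_disjoint_Ico_same) measurableSet_Ico
      (hint h1 (h3.trans h4) hf hN) (hint (h1.trans h2) h4 hf hN)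
  have hK2 : Measurable ((Ico (1 / 4 : ℝ) (1 / 2)).indicator K -
      (Ico (3 / 4 : ℝ) 1).indicator fun _ => c) :=
    (hK.indicator measurableSet_Ico).sub (measurable_const.indicator measurableSet_Ico)
  set K2 := (Ico (1 / 4 : ℝ) (1 / 2)).indicator K - (Ico (3 / 4 : ℝ) 1).indicator fun _ => c
    with hK2d
  have hM2 : ∀ t ∈ Ico (0 : ℝ) 1, ‖K2 t‖ ≤ 2 * M := by
    intro t ht
    have n1 : ‖(Ico (1 / 4 : ℝ) (1 / 2)).indicator K t‖ ≤ M :=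
      (norm_indicator_le_norm_self _ _).trans (hM t ht)
    have n2 : ‖(Ico (3 / 4 : ℝ) 1).indicator (fun _ => c) t‖ ≤ M :=
      (norm_indicator_le_norm_self _ _).trans hcM
    exact (norm_sub_le _ _).trans (by linarith)
  set K1 := (Ico (0 : ℝ) 1).indicator K - K2 with hK1d
  have hK1 : Measurable K1 := (hK.indicator measurableSet_Ico).sub hK2
  have hM1 : ∀ t ∈ Ico (0 : ℝ) 1, ‖K1 t‖ ≤ 2 * M := by
    intro t ht
    have e : K1 t = (Ico (1 / 4 : ℝ) (1 / 2))ᶜ.indicator K t +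
        (Ico (3 / 4 : ℝ) 1).indicator (fun _ => c) t := by
      simp only [hK1d, hK2d, Pi.sub_apply, indicator_of_mem ht, indicator_compl]
      ring
    have n1 : ‖(Ico (1 / 4 : ℝ) (1 / 2))ᶜ.indicator K t‖ ≤ M :=
      (norm_indicator_le_norm_self _ _).trans (hM t ht)
    have n2 : ‖(Ico (3 / 4 : ℝ) 1).indicator (fun _ => c) t‖ ≤ M :=
      (norm_indicator_le_norm_self _ _).trans hcM
    rw [e]
    exact (norm_add_le _ _).trans (by linarith)
  have v1 : ∀ {a b : ℝ}, 0 ≤ a → a ≤ b → b ≤ 1 → vol01.real (Ico a b) = b - a :=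
    fun h1 h2 h3 => vol01_real_Ico h1 h2 h3
  -- integrals of the pieces over quarters
  have i2q2 : ∫ t in Ico (1 / 4 : ℝ) (1 / 2), K2 t ∂vol01 = c / 4 := by
    have : ∫ t in Ico (1 / 4 : ℝ) (1 / 2), K2 t ∂vol01 =
        ∫ t in Ico (1 / 4 : ℝ) (1 / 2), K t ∂vol01 := by
      refine setIntegral_congr_fun measurableSet_Ico fun t ht => ?_
      have : t ∉ Ico (3 / 4 : ℝ) 1 := fun h => by linarith [h.1, ht.2]
      simp only [hK2d, Pi.sub_apply, indicator_of_mem ht, indicator_of_notMem this, sub_zero]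
    rw [this, hc]; ring
  have i2q1 : ∫ t in Ico (0 : ℝ) (1 / 4), K2 t ∂vol01 = 0 := by
    rw [setIntegral_eq_zero_of_forall_eq_zero]
    intro t ht
    have h1 : t ∉ Ico (3 / 4 : ℝ) 1 := fun h => by linarith [h.1, ht.2]
    have h2 : t ∉ Ico (1 / 4 : ℝ) (1 / 2) := fun h => by linarith [h.1, ht.2]
    simp only [hK2d, Pi.sub_apply, indicator_of_notMem h1, indicator_of_notMem h2, sub_self]
  have i2q4 : ∫ t in Ico (3 / 4 : ℝ) 1, K2 t ∂vol01 = -(c / 4) := by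
    have : ∫ t in Ico (3 / 4 : ℝ) 1, K2 t ∂vol01 = ∫ t in Ico (3 / 4 : ℝ) 1, -c ∂vol01 := by
      refine setIntegral_congr_fun measurableSet_Ico fun t ht => ?_
      have : t ∉ Ico (1 / 4 : ℝ) (1 / 2) := fun h => by linarith [h.2, ht.1]
      simp only [hK2d, Pi.sub_apply, indicator_of_mem ht, indicator_of_notMem this, zero_sub]
    rw [this, setIntegral_const, v1 (by norm_num) (by norm_num) le_rfl]
    norm_num
    ring
  have i2tot : ∫ t, K2 t ∂vol01 = 0 := by
    have e : ∫ t, K2 t ∂vol01 = ∫ t in Ico (0 : ℝ) 1, K2 t ∂vol01 := by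
      simp [vol01, Measure.restrict_restrict]
    have i2q3 : ∫ t in Ico (1 / 2 : ℝ) (3 / 4), K2 t ∂vol01 = 0 := by
      rw [setIntegral_eq_zero_of_forall_eq_zero]
      intro t ht
      have h1 : t ∉ Ico (3 / 4 : ℝ) 1 := fun h => by linarith [h.1, ht.2]
      have h2 : t ∉ Ico (1 / 4 : ℝ) (1 / 2) := fun h => by linarith [h.2, ht.1]
      simp only [hK2d, Pi.sub_apply, indicator_of_notMem h1, indicator_of_notMem h2, sub_self]
    rw [e, hsplit (b := 1 / 2) le_rfl (by norm_num) (by norm_num) le_rfl hK2 hM2,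
      hsplit (b := 1 / 4) le_rfl (by norm_num) (by norm_num) (by norm_num) hK2 hM2,
      hsplit (a := 1 / 2) (b := 3 / 4) (by norm_num) (by norm_num) (by norm_num) le_rfl hK2 hM2,
      i2q1, i2q2, i2q3, i2q4]
    ring
  have hK0 : ∀ t, t ∉ Ico (0 : ℝ) 1 → K2 t = 0 := by
    intro t ht
    have h1 : t ∉ Ico (3 / 4 : ℝ) 1 := fun h => ht ⟨by linarith [h.1], h.2⟩
    have h2 : t ∉ Ico (1 / 4 : ℝ) (1 / 2) := fun h => ht ⟨by linarith [h.1], by linarith [h.2]⟩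
    simp only [hK2d, Pi.sub_apply, indicator_of_notMem h1, indicator_of_notMem h2, sub_self]
  obtain ⟨W2, hW2⟩ := exists_isDiffKernel_of_two_sets (A := Ico (3 / 4 : ℝ) 1)
    (B := Ico (0 : ℝ) (1 / 2)) measurableSet_Ico measurableSet_Ico
    (Ico_subset_Ico (by norm_num) le_rfl) (Ico_subset_Ico le_rfl (by norm_num))
    (fun t ht s hs => le_abs.2 (Or.inl (by linarith [ht.1, hs.2])))
    (by rw [v1] <;> norm_num) (by rw [v1] <;> norm_num) hK2 hM2
    (by
      intro t h1 h2
      have h3 : t ∉ Ico (1 / 4 : ℝ) (1 / 2) := fun h => h2 ⟨by linarith [h.1], h.2⟩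
      simp only [hK2d, Pi.sub_apply, indicator_of_notMem h1, indicator_of_notMem h3, sub_self])
    (by
      rw [hsplit (b := 1 / 4) le_rfl (by norm_num) (by norm_num) (by norm_num) hK2 hM2, i2q1, i2q2,
        i2q4]
      ring)
  have i1tot : ∫ t in Ico (0 : ℝ) 1, K1 t ∂vol01 = 0 := by
    have e : ∫ t in Ico (0 : ℝ) 1, K1 t ∂vol01 = ∫ t, K1 t ∂vol01 := by
      simp [vol01, Measure.restrict_restrict]
    have e' : ∫ t, (Ico (0 : ℝ) 1).indicator K t ∂vol01 = ∫ t, K t ∂vol01 := by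
      rw [integral_indicator measurableSet_Ico]
      simp [vol01, Measure.restrict_restrict]
    have j1 : Integrable ((Ico (0 : ℝ) 1).indicator K) vol01 :=
      (integrable_indicator_iff measurableSet_Ico).2 (hint le_rfl le_rfl hK hM)
    have j2 : Integrable K2 vol01 := by
      have := hint le_rfl le_rfl hK2 hM2
      simpa [IntegrableOn, vol01, Measure.restrict_restrict] using this
    rw [e, hK1d, integral_sub' j1 j2, e', h0, i2tot, sub_zero]
  have i1q2 : ∫ t in Ico (1 / 4 : ℝ) (1 / 2), K1 t ∂vol01 = 0 := by
    rw [setIntegral_eq_zero_of_forall_eq_zero]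
    intro t ht
    have h1 : t ∉ Ico (3 / 4 : ℝ) 1 := fun h => by linarith [h.1, ht.2]
    have h2 : t ∈ Ico (0 : ℝ) 1 := ⟨by linarith [ht.1], by linarith [ht.2]⟩
    simp only [hK1d, hK2d, Pi.sub_apply, indicator_of_notMem h1,
      indicator_of_mem ht, indicator_of_mem h2, sub_zero, sub_self]
  obtain ⟨W1, hW1⟩ := exists_isDiffKernel_of_two_sets (A := Ico (0 : ℝ) (1 / 4))
    (B := Ico (1 / 2 : ℝ) 1) measurableSet_Ico measurableSet_Ico
    (Ico_subset_Ico le_rfl (by norm_num)) (Ico_subset_Ico (by norm_num) le_rfl)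
    (fun t ht s hs => le_abs.2 (Or.inr (by linarith [ht.2, hs.1])))
    (by rw [v1] <;> norm_num) (by rw [v1] <;> norm_num) hK1 hM1
    (by
      intro t h1 h2
      by_cases ht : t ∈ Ico (0 : ℝ) 1
      · have h3 : t ∈ Ico (1 / 4 : ℝ) (1 / 2) := by
          constructor
          · by_contra! h; exact h1 ⟨ht.1, h⟩
          · by_contra! h; exact h2 ⟨h, ht.2⟩
        have h4 : t ∉ Ico (3 / 4 : ℝ) 1 := fun h => by linarith [h.1, h3.2]
        simp only [hK1d, hK2d, Pi.sub_apply, indicator_of_mem ht, indicator_of_mem h3,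
          indicator_of_notMem h4, sub_zero, sub_self]
      · simp only [hK1d, Pi.sub_apply, hK0 t ht, indicator_of_notMem ht, sub_zero])
    (by
      rw [hsplit (b := 1 / 2) le_rfl (by norm_num) (by norm_num) le_rfl hK1 hM1,
        hsplit (b := 1 / 4) le_rfl (by norm_num) (by norm_num) (by norm_num) hK1 hM1, i1q2,
        add_zero] at i1tot
      exact i1tot)
  have h := hW1.add hW2
  rw [hK1d, sub_add_cancel] at h
  refine ⟨W1 + W2, h.measurable, fun x => (h.bound x).trans (by linarith), h.antisymm, h.far,
    fun t ht => (h.marginal t ht).trans (indicator_of_mem ht K)⟩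

/-! ### Decomposition of the cube into cells -/

section Cells

variable {ι : Type*}

/-- Lebesgue measure on the unit cube, as a product of measures. -/
noncomputable abbrev cubeMeasure (ι : Type*) [Fintype ι] : Measure (ι → ℝ) :=
  Measure.pi fun _ : ι => vol01

/-- Lebesgue measure on `([0,1)²)^ι`, whose points are pairs of opposite vertices of boxes. -/
noncomputable abbrev pairMeasure (ι : Type*) [Fintype ι] : Measure (ι → ℝ × ℝ) :=
  Measure.pi fun _ : ι => vol01.prod vol01

theorem restrict_cube [Fintype ι] :
    (volume : Measure (ι → ℝ)).restrict (cube ι) = cubeMeasure ι := by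
  rw [cube, volume_pi, Measure.restrict_pi_pi]

theorem ae_mem_cube [Fintype ι] : ∀ᵐ x ∂cubeMeasure ι, x ∈ cube ι := by
  rw [← restrict_cube]
  exact ae_restrict_mem (MeasurableSet.univ_pi fun _ => measurableSet_Ico)

/-- The point of relative position `y` in the cell with index `m`, if the `j`-th side of the cube is
cut into `N j` equal parts. -/
noncomputable def cellPt (N m : ι → ℕ) (y : ι → ℝ) : ι → ℝ := fun j => (m j + y j) / N j

/-- The indices of the cells. -/
def cells [Fintype ι] [DecidableEq ι] (N : ι → ℕ) : Finset (ι → ℕ) :=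
  Fintype.piFinset fun j => Finset.range (N j)

theorem mem_cells [Fintype ι] [DecidableEq ι] {N m : ι → ℕ} : m ∈ cells N ↔ ∀ j, m j < N j := by
  simp [cells, Fintype.mem_piFinset]

theorem measurePreserving_cell {N : ℕ} (hN : 0 < N) (m : ℕ) :
    MeasurePreserving (fun z : ℝ => (m + z) / N) ((N : ℝ≥0)⁻¹ • vol01)
      (volume.restrict (Ico (m / N : ℝ) ((m + 1) / N))) := by
  have hN' : (0 : ℝ) < N := Nat.cast_pos.2 hN
  have hmeas : Measurable fun z : ℝ => (m + z) / N := by fun_prop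
  refine ⟨hmeas, ?_⟩
  ext s hs
  have h1 : (volume : Measure ℝ) = ENNReal.ofReal |(N : ℝ)⁻¹| •
      Measure.map (fun z : ℝ => z * (N : ℝ)⁻¹ ) volume :=
    (Real.smul_map_volume_mul_right (inv_ne_zero hN'.ne')).symm
  have h2 : Measure.map (fun z : ℝ => (m : ℝ) + z) volume = volume :=
    (measurePreserving_add_left volume (m : ℝ)).map_eq
  have h3 : (volume : Measure ℝ) = ENNReal.ofReal |(N : ℝ)⁻¹| •
      Measure.map (fun z : ℝ => (m + z) / N) volume := by
    have : (fun z : ℝ => ((m : ℝ) + z) / N) = (fun z => z * (N : ℝ)⁻¹) ∘ fun z => m + z := by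
      ext z; simp [div_eq_mul_inv]
    rw [this, ← Measure.map_map (by fun_prop) (by fun_prop), h2]
    exact h1
  rw [Measure.map_apply hmeas hs, Measure.restrict_apply hs, Measure.smul_apply,
    Measure.restrict_apply (hmeas hs)]
  conv_rhs => rw [h3]
  rw [Measure.smul_apply, Measure.map_apply hmeas (hs.inter measurableSet_Ico)]
  have h4 : (fun z : ℝ => ((m : ℝ) + z) / N) ⁻¹' (s ∩ Ico (m / N : ℝ) ((m + 1) / N)) =
      (fun z : ℝ => ((m : ℝ) + z) / N) ⁻¹' s ∩ Ico 0 1 := by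
    ext z
    simp only [mem_preimage, mem_inter_iff, mem_Ico, div_le_div_iff_of_pos_right hN',
      div_lt_div_iff_of_pos_right hN', le_add_iff_nonneg_right, add_lt_add_iff_left]
  rw [h4, abs_of_pos (inv_pos.2 hN'), ENNReal.smul_def, smul_eq_mul, smul_eq_mul]
  congr 1
  rw [ENNReal.coe_inv (by exact_mod_cast hN.ne'), ENNReal.ofReal_inv_of_pos hN']
  simp

theorem pi_smul_measure [Fintype ι] (c : ι → ℝ≥0) :
    (Measure.pi fun j => c j • vol01) = (∏ j, c j) • cubeMeasure ι := by
  refine Measure.pi_eq fun s _ => ?_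
  simp only [Measure.smul_apply, Measure.pi_pi, ENNReal.smul_def, smul_eq_mul,
    Finset.prod_mul_distrib]
  push_cast
  rfl

theorem measurePreserving_cellPt [Fintype ι] {N : ι → ℕ} (hN : ∀ j, 0 < N j) (m : ι → ℕ) :
    MeasurePreserving (cellPt N m) ((∏ j, (N j : ℝ≥0)⁻¹) • cubeMeasure ι)
      (volume.restrict (box (fun j => (m j / N j : ℝ)) fun j => (m j + 1) / N j)) := by
  rw [← pi_smul_measure, box, volume_pi, Measure.restrict_pi_pi]
  exact measurePreserving_pi _ _ fun j => measurePreserving_cell (hN j) (m j)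

theorem disjoint_cells {N : ι → ℕ} (hN : ∀ j, 0 < N j) {m m' : ι → ℕ} (h : m ≠ m') :
    Disjoint (box (fun j => (m j / N j : ℝ)) (fun j => (m j + 1) / N j))
      (box (fun j => (m' j / N j : ℝ)) (fun j => (m' j + 1) / N j)) := by
  rw [Set.disjoint_left]
  intro x hx hx'
  apply h
  ext j
  have hN' : (0 : ℝ) < N j := Nat.cast_pos.2 (hN j)
  simp only [box, mem_univ_pi] at hx hx'
  have h1 := hx j
  have h2 := hx' j
  rw [mem_Ico, div_le_iff₀ hN', lt_div_iff₀ hN'] at h1 h2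
  have h3 : (m j : ℝ) < m' j + 1 := h1.1.trans_lt h2.2
  have h4 : (m' j : ℝ) < m j + 1 := h2.1.trans_lt h1.2
  have h5 : m j < m' j + 1 := by exact_mod_cast h3
  have h6 : m' j < m j + 1 := by exact_mod_cast h4
  omega

theorem measurableSet_box [Fintype ι] (a b : ι → ℝ) : MeasurableSet (box a b) :=
  MeasurableSet.univ_pi fun _ => measurableSet_Ico

variable [Fintype ι] [DecidableEq ι]

theorem biUnion_cells {N : ι → ℕ} (hN : ∀ j, 0 < N j) :
    ⋃ m ∈ cells N, box (fun j => (m j / N j : ℝ)) (fun j => (m j + 1) / N j) = cube ι := by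
  ext x
  simp only [mem_iUnion, mem_cells, box, cube, mem_univ_pi, exists_prop]
  constructor
  · rintro ⟨m, hm, hx⟩ j
    have hN' : (0 : ℝ) < N j := Nat.cast_pos.2 (hN j)
    have h1 : (m j : ℝ) + 1 ≤ N j := by exact_mod_cast hm j
    exact ⟨le_trans (by positivity) (hx j).1, (hx j).2.trans_le (by rwa [div_le_one hN'])⟩
  · intro hx
    choose m hm y hy h using fun j => exists_cell (hN j) (hx j)
    refine ⟨m, hm, fun j => ?_⟩
    have hN' : (0 : ℝ) < N j := Nat.cast_pos.2 (hN j)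
    rw [h j]
    exact ⟨by gcongr; linarith [(hy j).1], by gcongr; exact (hy j).2⟩

theorem quasiMeasurePreserving_cellPt {N : ι → ℕ} (hN : ∀ j, 0 < N j) {m : ι → ℕ}
    (hm : m ∈ cells N) :
    Measure.QuasiMeasurePreserving (cellPt N m) (cubeMeasure ι) (cubeMeasure ι) := by
  have h1 := (measurePreserving_cellPt hN m).quasiMeasurePreserving
  refine ⟨h1.1, ?_⟩
  have h2 : volume.restrict (box (fun j => (m j / N j : ℝ)) fun j => (m j + 1) / N j) ≪
      cubeMeasure ι := by
    rw [← restrict_cube, ← biUnion_cells hN]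
    exact (Measure.restrict_mono (subset_biUnion_of_mem (u := fun m : ι → ℕ =>
      box (fun j => (m j / N j : ℝ)) (fun j => (m j + 1) / N j)) hm) le_rfl).absolutelyContinuous
  refine Measure.AbsolutelyContinuous.trans ?_ (h1.2.trans h2)
  refine Measure.AbsolutelyContinuous.map ?_ h1.1
  refine Measure.AbsolutelyContinuous.mk fun s _ hs => ?_
  rw [Measure.smul_apply, ENNReal.smul_def, smul_eq_mul, mul_eq_zero] at hs
  refine hs.resolve_left ?_
  rw [ENNReal.coe_eq_zero]
  exact Finset.prod_ne_zero_iff.2 fun j _ => inv_ne_zero (by exact_mod_cast (hN j).ne')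

theorem integrable_comp_cellPt {E : Type*} [NormedAddCommGroup E] {N : ι → ℕ} (hN : ∀ j, 0 < N j)
    {m : ι → ℕ} (hm : m ∈ cells N) {f : (ι → ℝ) → E} (hf : Integrable f (cubeMeasure ι)) :
    Integrable (fun y => f (cellPt N m y)) (cubeMeasure ι) := by
  have h1 := measurePreserving_cellPt hN m
  rw [← restrict_cube, ← biUnion_cells hN] at hf
  have h2 : Integrable f (volume.restrict (box (fun j => (m j / N j : ℝ))
      fun j => (m j + 1) / N j)) :=
    IntegrableOn.mono_set (s := box (fun j => (m j / N j : ℝ)) fun j => (m j + 1) / N j) hf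
      (subset_biUnion_of_mem (u := fun m : ι → ℕ =>
        box (fun j => (m j / N j : ℝ)) (fun j => (m j + 1) / N j)) hm)
  have h3 := h1.integrable_comp_of_integrable h2
  have hc : (∏ j, (N j : ℝ≥0)⁻¹) ≠ 0 :=
    Finset.prod_ne_zero_iff.2 fun j _ => inv_ne_zero (by exact_mod_cast (hN j).ne')
  exact (integrable_smul_measure (c := ((∏ j, (N j : ℝ≥0)⁻¹ : ℝ≥0) : ℝ≥0∞))
    (by exact_mod_cast hc) ENNReal.coe_ne_top).1 h3

/-- Rescaling all cells to the unit cube. -/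
theorem integral_cube_eq_sum_cells {N : ι → ℕ} (hN : ∀ j, 0 < N j) {f : (ι → ℝ) → ℂ}
    (hf : Integrable f (cubeMeasure ι)) :
    ∫ x, f x ∂cubeMeasure ι =
      (∏ j, ((N j : ℝ) : ℂ)⁻¹) * ∑ m ∈ cells N, ∫ y, f (cellPt N m y) ∂cubeMeasure ι := by
  rw [← restrict_cube, ← biUnion_cells hN] at hf ⊢
  rw [integral_biUnion_finset _ (fun m _ => measurableSet_box _ _)
    (fun m _ m' _ h => disjoint_cells hN h)
    (fun m hm => IntegrableOn.mono_set hf (subset_biUnion_of_mem (u := fun m : ι → ℕ =>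
        box (fun j => (m j / N j : ℝ)) (fun j => (m j + 1) / N j)) hm)), Finset.mul_sum]
  refine Finset.sum_congr rfl fun m hm => ?_
  have h1 := measurePreserving_cellPt hN m
  have h2 : Integrable f (volume.restrict (box (fun j => (m j / N j : ℝ))
      fun j => (m j + 1) / N j)) :=
    IntegrableOn.mono_set (s := box (fun j => (m j / N j : ℝ)) fun j => (m j + 1) / N j) hf
      (subset_biUnion_of_mem (u := fun m : ι → ℕ =>
        box (fun j => (m j / N j : ℝ)) (fun j => (m j + 1) / N j)) hm)
  rw [← h1.map_eq, integral_map h1.aemeasurable (by rw [h1.map_eq]; exact h2.1),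
    integral_smul_nnreal_measure, NNReal.smul_def, Complex.real_smul]
  push_cast
  rw [biUnion_cells hN, restrict_cube]

end Cells

/-! ### Integrals against products of functions of mean zero -/

section Kernel

variable {ι : Type*} [Fintype ι]

theorem measurePreserving_fst_pair :
    MeasurePreserving (fun (x : ι → ℝ × ℝ) j => (x j).1) (pairMeasure ι) (cubeMeasure ι) :=
  measurePreserving_pi _ _ fun _ => measurePreserving_fst

theorem norm_prod_kernel_le {K : ι → ℝ → ℂ} {W : ι → ℝ × ℝ → ℂ} {C : ι → ℝ}
    (hW : ∀ j, IsDiffKernel (K j) (W j) (C j)) (x : ι → ℝ × ℝ) :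
    ‖∏ j, W j (x j)‖ ≤ ∏ j, C j := by
  rw [norm_prod]
  exact Finset.prod_le_prod (fun j _ => norm_nonneg _) fun j _ => (hW j).bound _

theorem measurable_prod_kernel {K : ι → ℝ → ℂ} {W : ι → ℝ × ℝ → ℂ} {C : ι → ℝ}
    (hW : ∀ j, IsDiffKernel (K j) (W j) (C j)) :
    Measurable fun x : ι → ℝ × ℝ => ∏ j, W j (x j) :=
  Finset.measurable_fun_prod _ fun j _ => (hW j).measurable.comp (measurable_pi_apply j)

/-- The two points of each pair have distance at least `1 / 4`. -/
def Far (x : ι → ℝ × ℝ) : Prop := ∀ j, 1 / 4 ≤ |(x j).1 - (x j).2|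

theorem prod_kernel_eq_zero {K : ι → ℝ → ℂ} {W : ι → ℝ × ℝ → ℂ} {C : ι → ℝ}
    (hW : ∀ j, IsDiffKernel (K j) (W j) (C j)) {x : ι → ℝ × ℝ} (hx : ¬ Far x) :
    ∏ j, W j (x j) = 0 := by
  simp only [Far, not_forall] at hx
  obtain ⟨j, hj⟩ := hx
  refine Finset.prod_eq_zero (Finset.mem_univ j) ?_
  by_contra h
  exact hj ((hW j).far _ h)

variable [DecidableEq ι]

/-- Exchange of the two entries of the pairs with index in `v`. -/
def swapOn (v : Finset ι) (x : ι → ℝ × ℝ) : ι → ℝ × ℝ :=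
  fun j => if j ∈ v then (x j).swap else x j

theorem measurePreserving_swapOn (v : Finset ι) :
    MeasurePreserving (swapOn v) (pairMeasure ι) (pairMeasure ι) := by
  have h : ∀ j : ι, MeasurePreserving (fun x : ℝ × ℝ => if j ∈ v then x.swap else x)
      (vol01.prod vol01) (vol01.prod vol01) := by
    intro j
    by_cases hj : j ∈ v
    · simp only [hj, if_true]
      exact Measure.measurePreserving_swap
    · simp only [hj, if_false]
      exact MeasurePreserving.id _
  exact measurePreserving_pi _ _ h

theorem measurePreserving_mix (v : Finset ι) :
    MeasurePreserving (fun (x : ι → ℝ × ℝ) j => if j ∈ v then (x j).2 else (x j).1)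
      (pairMeasure ι) (cubeMeasure ι) := by
  have h := measurePreserving_fst_pair.comp (measurePreserving_swapOn v)
  convert h using 2 with x
  ext j
  by_cases hj : j ∈ v <;> simp [swapOn, hj]

theorem integrable_mix_mul_prod {K : ι → ℝ → ℂ} {W : ι → ℝ × ℝ → ℂ} {C : ι → ℝ}
    (hW : ∀ j, IsDiffKernel (K j) (W j) (C j)) {G : (ι → ℝ) → ℝ}
    (hG : Integrable G (cubeMeasure ι)) (v : Finset ι) :
    Integrable (fun x : ι → ℝ × ℝ =>
      (G (fun j => if j ∈ v then (x j).2 else (x j).1) : ℂ) * ∏ j, W j (x j)) (pairMeasure ι) := by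
  refine Integrable.mul_bdd (c := ∏ j, C j) ?_ (measurable_prod_kernel hW).aestronglyMeasurable
    (Filter.Eventually.of_forall fun x => norm_prod_kernel_le hW x)
  exact ((measurePreserving_mix v).integrable_comp_of_integrable hG).ofReal

theorem integral_fst_mul_prod {K : ι → ℝ → ℂ} {W : ι → ℝ × ℝ → ℂ} {C : ι → ℝ}
    (hW : ∀ j, IsDiffKernel (K j) (W j) (C j)) {G : (ι → ℝ) → ℝ}
    (hG : Integrable G (cubeMeasure ι)) :
    ∫ x, (G fun j => (x j).1 : ℂ) * ∏ j, W j (x j) ∂pairMeasure ι =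
      ∫ x, (G x : ℂ) * ∏ j, K j (x j) ∂cubeMeasure ι := by
  have e := measurePreserving_arrowProdEquivProdArrow ℝ ℝ ι (fun _ => vol01) (fun _ => vol01)
  have hint := integrable_mix_mul_prod hW hG ∅
  simp only [Finset.notMem_empty, if_false] at hint
  have hint2 := hint
  rw [← e.symm.integrable_comp_emb (MeasurableEquiv.measurableEmbedding _)] at hint2
  rw [← e.symm.integral_comp (MeasurableEquiv.measurableEmbedding _)]
  have h1 := integral_prod _ hint2
  refine h1.trans ?_
  refine integral_congr_ae ?_
  filter_upwards [ae_mem_cube] with x hx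
  have h2 : ∀ y : ι → ℝ, ((fun x : ι → ℝ × ℝ => (G fun j => (x j).1 : ℂ) * ∏ j, W j (x j)) ∘
      (MeasurableEquiv.arrowProdEquivProdArrow ℝ ℝ ι).symm) (x, y) =
        (G x : ℂ) * ∏ j, W j (x j, y j) := fun y => rfl
  simp_rw [h2]
  rw [integral_const_mul, integral_fintype_prod_eq_prod (fun j s => W j (x j, s))]
  congr 1
  refine Finset.prod_congr rfl fun j _ => (hW j).marginal _ ?_
  exact hx j (mem_univ j)

/-- By the antisymmetry of the kernels all vertices of a box contribute the same to the integral of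
the alternating sum. -/
theorem integral_mul_prod_eq_integral_alternatingSum {K : ι → ℝ → ℂ} {W : ι → ℝ × ℝ → ℂ}
    {C : ι → ℝ} (hW : ∀ j, IsDiffKernel (K j) (W j) (C j)) {G : (ι → ℝ) → ℝ}
    (hG : Integrable G (cubeMeasure ι)) :
    2 ^ Fintype.card ι * ∫ x, (G x : ℂ) * ∏ j, K j (x j) ∂cubeMeasure ι =
      ∫ x, (alternatingSum G (fun j => (x j).2) fun j => (x j).1 : ℂ) * ∏ j, W j (x j)
        ∂pairMeasure ι := by
  have h1 : ∀ v : Finset ι, ∫ x, (-1) ^ v.card *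
      ((G (fun j => if j ∈ v then (x j).2 else (x j).1) : ℂ) * ∏ j, W j (x j)) ∂pairMeasure ι =
      ∫ x, (G x : ℂ) * ∏ j, K j (x j) ∂cubeMeasure ι := by
    intro v
    have hmp := measurePreserving_swapOn (ι := ι) v
    have hint := integrable_mix_mul_prod hW hG ∅
    simp only [Finset.notMem_empty, if_false] at hint
    rw [← integral_fst_mul_prod hW hG]
    conv_rhs => rw [← hmp.map_eq]
    rw [integral_map hmp.aemeasurable (by rw [hmp.map_eq]; exact hint.1)]
    refine integral_congr_ae (Filter.Eventually.of_forall fun x => ?_)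
    have e1 : ∀ j, W j (swapOn v x j) = (if j ∈ v then -1 else 1) * W j (x j) := by
      intro j
      by_cases hj : j ∈ v <;> simp [swapOn, hj, (hW j).antisymm]
    have e2 : (fun j => (swapOn v x j).1) = fun j => if j ∈ v then (x j).2 else (x j).1 := by
      ext j
      by_cases hj : j ∈ v <;> simp [swapOn, hj]
    simp only [e1, e2, Finset.prod_mul_distrib]
    rw [Finset.prod_ite_mem, Finset.univ_inter, Finset.prod_const]
    ring
  have h2 : ∀ x : ι → ℝ × ℝ, (alternatingSum G (fun j => (x j).2) fun j => (x j).1 : ℂ) *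
      ∏ j, W j (x j) = ∑ v : Finset ι, (-1) ^ v.card *
        ((G (fun j => if j ∈ v then (x j).2 else (x j).1) : ℂ) * ∏ j, W j (x j)) := by
    intro x
    simp only [alternatingSum]
    push_cast
    rw [Finset.sum_mul]
    exact Finset.sum_congr rfl fun v _ => by ring
  simp_rw [h2]
  rw [integral_finsetSum _ fun v _ => (integrable_mix_mul_prod hW hG v).const_mul _,
    Finset.sum_congr rfl fun v _ => h1 v, Finset.sum_const, Finset.card_univ, Fintype.card_finset,
    nsmul_eq_mul]
  push_cast
  rfl

/-- If the function `K j` has mean zero on each of the `N j` cells of its coordinate, the integral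
of `G` against the product of these functions is controlled by the differences of `G` over boxes
inside the cells. -/
theorem norm_integral_mul_prod_le {G : (ι → ℝ) → ℝ} (hG : Integrable G (cubeMeasure ι))
    {K : ι → ℝ → ℂ} {M : ι → ℝ} {N : ι → ℕ} (hN : ∀ j, 0 < N j) (hK : ∀ j, Measurable (K j))
    (hM : ∀ j, ∀ t ∈ Ico (0 : ℝ) 1, ‖K j t‖ ≤ M j)
    (hz : ∀ j, ∀ m < N j, ∫ z, K j ((m + z) / N j) ∂vol01 = 0) {B : ℝ} (hB0 : 0 ≤ B)
    (hB : ∀ᵐ x ∂pairMeasure ι, Far x → ∑ m ∈ cells N,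
      |alternatingSum G (cellPt N m fun j => (x j).2) (cellPt N m fun j => (x j).1)| ≤ B) :
    ‖∫ x, (G x : ℂ) * ∏ j, K j (x j) ∂cubeMeasure ι‖ ≤ (∏ j, 32 * M j / N j) * B := by
  have hM0 : ∀ j, 0 ≤ M j := fun j => (norm_nonneg _).trans (hM j 0 (by simp))
  have hmem : ∀ j, ∀ m < N j, ∀ z ∈ Ico (0 : ℝ) 1, ((m : ℝ) + z) / N j ∈ Ico (0 : ℝ) 1 := by
    intro j m hm z hz
    have hN' : (0 : ℝ) < N j := Nat.cast_pos.2 (hN j)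
    have h1 : (m : ℝ) + 1 ≤ N j := by exact_mod_cast hm
    refine ⟨div_nonneg (add_nonneg (Nat.cast_nonneg _) hz.1) hN'.le, ?_⟩
    rw [div_lt_one hN']
    linarith [hz.2]
  have hex : ∀ j m, ∃ W, m < N j →
      IsDiffKernel (fun z => K j ((m + z) / N j)) W (32 * M j) := by
    intro j m
    by_cases hm : m < N j
    · obtain ⟨W, hW⟩ := exists_isDiffKernel (K := fun z => K j ((m + z) / N j)) (M := M j)
        ((hK j).comp (by fun_prop)) (fun z hz' => hM j _ (hmem j m hm z hz')) (hz j m hm)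
      exact ⟨W, fun _ => hW⟩
    · exact ⟨0, fun h => absurd h hm⟩
  choose W hW using hex
  have hint : Integrable (fun x => (G x : ℂ) * ∏ j, K j (x j)) (cubeMeasure ι) := by
    refine Integrable.mul_bdd (c := ∏ j, M j) hG.ofReal
      (Finset.measurable_fun_prod _ fun j _ =>
        (hK j).comp (measurable_pi_apply j)).aestronglyMeasurable ?_
    filter_upwards [ae_mem_cube] with x hx
    rw [norm_prod]
    exact Finset.prod_le_prod (fun j _ => norm_nonneg _) fun j _ => hM j _ (hx j (mem_univ j))
  rw [integral_cube_eq_sum_cells hN hint, norm_mul]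
  have hWm : ∀ m ∈ cells N, ∀ j,
      IsDiffKernel (fun z => K j ((m j + z) / N j)) (W j (m j)) (32 * M j) :=
    fun m hm j => hW j (m j) (mem_cells.1 hm j)
  have hcell : ∀ m ∈ cells N, 2 ^ Fintype.card ι *
      ∫ y, (G (cellPt N m y) : ℂ) * ∏ j, K j (cellPt N m y j) ∂cubeMeasure ι =
      ∫ x, (alternatingSum G (cellPt N m fun j => (x j).2) (cellPt N m fun j => (x j).1) : ℂ) *
        ∏ j, W j (m j) (x j) ∂pairMeasure ι := by
    intro m hm
    have h1 := integral_mul_prod_eq_integral_alternatingSum (hWm m hm)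
      (integrable_comp_cellPt hN hm hG)
    refine h1.trans (integral_congr_ae (Filter.Eventually.of_forall fun x => ?_))
    simp only [alternatingSum]
    have e : ∀ v : Finset ι, (cellPt N m fun j => if j ∈ v then (x j).2 else (x j).1) = fun j =>
        if j ∈ v then cellPt N m (fun j => (x j).2) j else cellPt N m (fun j => (x j).1) j := by
      intro v
      ext j
      by_cases hj : j ∈ v <;> simp [cellPt, hj]
    simp only [e]
  have hint2 : ∀ m ∈ cells N, Integrable (fun x : ι → ℝ × ℝ =>
      (alternatingSum G (cellPt N m fun j => (x j).2) (cellPt N m fun j => (x j).1) : ℂ) *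
        ∏ j, W j (m j) (x j)) (pairMeasure ι) := by
    intro m hm
    have h1 := integrable_finsetSum (Finset.univ : Finset (Finset ι)) fun v _ =>
      (integrable_mix_mul_prod (hWm m hm) (integrable_comp_cellPt hN hm hG) v).const_mul
        ((-1) ^ v.card)
    refine h1.congr (Filter.Eventually.of_forall fun x => ?_)
    simp only [alternatingSum]
    push_cast
    rw [Finset.sum_mul]
    refine Finset.sum_congr rfl fun v _ => ?_
    have : (cellPt N m fun j => if j ∈ v then (x j).2 else (x j).1) = fun j =>
        if j ∈ v then cellPt N m (fun j => (x j).2) j else cellPt N m (fun j => (x j).1) j := by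
      ext j
      by_cases hj : j ∈ v <;> simp [cellPt, hj]
    rw [this]
    ring
  have hsum : 2 ^ Fintype.card ι *
      ∑ m ∈ cells N, ∫ y, (G (cellPt N m y) : ℂ) * ∏ j, K j (cellPt N m y j) ∂cubeMeasure ι =
      ∫ x, ∑ m ∈ cells N,
        (alternatingSum G (cellPt N m fun j => (x j).2) (cellPt N m fun j => (x j).1) : ℂ) *
        ∏ j, W j (m j) (x j) ∂pairMeasure ι := by
    rw [integral_finsetSum _ hint2, Finset.mul_sum]
    exact Finset.sum_congr rfl hcell
  have hbound : ‖∫ x, ∑ m ∈ cells N,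
        (alternatingSum G (cellPt N m fun j => (x j).2) (cellPt N m fun j => (x j).1) : ℂ) *
        ∏ j, W j (m j) (x j) ∂pairMeasure ι‖ ≤ (∏ j, 32 * M j) * B := by
    have hP0 : 0 ≤ ∏ j, 32 * M j := Finset.prod_nonneg fun j _ => by linarith [hM0 j]
    have h1 := norm_integral_le_of_norm_le_const (μ := pairMeasure ι) (C := (∏ j, 32 * M j) * B)
      (f := fun x => ∑ m ∈ cells N,
        (alternatingSum G (cellPt N m fun j => (x j).2) (cellPt N m fun j => (x j).1) : ℂ) *
        ∏ j, W j (m j) (x j)) ?_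
    · simpa using h1
    · filter_upwards [hB] with x hx
      by_cases hf : Far x
      · refine (norm_sum_le _ _).trans ?_
        refine le_trans ?_ (mul_le_mul_of_nonneg_left (hx hf) hP0)
        rw [Finset.mul_sum]
        refine Finset.sum_le_sum fun m hm => ?_
        rw [norm_mul, Complex.norm_real, Real.norm_eq_abs, mul_comm]
        gcongr
        exact norm_prod_kernel_le (hWm m hm) x
      · rw [Finset.sum_eq_zero, norm_zero]
        · positivity
        · intro m hm
          rw [prod_kernel_eq_zero (hWm m hm) hf, mul_zero]
  rw [← hsum, norm_mul] at hbound
  have h2 : (1 : ℝ) ≤ ‖(2 : ℂ) ^ Fintype.card ι‖ := by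
    rw [norm_pow]
    exact one_le_pow₀ (by simp)
  have h3 : ‖∑ m ∈ cells N, ∫ y, (G (cellPt N m y) : ℂ) * ∏ j, K j (cellPt N m y j)
      ∂cubeMeasure ι‖ ≤ (∏ j, 32 * M j) * B :=
    (le_mul_of_one_le_left (norm_nonneg _) h2).trans hbound
  have h4 : ‖∏ j, ((N j : ℝ) : ℂ)⁻¹‖ = ∏ j, (N j : ℝ)⁻¹ := by
    rw [norm_prod]
    simp
  rw [h4]
  calc _ ≤ (∏ j, (N j : ℝ)⁻¹) * ((∏ j, 32 * M j) * B) := by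
        gcongr
    _ = _ := by
        rw [← mul_assoc, ← Finset.prod_mul_distrib]
        congr 1
        exact Finset.prod_congr rfl fun j _ => by rw [div_eq_inv_mul]

end Kernel

/-! ### Differences over boxes and the generalized Vitali variation -/

section Variation

variable {ι : Type*}

theorem ae_mem_pair [Fintype ι] : ∀ᵐ x ∂pairMeasure ι,
    ∀ j, (x j).1 ∈ Ico (0 : ℝ) 1 ∧ (x j).2 ∈ Ico (0 : ℝ) 1 := by
  rw [ae_all_iff]
  intro j
  have h : ∀ᵐ y ∂vol01.prod vol01, y.1 ∈ Ico (0 : ℝ) 1 ∧ y.2 ∈ Ico (0 : ℝ) 1 := by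
    rw [Measure.prod_restrict]
    exact ae_restrict_mem (measurableSet_Ico.prod measurableSet_Ico)
  exact (Measure.quasiMeasurePreserving_eval (μ := fun _ : ι => vol01.prod vol01) j).ae h

theorem isSubbox_cellPt {N : ι → ℕ} (hN : ∀ j, 0 < N j) {a b : ι → ℝ} (ha : ∀ j, 0 ≤ a j)
    (hab : ∀ j, a j < b j) (hb : ∀ j, b j < 1) {m : ι → ℕ} (hm : ∀ j, m j < N j) :
    IsSubbox (cellPt N m a) (cellPt N m b) := by
  intro j
  have hN' : (0 : ℝ) < N j := Nat.cast_pos.2 (hN j)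
  have h1 : (m j : ℝ) + 1 ≤ N j := by exact_mod_cast hm j
  refine ⟨div_nonneg (add_nonneg (Nat.cast_nonneg _) (ha j)) hN'.le, ?_, ?_⟩
  · simp only [cellPt]
    gcongr
    exact hab j
  · simp only [cellPt]
    rw [div_lt_one hN']
    linarith [hb j]

theorem box_cellPt_subset {N : ι → ℕ} (hN : ∀ j, 0 < N j) {a b : ι → ℝ} (ha : ∀ j, 0 ≤ a j)
    (hb : ∀ j, b j < 1) (m : ι → ℕ) :
    box (cellPt N m a) (cellPt N m b) ⊆
      box (fun j => (m j / N j : ℝ)) fun j => (m j + 1) / N j := by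
  refine pi_mono fun j _ => ?_
  have hN' : (0 : ℝ) < N j := Nat.cast_pos.2 (hN j)
  refine Ico_subset_Ico ?_ ?_
  · simp only [cellPt]
    gcongr
    linarith [ha j]
  · simp only [cellPt]
    gcongr
    exact (hb j).le

theorem disjoint_box_cellPt {N : ι → ℕ} (hN : ∀ j, 0 < N j) {a b : ι → ℝ} (ha : ∀ j, 0 ≤ a j)
    (hb : ∀ j, b j < 1) {m m' : ι → ℕ} (h : m ≠ m') :
    Disjoint (box (cellPt N m a) (cellPt N m b)) (box (cellPt N m' a) (cellPt N m' b)) :=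
  (disjoint_cells hN h).mono (box_cellPt_subset hN ha hb m) (box_cellPt_subset hN ha hb m')

variable [Fintype ι] [DecidableEq ι]

theorem neg_one_pow_card_eq_prod (v : Finset ι) :
    (-1 : ℝ) ^ v.card = ∏ j, if j ∈ v then (-1 : ℝ) else 1 := by
  rw [Finset.prod_ite_mem, Finset.univ_inter, Finset.prod_const]

/-- Sorting the vertices of a box changes the alternating sum by a sign that does not depend on the
function. -/
theorem alternatingSum_min_max (G : (ι → ℝ) → ℝ) (a b : ι → ℝ) :
    alternatingSum G (fun j => min (a j) (b j)) (fun j => max (a j) (b j)) =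
      (-1) ^ (Finset.univ.filter fun j => b j < a j).card * alternatingSum G a b := by
  set S : Finset ι := Finset.univ.filter fun j => b j < a j with hS
  simp only [alternatingSum]
  rw [Finset.mul_sum, ← (symmDiff_right_involutive S).bijective.sum_comp]
  refine Finset.sum_congr rfl fun v _ => ?_
  rw [← mul_assoc]
  congr 1
  · simp only [neg_one_pow_card_eq_prod, ← Finset.prod_mul_distrib]
    refine Finset.prod_congr rfl fun j _ => ?_
    by_cases h1 : j ∈ S <;> by_cases h2 : j ∈ v <;> simp [Finset.mem_symmDiff, h1, h2]
  · congr 1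
    ext j
    by_cases h1 : b j < a j
    · have : j ∈ S := by simp [hS, h1]
      by_cases h2 : j ∈ v <;> simp [Finset.mem_symmDiff, this, h2, h1.le]
    · have : j ∉ S := by simp [hS, h1]
      by_cases h2 : j ∈ v <;> simp [Finset.mem_symmDiff, this, h2, not_lt.1 h1]

theorem abs_alternatingSum_min_max (G : (ι → ℝ) → ℝ) (a b : ι → ℝ) :
    |alternatingSum G (fun j => min (a j) (b j)) fun j => max (a j) (b j)| =
      |alternatingSum G a b| := by
  rw [alternatingSum_min_max, abs_mul, abs_pow, abs_neg, abs_one, one_pow, one_mul]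

/-- The differences of `G` over boxes of comparable size, one inside each cell of a grid, add up to
at most `B` times the power `lam - 1` of the volume of the cells. -/
def DiffBound (lam : ℝ) (G : (ι → ℝ) → ℝ) (B : ℝ) : Prop :=
  ∀ N : ι → ℕ, (∀ j, 0 < N j) → ∀ᵐ x ∂pairMeasure ι, Far x → ∑ m ∈ cells N,
    |alternatingSum G (cellPt N m fun j => (x j).2) (cellPt N m fun j => (x j).1)| ≤
      B * ∏ j, 4 * (N j : ℝ) ^ (1 - lam)

/-- The boxes inside the cells of a grid are disjoint and have the same volume, and this volume is
comparable with that of the cells because the pairs of vertices are far apart. -/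
theorem diffBound_of_vitaliVar {lam pp : ℝ} (hlam : 0 < lam) (hlam1 : lam ≤ 1) (hpp : 1 ≤ pp)
    {G : (ι → ℝ) → ℝ} (hV : vitaliVar lam pp G ≠ ⊤) :
    DiffBound lam G (vitaliVar lam pp G).toReal := by
  classical
  intro N hN
  filter_upwards [ae_mem_pair] with x hx hfar
  set a : ι → ℝ := fun j => min (x j).2 (x j).1 with ha_def
  set b : ι → ℝ := fun j => max (x j).2 (x j).1 with hb_def
  have hlen : ∀ j, 1 / 4 ≤ b j - a j := by
    intro j
    simp only [ha_def, hb_def]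
    rw [max_sub_min_eq_abs]
    exact hfar j
  have ha : ∀ j, 0 ≤ a j := fun j => le_min (hx j).2.1 (hx j).1.1
  have hb : ∀ j, b j < 1 := fun j => max_lt (hx j).2.2 (hx j).1.2
  have hab : ∀ j, a j < b j := fun j => by linarith [hlen j]
  have hNr : ∀ j, (0 : ℝ) < N j := fun j => Nat.cast_pos.2 (hN j)
  have hsort : ∀ m : ι → ℕ, |alternatingSum G (cellPt N m fun j => (x j).2)
      (cellPt N m fun j => (x j).1)| = |alternatingSum G (cellPt N m a) (cellPt N m b)| := by
    intro m
    rw [← abs_alternatingSum_min_max]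
    congr 2
    · ext j
      simp only [cellPt, ha_def]
      rw [min_div_div_right (hNr j).le, min_add_add_left]
    · ext j
      simp only [cellPt, hb_def]
      rw [max_div_div_right (hNr j).le, max_add_add_left]
  simp only [hsort]
  set v : ℝ := ∏ j, ((b j - a j) / N j) with hv
  have hvol : ∀ m : ι → ℕ, boxVol (cellPt N m a) (cellPt N m b) = v := by
    intro m
    refine Finset.prod_congr rfl fun j _ => ?_
    simp only [cellPt]
    ring
  have hvpos : 0 < v := Finset.prod_pos fun j _ => div_pos (by linarith [hab j]) (hNr j)
  set f : (ι → ℕ) → (ι → ℝ) × (ι → ℝ) := fun m => (cellPt N m a, cellPt N m b) with hf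
  have hinj : Function.Injective f := by
    intro m m' h
    ext j
    have h1 := congrFun (congrArg Prod.fst h) j
    simp only [hf, cellPt, div_left_inj' (hNr j).ne', add_left_inj] at h1
    exact_mod_cast h1
  have hfam : IsBoxFamily ((cells N).image f) := by
    constructor
    · intro J hJ
      obtain ⟨m, hm, rfl⟩ := Finset.mem_image.1 hJ
      exact isSubbox_cellPt hN ha hab hb (mem_cells.1 hm)
    · intro J hJ J' hJ' hne
      obtain ⟨m, _, rfl⟩ := Finset.mem_image.1 (Finset.mem_coe.1 hJ)
      obtain ⟨m', _, rfl⟩ := Finset.mem_image.1 (Finset.mem_coe.1 hJ')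
      exact disjoint_box_cellPt hN ha hb fun h => hne (by rw [h])
  have hle : ENNReal.ofReal ((∑ J ∈ (cells N).image f, boxVol J.1 J.2 *
      (|alternatingSum G J.1 J.2| / boxVol J.1 J.2 ^ lam) ^ pp) ^ (1 / pp)) ≤
      vitaliVar lam pp G := le_iSup₂_of_le _ hfam le_rfl
  rw [Finset.sum_image hinj.injOn] at hle
  have hle2 := (ENNReal.ofReal_le_iff_le_toReal hV).1 hle
  simp only [hf, hvol] at hle2
  set B := (vitaliVar lam pp G).toReal with hBdef
  have hB0 : 0 ≤ B := ENNReal.toReal_nonneg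
  -- Jensen's inequality: the total volume of the boxes is at most one
  have hcard : ∑ _m ∈ cells N, v ≤ 1 := by
    rw [Finset.sum_const, cells, Fintype.card_piFinset, nsmul_eq_mul, hv]
    push_cast
    rw [← Finset.prod_mul_distrib]
    refine Finset.prod_le_one (fun j _ => ?_) fun j _ => ?_
    · have := hab j
      have := hNr j
      exact mul_nonneg (Nat.cast_nonneg _) (div_nonneg (by linarith) (by linarith))
    · rw [Finset.card_range, mul_div_cancel₀ _ (hNr j).ne']
      linarith [ha j, hb j]
  have hJ := Real.inner_le_weight_mul_Lp_of_nonneg (cells N) hpp (fun _ => v)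
    (fun m => |alternatingSum G (cellPt N m a) (cellPt N m b)| / v ^ lam) (fun _ => hvpos.le)
    (fun m => div_nonneg (abs_nonneg _) (Real.rpow_nonneg hvpos.le _))
  have hJ2 : ∑ m ∈ cells N, v * (|alternatingSum G (cellPt N m a) (cellPt N m b)| / v ^ lam) ≤ B := by
    refine hJ.trans ?_
    rw [one_div] at hle2
    calc _ ≤ 1 * B := by
          gcongr
          refine Real.rpow_le_one (Finset.sum_nonneg fun _ _ => hvpos.le) hcard ?_
          rw [sub_nonneg]
          exact inv_le_one_of_one_le₀ hpp
      _ = B := one_mul B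
  have hJ3 : ∑ m ∈ cells N, |alternatingSum G (cellPt N m a) (cellPt N m b)| ≤
      B * v⁻¹ ^ (1 - lam) := by
    have e1 : ∑ m ∈ cells N, v * (|alternatingSum G (cellPt N m a) (cellPt N m b)| / v ^ lam) =
        (v / v ^ lam) * ∑ m ∈ cells N, |alternatingSum G (cellPt N m a) (cellPt N m b)| := by
      rw [Finset.mul_sum]
      exact Finset.sum_congr rfl fun m _ => by ring
    have e2 : v / v ^ lam = v ^ (1 - lam) := by
      rw [Real.rpow_sub hvpos, Real.rpow_one]
    rw [e1, e2] at hJ2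
    rw [Real.inv_rpow hvpos.le, ← div_eq_mul_inv, le_div_iff₀ (Real.rpow_pos_of_pos hvpos _)]
    linarith
  refine hJ3.trans (mul_le_mul_of_nonneg_left ?_ hB0)
  rw [hv, ← Finset.prod_inv_distrib, ← Real.finsetProd_rpow]
  · refine Finset.prod_le_prod (fun j _ => ?_) fun j _ => ?_
    · exact Real.rpow_nonneg (inv_nonneg.2 (div_nonneg (by linarith [hab j]) (hNr j).le)) _
    · have h1 : ((b j - a j) / N j)⁻¹ ≤ 4 * N j := by
        rw [inv_div, div_le_iff₀ (by linarith [hab j])]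
        nlinarith [hlen j, hNr j]
      calc _ ≤ (4 * (N j : ℝ)) ^ (1 - lam) := by
            refine Real.rpow_le_rpow ?_ h1 (by linarith)
            exact inv_nonneg.2 (div_nonneg (by linarith [hab j]) (hNr j).le)
        _ = 4 ^ (1 - lam) * (N j : ℝ) ^ (1 - lam) := Real.mul_rpow (by norm_num) (hNr j).le
        _ ≤ _ := by
            gcongr
            calc (4 : ℝ) ^ (1 - lam) ≤ 4 ^ (1 : ℝ) :=
                  Real.rpow_le_rpow_of_exponent_le (by norm_num) (by linarith)
              _ = 4 := Real.rpow_one 4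
  · exact fun j _ => inv_nonneg.2 (div_nonneg (by linarith [hab j]) (hNr j).le)

end Variation

/-! ### Splitting the coordinates, and mixed derivatives -/

theorem measurableEmbedding_glue {ι : Type*} [DecidableEq ι] (w : Finset ι) :
    MeasurableEmbedding
      (fun x : ({j // j ∈ w} → ℝ) × ({j // j ∉ w} → ℝ) => glue w x.1 x.2) :=
  (MeasurableEquiv.piEquivPiSubtypeProd (fun _ : ι => ℝ) (· ∈ w)).symm.measurableEmbedding

section Glue

variable {ι : Type*} [Fintype ι] [DecidableEq ι]

theorem measurePreserving_glue (w : Finset ι) (μ : ι → Measure ℝ) [∀ j, SigmaFinite (μ j)] :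
    MeasurePreserving (fun x : ({j // j ∈ w} → ℝ) × ({j // j ∉ w} → ℝ) => glue w x.1 x.2)
      ((Measure.pi fun j : {j // j ∈ w} => μ j).prod (Measure.pi fun j : {j // j ∉ w} => μ j))
      (Measure.pi μ) := by
  convert (measurePreserving_piEquivPiSubtypeProd μ (· ∈ w)).symm
  rfl

theorem proj_eq (w : Finset ι) (f : (ι → ℝ) → ℝ) (x : {j // j ∈ w} → ℝ) :
    proj w f x = ∫ z, f (glue w x z) ∂cubeMeasure {j // j ∉ w} := by
  rw [proj, restrict_cube]

theorem integrable_glue {E : Type*} [NormedAddCommGroup E] (w : Finset ι) {f : (ι → ℝ) → E}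
    (hf : Integrable f (cubeMeasure ι)) :
    Integrable (fun x : ({j // j ∈ w} → ℝ) × ({j // j ∉ w} → ℝ) => f (glue w x.1 x.2))
      ((cubeMeasure {j // j ∈ w}).prod (cubeMeasure {j // j ∉ w})) :=
  (measurePreserving_glue w fun _ => vol01).integrable_comp_of_integrable hf

theorem integrable_proj (w : Finset ι) {f : (ι → ℝ) → ℝ} (hf : Integrable f (cubeMeasure ι)) :
    Integrable (proj w f) (cubeMeasure {j // j ∈ w}) := by
  simp_rw [funext (proj_eq w f)]
  exact (integrable_glue w hf).integral_prod_left

/-- Jensen's inequality for the square. -/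
theorem integral_abs_le_sqrt {Ω : Type*} [MeasurableSpace Ω] {μ : Measure Ω}
    [IsProbabilityMeasure μ] {f : Ω → ℝ} (hf : Integrable f μ)
    (hL : ∫⁻ x, ENNReal.ofReal (f x ^ 2) ∂μ ≠ ⊤) :
    ∫ x, |f x| ∂μ ≤ √(∫⁻ x, ENNReal.ofReal (f x ^ 2) ∂μ).toReal := by
  have h2 : Integrable (fun x => f x ^ 2) μ := by
    refine ⟨hf.1.pow 2, ?_⟩
    rw [hasFiniteIntegral_iff_ofReal (Filter.Eventually.of_forall fun x => sq_nonneg (f x))]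
    exact lt_top_iff_ne_top.2 hL
  rw [← integral_eq_lintegral_of_nonneg_ae (Filter.Eventually.of_forall fun x => sq_nonneg (f x))
    h2.1]
  refine Real.le_sqrt_of_sq_le ?_
  set c := ∫ x, |f x| ∂μ with hc
  have h3 : 0 ≤ ∫ x, (|f x| - c) ^ 2 ∂μ := integral_nonneg fun x => sq_nonneg _
  have h4 : ∫ x, (|f x| - c) ^ 2 ∂μ = ∫ x, f x ^ 2 ∂μ - 2 * c * c + c ^ 2 := by
    have e : ∀ x, (|f x| - c) ^ 2 = f x ^ 2 - 2 * c * |f x| + c ^ 2 := by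
      intro x
      rw [sub_sq, sq_abs]
      ring
    simp_rw [e]
    rw [integral_add (f := fun x => f x ^ 2 - 2 * c * |f x|) (h2.sub (hf.abs.const_mul _))
      (integrable_const _),
      integral_sub h2 (hf.abs.const_mul _), integral_const_mul, ← hc]
    simp
  nlinarith

/-- The alternating sums of a projection are the integrals of alternating sums, provided that the
projection is given by convergent integrals at the vertices. -/
theorem alternatingSum_proj (w : Finset ι) (g : (ι → ℝ) → ℝ) (a b : {j // j ∈ w} → ℝ)
    (h : ∀ v : Finset {j // j ∈ w}, Integrable
      (fun z => g (glue w (fun j => if j ∈ v then a j else b j) z)) (cubeMeasure {j // j ∉ w})) :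
    alternatingSum (proj w g) a b =
      ∫ z, alternatingSum (fun t => g (glue w t z)) a b ∂cubeMeasure {j // j ∉ w} := by
  simp only [alternatingSum]
  rw [integral_finsetSum _ fun v _ => (h v).const_mul _]
  simp_rw [proj_eq, integral_const_mul]

/-- The differences of a projection over disjoint boxes are at most the `L¹` norm of the projection
of the mixed derivative, and hence at most its `L²` norm. -/
theorem diffBound_of_hasMixedDeriv {w : Finset ι} {g h : (ι → ℝ) → ℝ}
    (hg : Integrable g (cubeMeasure ι)) (hh : HasMixedDeriv w g h)
    (hL : ∫⁻ x in cube {j // j ∈ w}, ENNReal.ofReal (proj w h x ^ 2) ≠ ⊤) :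
    DiffBound 1 (proj w g)
      √(∫⁻ x in cube {j // j ∈ w}, ENNReal.ofReal (proj w h x ^ 2)).toReal := by
  have hhi : Integrable h (cubeMeasure ι) := by
    rw [← restrict_cube]
    have := hh.1
    rw [restrict_cube] at this ⊢
    exact this.integrable one_le_two
  have hproj := integrable_proj w hhi
  rw [restrict_cube] at hL ⊢
  have hJ := integral_abs_le_sqrt hproj hL
  set B := √(∫⁻ x, ENNReal.ofReal (proj w h x ^ 2) ∂cubeMeasure {j // j ∈ w}).toReal
  have hB0 : 0 ≤ B := Real.sqrt_nonneg _
  intro N hN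
  have hsec := (integrable_glue w hg).prod_right_ae
  have hsec' : ∀ᵐ x ∂pairMeasure {j // j ∈ w}, ∀ m : {j // j ∈ w} → ℕ,
      ∀ v : Finset {j // j ∈ w}, m ∈ cells N → Integrable (fun z =>
        g (glue w (cellPt N m fun j => if j ∈ v then (x j).2 else (x j).1) z))
          (cubeMeasure {j // j ∉ w}) := by
    rw [ae_all_iff]
    intro m
    rw [ae_all_iff]
    intro v
    by_cases hm : m ∈ cells N
    · have := ((quasiMeasurePreserving_cellPt hN hm).comp
        (measurePreserving_mix v).quasiMeasurePreserving).ae hsec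
      filter_upwards [this] with x hx _
      exact hx
    · exact Filter.Eventually.of_forall fun x h => absurd h hm
  filter_upwards [ae_mem_pair, hsec'] with x hx hxs hfar
  set a : {j // j ∈ w} → ℝ := fun j => min (x j).2 (x j).1 with ha_def
  set b : {j // j ∈ w} → ℝ := fun j => max (x j).2 (x j).1 with hb_def
  have ha : ∀ j, 0 ≤ a j := fun j => le_min (hx j).2.1 (hx j).1.1
  have hb : ∀ j, b j < 1 := fun j => max_lt (hx j).2.2 (hx j).1.2
  have hab : ∀ j, a j < b j := by
    intro j
    have h1 : 1 / 4 ≤ b j - a j := by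
      simp only [ha_def, hb_def]
      rw [max_sub_min_eq_abs]
      exact hfar j
    linarith
  have hNr : ∀ j, (0 : ℝ) < N j := fun j => Nat.cast_pos.2 (hN j)
  have hcell : ∀ m ∈ cells N,
      |alternatingSum (proj w g) (cellPt N m fun j => (x j).2) (cellPt N m fun j => (x j).1)| ≤
        ∫ t in box (cellPt N m a) (cellPt N m b), |proj w h t| := by
    intro m hm
    rw [alternatingSum_proj]
    swap
    · intro v
      convert hxs m v hm using 4 with z
      ext j
      by_cases hj : j ∈ v <;> simp [cellPt, hj]
    have hlo : (fun j => min (cellPt N m (fun j => (x j).2) j) (cellPt N m (fun j => (x j).1) j)) =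
        cellPt N m a := by
      ext j
      simp only [cellPt, ha_def]
      rw [min_div_div_right (hNr j).le, min_add_add_left]
    have hhi' : (fun j => max (cellPt N m (fun j => (x j).2) j)
        (cellPt N m (fun j => (x j).1) j)) = cellPt N m b := by
      ext j
      simp only [cellPt, hb_def]
      rw [max_div_div_right (hNr j).le, max_add_add_left]
    have hsub := isSubbox_cellPt hN ha hab hb (mem_cells.1 hm)
    have e1 : |∫ z, alternatingSum (fun t => g (glue w t z)) (cellPt N m fun j => (x j).2)
        (cellPt N m fun j => (x j).1) ∂cubeMeasure {j // j ∉ w}| =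
        |∫ z, alternatingSum (fun t => g (glue w t z)) (cellPt N m a) (cellPt N m b)
          ∂cubeMeasure {j // j ∉ w}| := by
      simp_rw [← hlo, ← hhi', alternatingSum_min_max]
      rw [integral_const_mul, abs_mul, abs_pow, abs_neg, abs_one, one_pow, one_mul]
    have e2 : ∫ z, alternatingSum (fun t => g (glue w t z)) (cellPt N m a) (cellPt N m b)
          ∂cubeMeasure {j // j ∉ w} =
        ∫ z, (∫ t in box (cellPt N m a) (cellPt N m b), h (glue w t z))
          ∂cubeMeasure {j // j ∉ w} := by
      refine integral_congr_ae ?_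
      filter_upwards [ae_mem_cube] with z hz
      exact (hh.2 z hz).2 _ _ hsub
    have hbc : box (cellPt N m a) (cellPt N m b) ⊆ cube {j // j ∈ w} := by
      rw [← biUnion_cells hN]
      exact (box_cellPt_subset hN ha hb m).trans (subset_biUnion_of_mem
        (u := fun m : {j // j ∈ w} → ℕ =>
          box (fun j => (m j / N j : ℝ)) (fun j => (m j + 1) / N j)) hm)
    have hres : volume.restrict (box (cellPt N m a) (cellPt N m b)) =
        (cubeMeasure {j // j ∈ w}).restrict (box (cellPt N m a) (cellPt N m b)) := by
      rw [← restrict_cube, Measure.restrict_restrict (measurableSet_box _ _),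
        inter_eq_left.2 hbc]
    have e3 : ∫ z, (∫ t in box (cellPt N m a) (cellPt N m b), h (glue w t z))
          ∂cubeMeasure {j // j ∉ w} = ∫ t in box (cellPt N m a) (cellPt N m b), proj w h t := by
      simp_rw [proj_eq]
      refine (integral_integral_swap ?_).symm
      rw [hres, ← Measure.restrict_univ (μ := cubeMeasure {j // j ∉ w}), Measure.prod_restrict]
      exact (integrable_glue w hhi).restrict
    rw [e1, e2, e3]
    exact abs_integral_le_integral_abs
  calc _ ≤ ∑ m ∈ cells N, ∫ t in box (cellPt N m a) (cellPt N m b), |proj w h t| :=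
        Finset.sum_le_sum hcell
    _ = ∫ t in ⋃ m ∈ cells N, box (cellPt N m a) (cellPt N m b), |proj w h t| := by
        have hint : IntegrableOn (fun t => |proj w h t|) (cube {j // j ∈ w}) := by
          rw [IntegrableOn, restrict_cube]
          exact hproj.abs
        rw [integral_biUnion_finset _ (fun m _ => measurableSet_box _ _)
          (fun m _ m' _ hne => disjoint_box_cellPt hN ha hb hne)]
        intro m hm
        refine hint.mono_set ?_
        rw [← biUnion_cells hN]
        exact (box_cellPt_subset hN ha hb m).trans (subset_biUnion_of_mem
          (u := fun m : {j // j ∈ w} → ℕ =>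
            box (fun j => (m j / N j : ℝ)) (fun j => (m j + 1) / N j)) hm)
    _ ≤ ∫ t, |proj w h t| ∂cubeMeasure {j // j ∈ w} := by
        rw [← restrict_cube]
        refine setIntegral_mono_set ?_ (Filter.Eventually.of_forall fun t => abs_nonneg _) ?_
        · rw [IntegrableOn, restrict_cube]
          exact hproj.abs
        · refine LE.le.eventuallyLE ?_
          rw [← biUnion_cells hN]
          exact iUnion₂_mono fun m _ => box_cellPt_subset hN ha hb m
    _ ≤ B := hJ
    _ ≤ B * ∏ j, 4 * (N j : ℝ) ^ (1 - 1 : ℝ) := by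
        refine le_mul_of_one_le_right hB0 ?_
        simp only [sub_self, Real.rpow_zero, mul_one, Finset.prod_const]
        exact one_le_pow₀ (by norm_num)

/-- The infimum in `mixedSeminormSq` need not be known to be attained: the bound follows in the limit
from nearly optimal mixed derivatives. -/
theorem diffBound_of_mixedSeminormSq {w : Finset ι} {g : (ι → ℝ) → ℝ}
    (hg : Integrable g (cubeMeasure ι)) (hfin : mixedSeminormSq w g ≠ ⊤) :
    DiffBound 1 (proj w g) √(mixedSeminormSq w g).toReal := by
  intro N hN
  have hn : ∀ n : ℕ, ∀ᵐ x ∂pairMeasure {j // j ∈ w}, Far x → ∑ m ∈ cells N,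
      |alternatingSum (proj w g) (cellPt N m fun j => (x j).2) (cellPt N m fun j => (x j).1)| ≤
        √((mixedSeminormSq w g).toReal + 1 / ((n : ℝ) + 1)) *
          ∏ j, 4 * (N j : ℝ) ^ (1 - 1 : ℝ) := by
    intro n
    have hlt : mixedSeminormSq w g < mixedSeminormSq w g + ENNReal.ofReal (1 / ((n : ℝ) + 1)) := by
      refine ENNReal.lt_add_right hfin ?_
      have : (0 : ℝ) < 1 / ((n : ℝ) + 1) := by positivity
      simpa using this
    conv_lhs at hlt => rw [mixedSeminormSq]
    simp only [iInf_lt_iff] at hlt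
    obtain ⟨h, hh, hlt⟩ := hlt
    have hL := ne_top_of_lt hlt
    filter_upwards [diffBound_of_hasMixedDeriv hg hh hL N hN] with x hx hfar
    refine (hx hfar).trans ?_
    have h1 := ENNReal.toReal_mono (by simp [hfin]) hlt.le
    rw [ENNReal.toReal_add hfin ENNReal.ofReal_ne_top, ENNReal.toReal_ofReal (by positivity)] at h1
    refine mul_le_mul_of_nonneg_right (Real.sqrt_le_sqrt h1) ?_
    exact Finset.prod_nonneg fun j _ => by positivity
  filter_upwards [ae_all_iff.2 hn] with x hx hfar
  have hlim : Filter.Tendsto (fun n : ℕ =>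
      √((mixedSeminormSq w g).toReal + 1 / ((n : ℝ) + 1)) * ∏ j, 4 * (N j : ℝ) ^ (1 - 1 : ℝ))
      Filter.atTop (nhds (√((mixedSeminormSq w g).toReal + 0) *
        ∏ j, 4 * (N j : ℝ) ^ (1 - 1 : ℝ))) :=
    ((Real.continuous_sqrt.tendsto _).comp
      (tendsto_one_div_add_atTop_nhds_zero_nat.const_add _)).mul_const _
  rw [add_zero] at hlim
  exact ge_of_tendsto' hlim fun n => hx n hfar

/-- The derivative with respect to no variable is the function itself, which is hence square
integrable. -/
theorem integrable_of_mixedSeminormSq_empty {g : (ι → ℝ) → ℝ} (h : mixedSeminormSq ∅ g ≠ ⊤) :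
    Integrable g (cubeMeasure ι) := by
  have h1 := lt_top_iff_ne_top.2 h
  rw [mixedSeminormSq] at h1
  simp only [iInf_lt_iff] at h1
  obtain ⟨k, hk, -⟩ := h1
  have hki : Integrable k (cubeMeasure ι) := by
    have := hk.1
    rw [restrict_cube] at this
    exact this.integrable one_le_two
  refine hki.congr ?_
  filter_upwards [ae_mem_cube] with x hx
  have hz : (fun j : {j // j ∉ (∅ : Finset ι)} => x j) ∈ cube {j // j ∉ (∅ : Finset ι)} :=
    fun j _ => hx j (mem_univ _)
  have hglue : ∀ t : {j // j ∈ (∅ : Finset ι)} → ℝ, glue ∅ t (fun j => x j) = x := by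
    intro t
    ext j
    simp [glue]
  have : IsEmpty {j // j ∈ (∅ : Finset ι)} := ⟨fun j => Finset.notMem_empty _ j.2⟩
  have h2 := (hk.2 _ hz).2 0 0 (fun j => this.elim j)
  simp only [hglue, alternatingSum, setIntegral_const] at h2
  have hvol : volume.real (box (0 : {j // j ∈ (∅ : Finset ι)} → ℝ) 0) = 1 := by
    rw [Measure.real, box, volume_pi_pi]
    simp
  rw [hvol, Fintype.sum_unique, Finset.card_eq_zero.2 (Finset.eq_empty_of_isEmpty _)] at h2
  simpa using h2.symm

end Glue

/-! ### Integrals against products of oscillating functions -/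

theorem integral_vol01 {E : Type*} [NormedAddCommGroup E] [NormedSpace ℝ E] (f : ℝ → E) :
    ∫ x, f x ∂vol01 = ∫ x in (0 : ℝ)..1, f x := by
  rw [intervalIntegral.integral_of_le zero_le_one, integral_Ico_eq_integral_Ioc]

theorem integral_cell {N : ℕ} (hN : 0 < N) (m : ℕ) (f : ℝ → ℂ) :
    ∫ z, f ((m + z) / N) ∂vol01 = N * ∫ x in (m / N : ℝ)..((m + 1) / N), f x := by
  have hN' : (N : ℝ) ≠ 0 := Nat.cast_ne_zero.2 hN.ne'
  have e : ∀ z : ℝ, ((m : ℝ) + z) / N = z / N + m / N := fun z => by ring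
  simp_rw [integral_vol01, e]
  rw [intervalIntegral.integral_comp_div_add _ hN']
  simp only [zero_div, zero_add, Complex.real_smul, Complex.ofReal_natCast, ← add_div,
    add_comm (1 : ℝ)]

section Osc

variable {ι : Type*} [Fintype ι] [DecidableEq ι]

/-- Coordinates on which the product does not depend can be integrated out. -/
theorem integral_mul_prod_eq_proj (w : Finset ι) {G : (ι → ℝ) → ℝ}
    (hG : Integrable G (cubeMeasure ι)) {K : ι → ℝ → ℂ} (hK : ∀ j, Measurable (K j)) {M : ι → ℝ}
    (hM : ∀ j, ∀ t ∈ Ico (0 : ℝ) 1, ‖K j t‖ ≤ M j) :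
    ∫ x, (G x : ℂ) * ∏ j ∈ w, K j (x j) ∂cubeMeasure ι =
      ∫ x, (proj w G x : ℂ) * ∏ j : {j // j ∈ w}, K j (x j) ∂cubeMeasure {j // j ∈ w} := by
  have hmp := measurePreserving_glue w (fun _ : ι => vol01)
  have hint : Integrable (fun x => (G x : ℂ) * ∏ j ∈ w, K j (x j)) (cubeMeasure ι) := by
    refine Integrable.mul_bdd (c := ∏ j ∈ w, M j) hG.ofReal
      (Finset.measurable_fun_prod _ fun j _ =>
        (hK j).comp (measurable_pi_apply j)).aestronglyMeasurable ?_
    filter_upwards [ae_mem_cube] with x hx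
    rw [norm_prod]
    exact Finset.prod_le_prod (fun j _ => norm_nonneg _) fun j _ => hM j _ (hx j (mem_univ j))
  rw [← hmp.integral_comp (measurableEmbedding_glue w)]
  refine (integral_prod _ (hmp.integrable_comp_of_integrable hint)).trans ?_
  refine integral_congr_ae (Filter.Eventually.of_forall fun x => ?_)
  have h1 : ∀ z : {j // j ∉ w} → ℝ, ∏ j ∈ w, K j (glue w x z j) =
      ∏ j : {j // j ∈ w}, K j (x j) := by
    intro z
    rw [← Finset.prod_coe_sort]
    refine Finset.prod_congr rfl fun j _ => ?_
    simp [glue, j.2]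
  simp only [Function.comp_apply, h1]
  rw [integral_mul_const, proj_eq]
  congr 1
  exact integral_complex_ofReal

/-- Expanding each factor into its mean and its oscillating part, the integral against a product of
functions becomes a sum of integrals of the projections of `G` against products of functions of
mean zero on the cells of a grid. -/
theorem norm_integral_mul_prod_osc_le {q : ℕ} (hq : 0 < q) {G : (ι → ℝ) → ℝ}
    (hG : Integrable G (cubeMeasure ι)) {lam : ℝ} {B : Finset ι → ℝ} (hB0 : ∀ w, 0 ≤ B w)
    (hB : ∀ w, DiffBound lam (proj w G) (B w)) {K : ι → ℝ → ℂ} (hKm : ∀ j, Measurable (K j))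
    {e : ι → ℕ} {M : ι → ℝ} (hK : ∀ j, OscBound q (K j) (e j) (M j)) :
    ‖∫ x, (G x : ℂ) * ∏ j, K j (x j) ∂cubeMeasure ι‖ ≤
      (∏ j, 256 * (M j * (q : ℝ) ^ (-(lam * e j)))) * ∑ w, B w := by
  have hq' : (0 : ℝ) < q := Nat.cast_pos.2 hq
  have hM0 : ∀ j, 0 ≤ M j := fun j => (norm_nonneg _).trans ((hK j).bound 0 (by simp))
  set c : ι → ℂ := fun j => ∫ y in (0 : ℝ)..1, K j y with hc
  set D : ι → ℝ → ℂ := fun j t => K j t - c j with hD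
  have hcM : ∀ j, ‖c j‖ ≤ M j := by
    intro j
    refine (intervalIntegral.norm_integral_le_of_norm_le_const (C := M j) fun x hx => ?_).trans ?_
    · rw [uIoc_of_le zero_le_one] at hx
      exact (hK j).bound x ⟨hx.1.le, hx.2⟩
    · simp
  -- The factor `q ^ (-(lam * e j))` is lost only if `e j = 0`, as otherwise the mean vanishes.
  have hcM' : ∀ j, ‖c j‖ ≤ 256 * (M j * (q : ℝ) ^ (-(lam * e j))) := by
    intro j
    rcases (hK j).mean with h | h
    · rw [h]
      simp only [CharP.cast_eq_zero, mul_zero, neg_zero, Real.rpow_zero, mul_one]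
      linarith [hcM j, hM0 j]
    · simp only [hc, h, norm_zero]
      have := hM0 j
      positivity
  have hDm : ∀ j, Measurable (D j) := fun j => (hKm j).sub_const _
  have hDM : ∀ j, ∀ t ∈ Ico (0 : ℝ) 1, ‖D j t‖ ≤ 2 * M j := by
    intro j t ht
    refine (norm_sub_le _ _).trans ?_
    linarith [(hK j).bound t ⟨ht.1, ht.2.le⟩, hcM j]
  have hDint : ∀ w : Finset ι, Integrable (fun x => (G x : ℂ) * ∏ j ∈ w, D j (x j))
      (cubeMeasure ι) := by
    intro w
    refine Integrable.mul_bdd (c := ∏ j ∈ w, 2 * M j) hG.ofReal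
      (Finset.measurable_fun_prod _ fun j _ =>
        (hDm j).comp (measurable_pi_apply j)).aestronglyMeasurable ?_
    filter_upwards [ae_mem_cube] with x hx
    rw [norm_prod]
    exact Finset.prod_le_prod (fun j _ => norm_nonneg _) fun j _ => hDM j _ (hx j (mem_univ j))
  have hexp : ∀ x : ι → ℝ, (G x : ℂ) * ∏ j, K j (x j) =
      ∑ w : Finset ι, (∏ j ∈ Finset.univ \ w, c j) * ((G x : ℂ) * ∏ j ∈ w, D j (x j)) := by
    intro x
    have h1 : ∏ j, K j (x j) = ∏ j, (D j (x j) + c j) :=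
      Finset.prod_congr rfl fun j _ => by simp [hD]
    rw [h1, Finset.prod_add, Finset.powerset_univ, Finset.mul_sum]
    exact Finset.sum_congr rfl fun w _ => by ring
  simp_rw [hexp]
  rw [integral_finsetSum _ fun w _ => (hDint w).const_mul _, Finset.mul_sum]
  refine (norm_sum_le _ _).trans (Finset.sum_le_sum fun w _ => ?_)
  rw [integral_const_mul, norm_mul, norm_prod, integral_mul_prod_eq_proj w hG hDm hDM,
    ← Finset.prod_sdiff (Finset.subset_univ w), mul_assoc]
  have hP : ∀ j, 0 ≤ 256 * (M j * (q : ℝ) ^ (-(lam * e j))) := fun j =>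
    (norm_nonneg _).trans (hcM' j)
  refine mul_le_mul (Finset.prod_le_prod (fun j _ => norm_nonneg _) fun j _ => hcM' j) ?_
    (norm_nonneg _) (Finset.prod_nonneg fun j _ => hP j)
  have hmain := norm_integral_mul_prod_le (integrable_proj w hG) (K := fun j => D j)
    (M := fun j : {j // j ∈ w} => 2 * M j) (N := fun j : {j // j ∈ w} => q ^ e j)
    (B := B w * ∏ j : {j // j ∈ w}, 4 * ((q ^ e j : ℕ) : ℝ) ^ (1 - lam))
    (fun j => pow_pos hq _) (fun j => hDm j) (fun j => hDM j)
    (fun j m hm => by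
      rw [integral_cell (pow_pos hq _)]
      have := (hK j).cell m hm
      push_cast
      simp only [hD, hc]
      rw [this, mul_zero])
    (mul_nonneg (hB0 w) (Finset.prod_nonneg fun j _ => by positivity))
    (hB w _ fun j => pow_pos hq _)
  refine hmain.trans_eq ?_
  rw [mul_left_comm, ← Finset.prod_mul_distrib, mul_comm, ← Finset.prod_coe_sort w]
  congr 1
  refine Finset.prod_congr rfl fun j _ => ?_
  have h1 : ((q ^ e j : ℕ) : ℝ) ^ (1 - lam) = (q : ℝ) ^ e j * (q : ℝ) ^ (-(lam * e j)) := by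
    push_cast
    rw [← Real.rpow_natCast, ← Real.rpow_mul hq'.le, ← Real.rpow_add hq']
    congr 1
    ring
  rw [h1]
  push_cast
  have h2 : (0 : ℝ) < (q : ℝ) ^ e j := by positivity
  field_simp
  ring

end Osc

/-! ### Taylor's formula in one variable -/

/-- The kernel `(x - t)₊ ^ n / n!` of Taylor's formula. The value at `t = x` is the one of
`(x - t) ^ n / n!`, so that `taylorKer n x 0 = x ^ n / n!` for all `x ≥ 0`. -/
noncomputable def taylorKer (n : ℕ) (x t : ℝ) : ℝ :=
  if t ≤ x then (x - t) ^ n / n.factorial else 0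

theorem measurable_taylorKer (n : ℕ) : Measurable fun p : ℝ × ℝ => taylorKer n p.1 p.2 := by
  refine Measurable.ite (measurableSet_le measurable_snd measurable_fst) ?_ measurable_const
  exact ((measurable_fst.sub measurable_snd).pow_const n).div_const _

theorem abs_taylorKer_le (n : ℕ) {x t : ℝ} (hx : x ∈ Icc (0 : ℝ) 1) (ht : t ∈ Icc (0 : ℝ) 1) :
    |taylorKer n x t| ≤ 1 := by
  unfold taylorKer
  split_ifs with h
  · have h0 : 0 ≤ x - t := sub_nonneg.2 h
    rw [abs_of_nonneg (by positivity)]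
    refine div_le_one_of_le₀ ?_ (by positivity)
    calc (x - t) ^ n ≤ 1 := pow_le_one₀ h0 (by linarith [hx.2, ht.1])
      _ ≤ _ := by exact_mod_cast n.factorial_pos
  · simp

/-- The kernels are successive primitives of each other in the variable `t`. -/
theorem integral_taylorKer (n : ℕ) {x r : ℝ} (hx : x ≤ 1) (hr : r ≤ 1) :
    ∫ t in r..1, taylorKer n x t = taylorKer (n + 1) x r := by
  have hzero : ∀ {a : ℝ}, x ≤ a → a ≤ 1 → ∫ t in a..1, taylorKer n x t = 0 := by
    intro a hxa ha
    rw [intervalIntegral.integral_congr_ae (g := fun _ => 0)]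
    · simp
    · refine Filter.Eventually.of_forall fun t ht => ?_
      rw [uIoc_of_le ha] at ht
      exact if_neg (not_le.2 (hxa.trans_lt ht.1))
  rcases le_or_gt r x with h | h
  · have hpoly : ∀ t ∈ uIcc r x, taylorKer n x t = (x - t) ^ n / n.factorial := by
      intro t ht
      rw [uIcc_of_le h] at ht
      exact if_pos ht.2
    have h1 : ∫ t in r..x, taylorKer n x t = taylorKer (n + 1) x r := by
      rw [intervalIntegral.integral_congr hpoly, intervalIntegral.integral_div,
        intervalIntegral.integral_comp_sub_left (fun t => t ^ n), integral_pow, taylorKer, if_pos h,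
        Nat.factorial_succ]
      push_cast
      rw [sub_self, zero_pow (Nat.succ_ne_zero n), sub_zero, div_div]
    have i1 : IntervalIntegrable (taylorKer n x) volume r x := by
      refine IntervalIntegrable.congr_uIoo (f := fun t => (x - t) ^ n / n.factorial) ?_ ?_
      · exact Continuous.intervalIntegrable (by fun_prop) _ _
      · intro t ht
        exact (hpoly t (Ioo_subset_Icc_self ht)).symm
    have i2 : IntervalIntegrable (taylorKer n x) volume x 1 := by
      refine IntervalIntegrable.congr_uIoo (f := fun _ => (0 : ℝ))
        intervalIntegrable_const ?_
      intro t ht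
      rw [uIoo_of_le hx] at ht
      exact (if_neg (not_le.2 ht.1)).symm
    rw [← intervalIntegral.integral_add_adjacent_intervals i1 i2, h1, hzero le_rfl hx, add_zero]
  · rw [hzero h.le hr, taylorKer, if_neg (not_le.2 h)]

theorem ae_mem_vol01 : ∀ᵐ x ∂vol01, x ∈ Ico (0 : ℝ) 1 := ae_restrict_mem measurableSet_Ico

theorem integral_taylorKer_zero_mul {E : Type*} [NormedAddCommGroup E] [NormedSpace ℝ E] {r : ℝ}
    (hr : r ∈ Icc (0 : ℝ) 1) (f : ℝ → E) :
    ∫ t, taylorKer 0 t r • f t ∂vol01 = ∫ t in r..1, f t := by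
  rw [intervalIntegral.integral_of_le hr.2, ← integral_Icc_eq_integral_Ioc,
    integral_Icc_eq_integral_Ico]
  have e : (fun t => taylorKer 0 t r • f t) = (Ici r).indicator f := by
    ext t
    by_cases h : r ≤ t
    · simp [taylorKer, h]
    · simp [taylorKer, h]
  rw [e, integral_indicator measurableSet_Ici, Measure.restrict_restrict measurableSet_Ici]
  congr 2
  ext t
  simp only [mem_inter_iff, mem_Ici, mem_Ico]
  exact ⟨fun h => ⟨h.1, h.2.2⟩, fun h => ⟨h.1, hr.1.trans h.1, h.2⟩⟩

theorem integrable_mul_taylorKer {Ω : Type*} [MeasurableSpace Ω] {μ : Measure Ω} {f a b : Ω → ℝ}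
    (hf : Integrable f μ) (ha : Measurable a) (hb : Measurable b)
    (ha' : ∀ᵐ ω ∂μ, a ω ∈ Icc (0 : ℝ) 1) (hb' : ∀ᵐ ω ∂μ, b ω ∈ Icc (0 : ℝ) 1) (n : ℕ) :
    Integrable (fun ω => f ω * taylorKer n (a ω) (b ω)) μ := by
  refine hf.mul_bdd (c := 1) ((measurable_taylorKer n).comp (ha.prodMk hb)).aestronglyMeasurable ?_
  filter_upwards [ha', hb'] with ω h1 h2
  exact abs_taylorKer_le n h1 h2

/-- One-sided derivative on `[0,1)`. -/
noncomputable def derivIco (h : ℝ → ℝ) (x : ℝ) : ℝ := derivWithin h (Ico 0 1) x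

/-- A function that is differentiable everywhere is the integral of its derivative as soon as the
derivative is integrable. -/
theorem eq_add_integral_derivIco {h : ℝ → ℝ}
    (hd : ∀ x ∈ Ico (0 : ℝ) 1, DifferentiableWithinAt ℝ h (Ico 0 1) x)
    (hi : Integrable (derivIco h) vol01) {x : ℝ} (hx : x ∈ Ico (0 : ℝ) 1) :
    h x = h 0 + ∫ t, derivIco h t * taylorKer 0 x t ∂vol01 := by
  have hsub : Icc 0 x ⊆ Ico (0 : ℝ) 1 := fun t ht => ⟨ht.1, ht.2.trans_lt hx.2⟩
  have h1 : ∫ t in (0 : ℝ)..x, derivIco h t = h x - h 0 := by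
    refine intervalIntegral.integral_eq_sub_of_hasDeriv_right_of_le hx.1 ?_ ?_ ?_
    · intro t ht
      exact (hd t (hsub ht)).continuousWithinAt.mono hsub
    · intro t ht
      have ht' : t ∈ Ico (0 : ℝ) 1 := hsub ⟨ht.1.le, ht.2.le⟩
      exact ((hd t ht').hasDerivWithinAt.hasDerivAt
        (Ico_mem_nhds ht.1 (ht.2.trans hx.2))).hasDerivWithinAt
    · rw [intervalIntegrable_iff_integrableOn_Icc_of_le hx.1]
      exact IntegrableOn.mono_set hi hsub
  have h2 : ∫ t, derivIco h t * taylorKer 0 x t ∂vol01 = ∫ t in (0 : ℝ)..x, derivIco h t := by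
    have e : (fun t => derivIco h t * taylorKer 0 x t) = (Iic x).indicator (derivIco h) := by
      ext t
      by_cases h : t ≤ x
      · simp [taylorKer, h]
      · simp [taylorKer, h]
    rw [e, integral_indicator measurableSet_Iic, Measure.restrict_restrict measurableSet_Iic,
      intervalIntegral.integral_of_le hx.1, ← integral_Icc_eq_integral_Ioc]
    congr 2
    ext t
    simp only [mem_inter_iff, mem_Iic, mem_Ico, mem_Icc]
    exact ⟨fun h => ⟨h.2.1, h.1⟩, fun h => ⟨h.2, h.1, h.2.trans_lt hx.2⟩⟩
  rw [h2, h1]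
  ring

/-- A function with integrable derivative is bounded, hence integrable. -/
theorem integrable_of_derivIco {h : ℝ → ℝ}
    (hd : ∀ x ∈ Ico (0 : ℝ) 1, DifferentiableWithinAt ℝ h (Ico 0 1) x)
    (hi : Integrable (derivIco h) vol01) : Integrable h vol01 := by
  have hc : ContinuousOn h (Ico 0 1) := fun x hx => (hd x hx).continuousWithinAt
  refine Integrable.of_bound (C := |h 0| + ∫ t, |derivIco h t| ∂vol01)
    (hc.aestronglyMeasurable measurableSet_Ico) ?_
  filter_upwards [ae_mem_vol01] with x hx
  rw [eq_add_integral_derivIco hd hi hx]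
  refine (norm_add_le _ _).trans (add_le_add le_rfl ?_)
  refine (norm_integral_le_integral_norm _).trans ?_
  refine integral_mono_ae ?_ hi.abs ?_
  · exact (integrable_mul_taylorKer hi measurable_const measurable_id
      (Filter.Eventually.of_forall fun _ => ⟨hx.1, hx.2.le⟩)
      (ae_mem_vol01.mono fun t ht => ⟨ht.1, ht.2.le⟩) 0).norm
  · filter_upwards [ae_mem_vol01] with t ht
    rw [norm_mul, Real.norm_eq_abs, Real.norm_eq_abs]
    exact mul_le_of_le_one_right (abs_nonneg _)
      (abs_taylorKer_le 0 ⟨hx.1, hx.2.le⟩ ⟨ht.1, ht.2.le⟩)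

/-- Taylor's formula with integral remainder, for a function whose derivative of top order exists
everywhere and is integrable, but need not be continuous. -/
theorem taylor_derivIco (n : ℕ) {h : ℝ → ℝ}
    (hd : ∀ i ≤ n, ∀ x ∈ Ico (0 : ℝ) 1, DifferentiableWithinAt ℝ (derivIco^[i] h) (Ico 0 1) x)
    (hi : Integrable (derivIco^[n + 1] h) vol01) {x : ℝ} (hx : x ∈ Ico (0 : ℝ) 1) :
    h x = ∑ i ∈ Finset.range (n + 1), derivIco^[i] h 0 * taylorKer i x 0 +
      ∫ t, derivIco^[n + 1] h t * taylorKer n x t ∂vol01 := by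
  have hx' : x ∈ Icc (0 : ℝ) 1 := ⟨hx.1, hx.2.le⟩
  induction n with
  | zero =>
    have h0 := eq_add_integral_derivIco (hd 0 le_rfl) (by simpa using hi) hx
    simpa [taylorKer, hx.1] using h0
  | succ n ih =>
    set g := derivIco^[n + 1] h with hg
    have hg' : derivIco^[n + 1 + 1] h = derivIco g := Function.iterate_succ_apply' _ _ _
    rw [hg'] at hi ⊢
    have hgd : ∀ x ∈ Ico (0 : ℝ) 1, DifferentiableWithinAt ℝ g (Ico 0 1) x := hd (n + 1) le_rfl
    rw [ih (fun i hin => hd i (hin.trans (Nat.le_succ n))) (integrable_of_derivIco hgd hi),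
      Finset.sum_range_succ (n := n + 1), add_assoc, ← hg]
    congr 1
    have hae : ∀ᵐ t ∂vol01, t ∈ Icc (0 : ℝ) 1 := ae_mem_vol01.mono fun t ht => ⟨ht.1, ht.2.le⟩
    have hK : Integrable (fun t => taylorKer n x t) vol01 := by
      simpa using integrable_mul_taylorKer (integrable_const (1 : ℝ)) measurable_const
        measurable_id (Filter.Eventually.of_forall fun _ => hx') hae n
    -- the double integral obtained by inserting the integral representation of `g`
    have hprod : Integrable (fun p : ℝ × ℝ =>
        derivIco g p.2 * taylorKer n x p.1 * taylorKer 0 p.1 p.2) (vol01.prod vol01) := by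
      have h1 : Integrable (fun p : ℝ × ℝ => derivIco g p.2) (vol01.prod vol01) := hi.comp_snd _
      have a1 : ∀ᵐ p ∂vol01.prod vol01, p.1 ∈ Icc (0 : ℝ) 1 :=
        Measure.quasiMeasurePreserving_fst.ae hae
      have a2 : ∀ᵐ p ∂vol01.prod vol01, p.2 ∈ Icc (0 : ℝ) 1 :=
        Measure.quasiMeasurePreserving_snd.ae hae
      exact integrable_mul_taylorKer (integrable_mul_taylorKer h1 measurable_const measurable_fst
        (Filter.Eventually.of_forall fun _ => hx') a1 n) measurable_fst measurable_snd a1 a2 0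
    have e1 : ∫ t, g t * taylorKer n x t ∂vol01 =
        ∫ t, (g 0 * taylorKer n x t +
          ∫ r, derivIco g r * taylorKer n x t * taylorKer 0 t r ∂vol01) ∂vol01 := by
      refine integral_congr_ae ?_
      filter_upwards [ae_mem_vol01] with t ht
      rw [eq_add_integral_derivIco (h := g) hgd hi ht, add_mul, ← integral_mul_const]
      congr 1
      exact integral_congr_ae (Filter.Eventually.of_forall fun r => by ring)
    rw [e1, integral_add (hK.const_mul _) hprod.integral_prod_left, integral_const_mul,
      integral_vol01, integral_taylorKer n hx'.2 zero_le_one, integral_integral_swap hprod]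
    congr 1
    refine integral_congr_ae ?_
    filter_upwards [ae_mem_vol01] with r hr
    have e2 : ∀ t, derivIco g r * taylorKer n x t * taylorKer 0 t r =
        derivIco g r * (taylorKer 0 t r • taylorKer n x t) := fun t => by
      rw [smul_eq_mul]; ring
    simp_rw [e2]
    rw [integral_const_mul, integral_taylorKer_zero_mul ⟨hr.1, hr.2.le⟩,
      integral_taylorKer n hx'.2 hr.2.le]

/-- Integrating the Taylor kernels in their first variable yields the iterated primitives. -/
theorem integral_taylorKer_mul (n : ℕ) {Φ : ℝ → ℂ} {B : ℝ} (hΦm : Measurable Φ)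
    (hB : ∀ t ∈ Icc (0 : ℝ) 1, ‖Φ t‖ ≤ B) {t : ℝ} (ht : t ∈ Icc (0 : ℝ) 1) :
    ∫ x, (taylorKer n x t : ℂ) * Φ x ∂vol01 = bint^[n + 1] Φ t := by
  have hae : ∀ᵐ t ∂vol01, t ∈ Icc (0 : ℝ) 1 := ae_mem_vol01.mono fun t ht => ⟨ht.1, ht.2.le⟩
  induction n generalizing t with
  | zero =>
    simp_rw [← Complex.real_smul]
    rw [integral_taylorKer_zero_mul ht]
    rfl
  | succ n ih =>
    rw [Function.iterate_succ_apply', bint]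
    have e1 : ∫ r in t..1, bint^[n + 1] Φ r =
        ∫ r, taylorKer 0 r t • bint^[n + 1] Φ r ∂vol01 := (integral_taylorKer_zero_mul ht _).symm
    have e2 : ∫ r, taylorKer 0 r t • bint^[n + 1] Φ r ∂vol01 =
        ∫ r, ∫ x, (taylorKer 0 r t : ℂ) * ((taylorKer n x r : ℂ) * Φ x) ∂vol01 ∂vol01 := by
      refine integral_congr_ae ?_
      filter_upwards [hae] with r hr
      rw [integral_const_mul, ih hr, Complex.real_smul]
    have hprod : Integrable (fun p : ℝ × ℝ =>
        (taylorKer 0 p.1 t : ℂ) * ((taylorKer n p.2 p.1 : ℂ) * Φ p.2)) (vol01.prod vol01) := by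
      have a1 : ∀ᵐ p ∂vol01.prod vol01, p.1 ∈ Icc (0 : ℝ) 1 :=
        Measure.quasiMeasurePreserving_fst.ae hae
      have a2 : ∀ᵐ p ∂vol01.prod vol01, p.2 ∈ Icc (0 : ℝ) 1 :=
        Measure.quasiMeasurePreserving_snd.ae hae
      refine Integrable.of_bound (C := 1 * (1 * B)) ?_ ?_
      · refine Measurable.aestronglyMeasurable (Measurable.mul ?_ (Measurable.mul ?_ ?_))
        · exact Complex.measurable_ofReal.comp
            ((measurable_taylorKer 0).comp (measurable_fst.prodMk measurable_const))
        · exact Complex.measurable_ofReal.comp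
            ((measurable_taylorKer n).comp (measurable_snd.prodMk measurable_fst))
        · exact hΦm.comp measurable_snd
      · filter_upwards [a1, a2] with p h1 h2
        rw [norm_mul, norm_mul, Complex.norm_real, Complex.norm_real]
        gcongr
        · exact abs_taylorKer_le 0 h1 ht
        · exact abs_taylorKer_le n h2 h1
        · exact hB _ h2
    rw [e1, e2, integral_integral_swap hprod]
    refine integral_congr_ae ?_
    filter_upwards [hae] with x hx
    have e3 : ∀ r, (taylorKer 0 r t : ℂ) * ((taylorKer n x r : ℂ) * Φ x) =
        ((taylorKer 0 r t • taylorKer n x r : ℝ) : ℂ) * Φ x := by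
      intro r
      rw [smul_eq_mul]
      push_cast
      ring
    simp_rw [e3]
    rw [integral_mul_const, integral_complex_ofReal, integral_taylorKer_zero_mul ht,
      integral_taylorKer n hx.2 ht.2]

/-! ### Slices of mixed partial derivatives -/

section Slice

variable {s : ℕ}

theorem cons_mem_cube {x : ℝ} {y : Fin s → ℝ} :
    (Fin.cons x y : Fin (s + 1) → ℝ) ∈ cube (Fin (s + 1)) ↔ x ∈ Ico (0 : ℝ) 1 ∧ y ∈ cube (Fin s) := by
  simp only [cube, mem_univ_pi, Fin.forall_fin_succ, Fin.cons_zero, Fin.cons_succ]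

theorem iterate_partialDeriv_succ_cons (j : Fin s) (m : ℕ) (g : (Fin (s + 1) → ℝ) → ℝ) (x : ℝ) :
    (fun y : Fin s → ℝ => (partialDeriv j.succ)^[m] g (Fin.cons x y)) =
      (partialDeriv j)^[m] fun y => g (Fin.cons x y) := by
  induction m generalizing g with
  | zero => rfl
  | succ m ih =>
    rw [Function.iterate_succ_apply, Function.iterate_succ_apply, ih]
    congr 1
    funext y
    simp only [partialDeriv, Fin.cons_succ, ← Fin.cons_update]

theorem iterate_partialDeriv_zero_cons (m : ℕ) (g : (Fin (s + 1) → ℝ) → ℝ) (y : Fin s → ℝ) :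
    (fun x : ℝ => (partialDeriv 0)^[m] g (Fin.cons x y)) =
      derivIco^[m] fun x => g (Fin.cons x y) := by
  induction m generalizing g with
  | zero => rfl
  | succ m ih =>
    rw [Function.iterate_succ_apply, Function.iterate_succ_apply, ih]
    congr 1
    funext x
    simp only [partialDeriv, derivIco, Fin.cons_zero, Fin.update_cons_zero]

/-- The derivatives in the first variable are taken last, so that a mixed partial derivative is an
iterated derivative in the first variable of mixed partial derivatives of slices. -/
theorem mixedPartial_cons (i : ℕ) (τ : Fin s → ℕ) (f : (Fin (s + 1) → ℝ) → ℝ) (x : ℝ)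
    (y : Fin s → ℝ) :
    mixedPartial (Fin.cons i τ) f (Fin.cons x y) =
      derivIco^[i] (fun u => mixedPartial τ (fun z => f (Fin.cons u z)) y) x := by
  have key : ∀ (l : List (Fin s)) (u : ℝ),
      (fun z : Fin s → ℝ => l.foldr (fun j g => (partialDeriv j.succ)^[τ j] g) f (Fin.cons u z)) =
        l.foldr (fun j g => (partialDeriv j)^[τ j] g) fun z => f (Fin.cons u z) := by
    intro l u
    induction l with
    | nil => rfl
    | cons j l ih => rw [List.foldr_cons, List.foldr_cons, iterate_partialDeriv_succ_cons, ih]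
  rw [mixedPartial, List.finRange_succ, List.foldr_cons, List.foldr_map]
  simp only [Fin.cons_zero, Fin.cons_succ]
  refine (congrFun (iterate_partialDeriv_zero_cons i _ y) x).trans ?_
  exact congrArg (fun g => derivIco^[i] g x) (funext fun u => congrFun (key _ u) y)

theorem HasMixedPartials.slice {δ : ℕ} {f : (Fin (s + 1) → ℝ) → ℝ} (hf : HasMixedPartials δ f)
    {x : ℝ} (hx : x ∈ Ico (0 : ℝ) 1) : HasMixedPartials δ fun y => f (Fin.cons x y) := by
  intro τ j hτ hj h0 y hy
  have h := hf (Fin.cons 0 τ) j.succ (Fin.cases (Nat.zero_le _) hτ) hj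
    (Fin.cases (fun _ => rfl) fun i hi => h0 i (Fin.succ_lt_succ_iff.1 hi)) (Fin.cons x y)
    (cons_mem_cube.2 ⟨hx, hy⟩)
  simpa only [Fin.cons_succ, ← Fin.cons_update, mixedPartial_cons, Function.iterate_zero, id] using h

theorem HasMixedPartials.differentiable_derivIco {δ : ℕ} {f : (Fin (s + 1) → ℝ) → ℝ}
    (hf : HasMixedPartials δ f) {τ : Fin s → ℕ} (hτ : ∀ j, τ j ≤ δ) {i : ℕ} (hi : i < δ)
    {y : Fin s → ℝ} (hy : y ∈ cube (Fin s)) {x : ℝ} (hx : x ∈ Ico (0 : ℝ) 1) :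
    DifferentiableWithinAt ℝ
      (derivIco^[i] fun u => mixedPartial τ (fun z => f (Fin.cons u z)) y) (Ico 0 1) x := by
  have h := hf (Fin.cons i τ) 0 (Fin.cases hi.le hτ) hi (fun j hj => absurd hj (Fin.not_lt_zero j))
    (Fin.cons x y) (cons_mem_cube.2 ⟨hx, hy⟩)
  simpa only [Fin.cons_zero, Fin.update_cons_zero, mixedPartial_cons] using h

end Slice

/-! ### Taylor's formula in several variables -/

/-- The measure on `[0,1)` on which the `i`-th derivative enters Taylor's formula of order `δ`: a
unit mass at the origin for `i < δ`, Lebesgue measure for the remainder term `i = δ`. -/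
noncomputable def nodeMeasure (δ i : ℕ) : Measure ℝ := if i = δ then vol01 else Measure.dirac 0

theorem nodeMeasure_self (δ : ℕ) : nodeMeasure δ δ = vol01 := if_pos rfl

theorem nodeMeasure_of_ne {δ i : ℕ} (h : i ≠ δ) : nodeMeasure δ i = Measure.dirac 0 := if_neg h

instance (δ i : ℕ) : IsProbabilityMeasure (nodeMeasure δ i) := by
  unfold nodeMeasure
  split_ifs <;> infer_instance

theorem ae_mem_nodeMeasure (δ i : ℕ) : ∀ᵐ x ∂nodeMeasure δ i, x ∈ Ico (0 : ℝ) 1 := by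
  unfold nodeMeasure
  split_ifs
  · exact ae_mem_vol01
  · refine (ae_dirac_iff (p := fun x : ℝ => x ∈ Ico (0 : ℝ) 1) measurableSet_Ico).2 ?_
    exact ⟨le_rfl, zero_lt_one⟩

/-- The product of the measures `nodeMeasure δ (τ j)`. -/
noncomputable abbrev taylorMeasure {s : ℕ} (δ : ℕ) (τ : Fin s → ℕ) : Measure (Fin s → ℝ) :=
  Measure.pi fun j => nodeMeasure δ (τ j)

theorem ae_mem_taylorMeasure {s : ℕ} (δ : ℕ) (τ : Fin s → ℕ) :
    ∀ᵐ x ∂taylorMeasure δ τ, x ∈ cube (Fin s) := by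
  have h : ∀ᵐ x ∂taylorMeasure δ τ, ∀ j, x j ∈ Ico (0 : ℝ) 1 :=
    ae_all_iff.2 fun j => (Measure.tendsto_eval_ae_ae (i := j)).eventually
      (ae_mem_nodeMeasure δ (τ j))
  exact h.mono fun x hx j _ => hx j

theorem measurePreserving_cons {s : ℕ} (μ : Fin (s + 1) → Measure ℝ) [∀ i, SigmaFinite (μ i)] :
    MeasurePreserving (fun p : ℝ × (Fin s → ℝ) => (Fin.cons p.1 p.2 : Fin (s + 1) → ℝ))
      ((μ 0).prod (Measure.pi fun j => μ j.succ)) (Measure.pi μ) := by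
  have h := (measurePreserving_piFinSuccAbove μ 0).symm
  simp only [Fin.succAbove_zero] at h
  convert h using 1
  funext p
  exact (Fin.insertNth_zero' p.1 p.2).symm

theorem measurableEmbedding_cons (s : ℕ) :
    MeasurableEmbedding fun p : ℝ × (Fin s → ℝ) => (Fin.cons p.1 p.2 : Fin (s + 1) → ℝ) := by
  have h := (MeasurableEquiv.piFinSuccAbove (fun _ : Fin (s + 1) => ℝ) 0).symm.measurableEmbedding
  convert h using 1
  funext p
  exact (Fin.insertNth_zero' p.1 p.2).symm

theorem measurePreserving_cons_taylor {s : ℕ} (δ i : ℕ) (τ : Fin s → ℕ) :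
    MeasurePreserving (fun p : ℝ × (Fin s → ℝ) => (Fin.cons p.1 p.2 : Fin (s + 1) → ℝ))
      ((nodeMeasure δ i).prod (taylorMeasure δ τ))
      (taylorMeasure δ (Fin.cons i τ : Fin (s + 1) → ℕ)) := by
  simpa only [Fin.cons_zero, Fin.cons_succ] using
    measurePreserving_cons fun j => nodeMeasure δ ((Fin.cons i τ : Fin (s + 1) → ℕ) j)

/-- `taylor_derivIco` with all terms written as integrals. -/
theorem taylor_nodeMeasure (n : ℕ) {h : ℝ → ℝ}
    (hd : ∀ i ≤ n, ∀ x ∈ Ico (0 : ℝ) 1, DifferentiableWithinAt ℝ (derivIco^[i] h) (Ico 0 1) x)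
    (hi : Integrable (derivIco^[n + 1] h) vol01) {x : ℝ} (hx : x ∈ Ico (0 : ℝ) 1) :
    h x = ∑ i : Fin (n + 2),
      ∫ t, derivIco^[i] h t * taylorKer (min i n) x t ∂nodeMeasure (n + 1) i := by
  rw [taylor_derivIco n hd hi hx, Fin.sum_univ_castSucc, Finset.sum_range]
  congr 1
  · refine Finset.sum_congr rfl fun i _ => ?_
    have h1 : (i.castSucc : ℕ) ≠ n + 1 := by simpa using i.2.ne
    rw [nodeMeasure_of_ne h1, integral_dirac, Fin.val_castSucc, min_eq_left (Nat.lt_succ_iff.1 i.2)]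
  · rw [Fin.val_last, nodeMeasure_self, min_eq_right (Nat.le_succ n)]

/-- Taylor's formula at the origin in several variables, by induction on their number. For almost
every value of the other variables the top order derivative in the first variable is integrable;
hence the mixed partial derivatives of each slice are again integrable. -/
theorem taylor_mixedPartial (n : ℕ) {s : ℕ} {f : (Fin s → ℝ) → ℝ}
    (hf : HasMixedPartials (n + 1) f)
    (hi : ∀ τ : Fin s → Fin (n + 2),
      Integrable (mixedPartial (fun j => (τ j : ℕ)) f) (taylorMeasure (n + 1) fun j => (τ j : ℕ)))
    {x : Fin s → ℝ} (hx : x ∈ cube (Fin s)) :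
    f x = ∑ τ : Fin s → Fin (n + 2), ∫ t, mixedPartial (fun j => (τ j : ℕ)) f t *
      ∏ j, taylorKer (min (τ j) n) (x j) (t j) ∂taylorMeasure (n + 1) fun j => (τ j : ℕ) := by
  induction s with
  | zero =>
    rw [Fintype.sum_unique]
    have h1 : ∀ t, mixedPartial (fun j => ((default : Fin 0 → Fin (n + 2)) j : ℕ)) f t *
        ∏ j, taylorKer (min ((default : Fin 0 → Fin (n + 2)) j) n) (x j) (t j) = f x := by
      intro t
      rw [Fin.prod_univ_zero, mul_one, Subsingleton.elim t x]
      rfl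
    refine Eq.trans ?_ (integral_congr_ae (Filter.Eventually.of_forall fun t => (h1 t).symm))
    simp
  | succ s ih =>
    obtain ⟨a, y, rfl⟩ : ∃ a y, x = Fin.cons a y := ⟨x 0, Fin.tail x, (Fin.cons_self_tail x).symm⟩
    obtain ⟨ha, hy⟩ := cons_mem_cube.1 hx
    have hcons : ∀ (i : Fin (n + 2)) (τ : Fin s → Fin (n + 2)),
        (fun j => ((Fin.cons i τ : Fin (s + 1) → Fin (n + 2)) j : ℕ)) =
          Fin.cons (i : ℕ) fun j => (τ j : ℕ) := by
      intro i τ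
      funext j
      refine Fin.cases rfl (fun j => rfl) j
    set H : Fin (n + 2) → (Fin s → Fin (n + 2)) → ℝ × (Fin s → ℝ) → ℝ := fun i τ p =>
      mixedPartial (Fin.cons (i : ℕ) fun j => (τ j : ℕ)) f (Fin.cons p.1 p.2) with hH
    have hHd : ∀ i τ t z, H i τ (t, z) =
        derivIco^[i] (fun u => mixedPartial (fun j => (τ j : ℕ)) (fun z => f (Fin.cons u z)) z) t :=
      fun i τ t z => mixedPartial_cons _ _ f t z
    have hHi : ∀ i τ, Integrable (H i τ)
        ((nodeMeasure (n + 1) i).prod (taylorMeasure (n + 1) fun j => (τ j : ℕ))) := by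
      intro i τ
      have h := hi (Fin.cons i τ)
      rw [hcons] at h
      exact ((measurePreserving_cons_taylor (n + 1) i _).integrable_comp_emb
        (measurableEmbedding_cons s)).2 h
    have hHk : ∀ i τ, Integrable (fun p : ℝ × (Fin s → ℝ) => H i τ p * taylorKer (min i n) a p.1)
        ((nodeMeasure (n + 1) i).prod (taylorMeasure (n + 1) fun j => (τ j : ℕ))) := by
      intro i τ
      refine integrable_mul_taylorKer (hHi i τ) measurable_const measurable_fst
        (Filter.Eventually.of_forall fun _ => ⟨ha.1, ha.2.le⟩) ?_ _
      exact Measure.quasiMeasurePreserving_fst.ae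
        ((ae_mem_nodeMeasure (n + 1) i).mono fun t ht => ⟨ht.1, ht.2.le⟩)
    -- Taylor's formula in the first variable
    have h1 : ∀ τ : Fin s → Fin (n + 2), ∀ᵐ z ∂taylorMeasure (n + 1) fun j => (τ j : ℕ),
        mixedPartial (fun j => (τ j : ℕ)) (fun z => f (Fin.cons a z)) z =
          ∑ i : Fin (n + 2), ∫ t, H i τ (t, z) * taylorKer (min i n) a t ∂nodeMeasure (n + 1) i := by
      intro τ
      have h2 := hHi (Fin.last (n + 1)) τ
      rw [Fin.val_last, nodeMeasure_self] at h2
      filter_upwards [ae_mem_taylorMeasure (n + 1) fun j => (τ j : ℕ), h2.prod_left_ae] with z hz h3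
      simp only [hHd] at h3 ⊢
      exact taylor_nodeMeasure n (fun i hin x hx =>
        hf.differentiable_derivIco (fun j => Nat.lt_succ_iff.1 (τ j).2) (Nat.lt_succ_iff.2 hin)
          hz hx) h3 ha
    have hsl := ih (f := fun z => f (Fin.cons a z)) (hf.slice ha) (fun τ => by
      refine Integrable.congr ?_ ((h1 τ).mono fun z hz => hz.symm)
      exact integrable_finsetSum _ fun i _ => (hHk i τ).integral_prod_right) hy
    rw [hsl, ← (Fin.consEquiv fun _ => Fin (n + 2)).sum_comp, Fintype.sum_prod_type,
      Finset.sum_comm]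
    refine Finset.sum_congr rfl fun τ _ => ?_
    have h4 : ∀ᵐ z ∂taylorMeasure (n + 1) fun j => (τ j : ℕ), ∀ j, z j ∈ Icc (0 : ℝ) 1 :=
      (ae_mem_taylorMeasure _ _).mono fun z hz j => ⟨(hz j trivial).1, (hz j trivial).2.le⟩
    have hprodm : Measurable fun z : Fin s → ℝ => ∏ j, taylorKer (min (τ j) n) (y j) (z j) :=
      Finset.measurable_fun_prod _ fun j _ =>
        (measurable_taylorKer _).comp (measurable_const.prodMk (measurable_pi_apply j))
    have hprodb : ∀ᵐ z ∂taylorMeasure (n + 1) fun j => (τ j : ℕ),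
        ‖∏ j, taylorKer (min (τ j) n) (y j) (z j)‖ ≤ 1 := by
      filter_upwards [h4] with z hz
      rw [norm_prod]
      exact Finset.prod_le_one (fun _ _ => norm_nonneg _) fun j _ =>
        abs_taylorKer_le _ ⟨(hy j trivial).1, (hy j trivial).2.le⟩ (hz j)
    have hHkk : ∀ i, Integrable (fun p : ℝ × (Fin s → ℝ) => H i τ p * taylorKer (min i n) a p.1 *
        ∏ j, taylorKer (min (τ j) n) (y j) (p.2 j))
        ((nodeMeasure (n + 1) i).prod (taylorMeasure (n + 1) fun j => (τ j : ℕ))) := by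
      intro i
      refine (hHk i τ).mul_bdd (c := 1) (hprodm.comp measurable_snd).aestronglyMeasurable ?_
      exact Measure.quasiMeasurePreserving_snd.ae hprodb
    have h5 : ∫ z, mixedPartial (fun j => (τ j : ℕ)) (fun z => f (Fin.cons a z)) z *
        ∏ j, taylorKer (min (τ j) n) (y j) (z j) ∂taylorMeasure (n + 1) (fun j => (τ j : ℕ)) =
        ∫ z, ∑ i : Fin (n + 2), ∫ t, H i τ (t, z) * taylorKer (min i n) a t *
          ∏ j, taylorKer (min (τ j) n) (y j) (z j) ∂nodeMeasure (n + 1) i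
          ∂taylorMeasure (n + 1) (fun j => (τ j : ℕ)) := by
      refine integral_congr_ae ?_
      filter_upwards [h1 τ] with z hz
      rw [hz, Finset.sum_mul]
      exact Finset.sum_congr rfl fun i _ => (integral_mul_const _ _).symm
    rw [h5, integral_finsetSum _ fun i _ => (hHkk i).integral_prod_right]
    refine Finset.sum_congr rfl fun i _ => ?_
    have h6 : (Fin.consEquiv fun _ : Fin (s + 1) => Fin (n + 2)) (i, τ) = Fin.cons i τ := rfl
    rw [h6, hcons, ← (measurePreserving_cons_taylor (n + 1) i _).integral_comp
      (measurableEmbedding_cons s), integral_prod_symm]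
    · refine integral_congr_ae (Filter.Eventually.of_forall fun z => ?_)
      refine integral_congr_ae (Filter.Eventually.of_forall fun t => ?_)
      simp only [Fin.prod_univ_succ, Fin.cons_zero, Fin.cons_succ, hH, mul_assoc]
    · refine (hHkk i).congr (Filter.Eventually.of_forall fun p => ?_)
      simp only [Fin.prod_univ_succ, Fin.cons_zero, Fin.cons_succ, hH, mul_assoc]

/-! ### The remainder terms as integrals over faces of the cube -/

theorem prod_mem_mul_prod_notMem {ι M : Type*} [Fintype ι] [DecidableEq ι] [CommMonoid M]
    (u : Finset ι) (g : ι → M) :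
    (∏ j : {j // j ∈ u}, g j) * ∏ j : {j // j ∉ u}, g j = ∏ j, g j := by
  convert Fintype.prod_subtype_mul_prod_subtype (· ∈ u) g

section Anchored

variable {s : ℕ}

theorem measurableEmbedding_glue_zero {ι : Type*} [Fintype ι] [DecidableEq ι] (w : Finset ι) :
    MeasurableEmbedding fun x : {j // j ∈ w} → ℝ => glue w x 0 :=
  (measurableEmbedding_glue w).comp (measurableEmbedding_prod_mk_right 0)

/-- The measure of Taylor's formula lives on the face of the cube spanned by the coordinates in which
the derivative has top order. -/
theorem measurePreserving_glue_zero {δ : ℕ} (τ : Fin s → Fin (δ + 1)) :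
    MeasurePreserving (fun x : {j // j ∈ topSet τ} → ℝ => glue (topSet τ) x 0)
      (cubeMeasure {j // j ∈ topSet τ}) (taylorMeasure δ fun j => (τ j : ℕ)) := by
  have h := measurePreserving_glue (topSet τ) fun j => nodeMeasure δ (τ j)
  have h1 : (fun j : {j // j ∈ topSet τ} => nodeMeasure δ (τ j)) = fun _ => vol01 := by
    funext j
    rw [(Finset.mem_filter.1 j.2).2, nodeMeasure_self]
  have h2 : (fun j : {j // j ∉ topSet τ} => nodeMeasure δ (τ j)) =
      fun _ => Measure.dirac (0 : ℝ) := by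
    funext j
    refine nodeMeasure_of_ne fun hj => j.2 ?_
    simp [topSet, hj]
  have h3 : (Measure.pi fun _ : {j // j ∉ topSet τ} => Measure.dirac (0 : ℝ)) =
      Measure.dirac 0 := by
    refine Measure.pi_eq fun S hS => ?_
    rw [Measure.dirac_apply' _ (MeasurableSet.univ_pi hS)]
    simp_rw [fun i => Measure.dirac_apply' (0 : ℝ) (hS i)]
    by_cases h0 : ∀ i, (0 : ℝ) ∈ S i
    · rw [indicator_of_mem (show (0 : {j // j ∉ topSet τ} → ℝ) ∈ univ.pi S from mem_univ_pi.2 h0),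
        Finset.prod_eq_one]
      · rfl
      · intro i _
        rw [indicator_of_mem (h0 i)]
        rfl
    · rw [indicator_of_notMem (show (0 : {j // j ∉ topSet τ} → ℝ) ∉ univ.pi S from
        fun hm => h0 (mem_univ_pi.1 hm))]
      push Not at h0
      obtain ⟨i, hi⟩ := h0
      exact (Finset.prod_eq_zero (Finset.mem_univ i) (indicator_of_notMem hi _)).symm
  simp only [h1, h2] at h
  rw [h3, Measure.prod_dirac] at h
  exact h.comp ⟨measurable_prodMk_right, rfl⟩

theorem integrable_anchored_iff {δ : ℕ} (τ : Fin s → Fin (δ + 1)) (f : (Fin s → ℝ) → ℝ) :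
    Integrable (anchored τ f) (cubeMeasure {j // j ∈ topSet τ}) ↔
      Integrable (mixedPartial (fun j => (τ j : ℕ)) f) (taylorMeasure δ fun j => (τ j : ℕ)) :=
  (measurePreserving_glue_zero τ).integrable_comp_emb (measurableEmbedding_glue_zero _)

/-- Splitting a product of functions of one variable into the coordinates in which Taylor's formula
has a remainder and the others, which are set to `0`. -/
theorem integral_mixedPartial_mul_prod {δ : ℕ} (τ : Fin s → Fin (δ + 1)) (f : (Fin s → ℝ) → ℝ)
    (K : Fin s → ℝ → ℂ) :
    ∫ t, (mixedPartial (fun j => (τ j : ℕ)) f t : ℂ) * ∏ j, K j (t j)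
        ∂taylorMeasure δ (fun j => (τ j : ℕ)) =
      (∫ x, (anchored τ f x : ℂ) * ∏ j : {j // j ∈ topSet τ}, K j (x j)
        ∂cubeMeasure {j // j ∈ topSet τ}) * ∏ j : {j // j ∉ topSet τ}, K j 0 := by
  rw [← (measurePreserving_glue_zero τ).integral_comp (measurableEmbedding_glue_zero _),
    ← integral_mul_const]
  refine integral_congr_ae (Filter.Eventually.of_forall fun x => ?_)
  have e1 : ∏ j : {j // j ∈ topSet τ}, K j (glue (topSet τ) x 0 j) =
      ∏ j : {j // j ∈ topSet τ}, K j (x j) :=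
    Finset.prod_congr rfl fun j _ => by rw [glue, dif_pos j.2]
  have e2 : ∏ j : {j // j ∉ topSet τ}, K j (glue (topSet τ) x 0 j) =
      ∏ j : {j // j ∉ topSet τ}, K j 0 :=
    Finset.prod_congr rfl fun j _ => by rw [glue, dif_neg j.2]; rfl
  simp only [anchored]
  rw [← prod_mem_mul_prod_notMem (topSet τ), e1, e2, mul_assoc]

end Anchored

/-! ### Walsh coefficients of smooth functions -/

section Coefficients

variable {s : ℕ}

theorem integrable_taylor_term {n : ℕ} {f : (Fin s → ℝ) → ℝ} {τ : Fin s → Fin (n + 2)}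
    (hi : Integrable (mixedPartial (fun j => (τ j : ℕ)) f)
      (taylorMeasure (n + 1) fun j => (τ j : ℕ))) :
    Integrable (fun p : (Fin s → ℝ) × (Fin s → ℝ) => mixedPartial (fun j => (τ j : ℕ)) f p.2 *
        ∏ j, taylorKer (min (τ j) n) (p.1 j) (p.2 j))
      ((cubeMeasure (Fin s)).prod (taylorMeasure (n + 1) fun j => (τ j : ℕ))) := by
  have h1 : Integrable (fun p : (Fin s → ℝ) × (Fin s → ℝ) =>
      mixedPartial (fun j => (τ j : ℕ)) f p.2)
      ((cubeMeasure (Fin s)).prod (taylorMeasure (n + 1) fun j => (τ j : ℕ))) := hi.comp_snd _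
  refine h1.mul_bdd (c := 1) (Measurable.aestronglyMeasurable ?_) ?_
  · refine Finset.measurable_fun_prod _ fun j _ => ?_
    have h2 : Measurable fun p : (Fin s → ℝ) × (Fin s → ℝ) => (p.1 j, p.2 j) := by fun_prop
    exact (measurable_taylorKer _).comp h2
  · filter_upwards [Measure.quasiMeasurePreserving_fst.ae (ae_mem_cube (ι := Fin s)),
      Measure.quasiMeasurePreserving_snd.ae
        (ae_mem_taylorMeasure (n + 1) fun j => (τ j : ℕ))] with p h2 h3
    rw [norm_prod]
    exact Finset.prod_le_one (fun _ _ => norm_nonneg _) fun j _ => abs_taylorKer_le _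
      ⟨(h2 j trivial).1, (h2 j trivial).2.le⟩ ⟨(h3 j trivial).1, (h3 j trivial).2.le⟩

theorem ae_eq_taylor {n : ℕ} {f : (Fin s → ℝ) → ℝ} (hf : HasMixedPartials (n + 1) f)
    (hi : ∀ τ : Fin s → Fin (n + 2),
      Integrable (mixedPartial (fun j => (τ j : ℕ)) f) (taylorMeasure (n + 1) fun j => (τ j : ℕ))) :
    ∀ᵐ x ∂cubeMeasure (Fin s), f x = ∑ τ : Fin s → Fin (n + 2),
      ∫ t, mixedPartial (fun j => (τ j : ℕ)) f t *
        ∏ j, taylorKer (min (τ j) n) (x j) (t j) ∂taylorMeasure (n + 1) fun j => (τ j : ℕ) :=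
  ae_mem_cube.mono fun _ hx => taylor_mixedPartial n hf hi hx

/-- By Taylor's formula `f` is bounded. -/
theorem memLp_two_of_hasMixedPartials {n : ℕ} {f : (Fin s → ℝ) → ℝ}
    (hf : HasMixedPartials (n + 1) f)
    (hi : ∀ τ : Fin s → Fin (n + 2),
      Integrable (anchored τ f) (cubeMeasure {j // j ∈ topSet τ})) :
    MemLp f 2 (volume.restrict (cube (Fin s))) := by
  simp only [integrable_anchored_iff] at hi
  rw [restrict_cube]
  have hae := ae_eq_taylor hf hi
  refine MemLp.of_bound ?_ (∑ τ : Fin s → Fin (n + 2),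
    ∫ t, ‖mixedPartial (fun j => (τ j : ℕ)) f t‖ ∂taylorMeasure (n + 1) fun j => (τ j : ℕ)) ?_
  · refine AEStronglyMeasurable.congr ?_ (hae.mono fun x hx => hx.symm)
    exact (integrable_finsetSum _ fun τ _ =>
      (integrable_taylor_term (hi τ)).integral_prod_left).aestronglyMeasurable
  · filter_upwards [hae, ae_mem_cube] with x hx hxc
    rw [hx]
    refine (norm_sum_le _ _).trans (Finset.sum_le_sum fun τ _ => ?_)
    refine norm_integral_le_of_norm_le (hi τ).norm ?_
    filter_upwards [ae_mem_taylorMeasure (n + 1) fun j => (τ j : ℕ)] with t ht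
    rw [norm_mul, norm_prod]
    exact mul_le_of_le_one_right (norm_nonneg _) (Finset.prod_le_one (fun _ _ => norm_nonneg _)
      fun j _ => abs_taylorKer_le _ ⟨(hxc j trivial).1, (hxc j trivial).2.le⟩
        ⟨(ht j trivial).1, (ht j trivial).2.le⟩)

/-- Inserting Taylor's formula into an integral against a product of functions of one variable:
these functions turn into their iterated primitives. -/
theorem integral_mul_prod_taylor {n : ℕ} {f : (Fin s → ℝ) → ℝ} (hf : HasMixedPartials (n + 1) f)
    (hi : ∀ τ : Fin s → Fin (n + 2),
      Integrable (mixedPartial (fun j => (τ j : ℕ)) f) (taylorMeasure (n + 1) fun j => (τ j : ℕ)))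
    {Φ : Fin s → ℝ → ℂ} (hΦm : ∀ j, Measurable (Φ j)) (hΦ : ∀ j t, ‖Φ j t‖ ≤ 1) :
    ∫ x, (f x : ℂ) * ∏ j, Φ j (x j) ∂cubeMeasure (Fin s) = ∑ τ : Fin s → Fin (n + 2),
      ∫ t, (mixedPartial (fun j => (τ j : ℕ)) f t : ℂ) *
        ∏ j, bint^[min (τ j : ℕ) n + 1] (Φ j) (t j) ∂taylorMeasure (n + 1) fun j => (τ j : ℕ) := by
  set T : (τ : Fin s → Fin (n + 2)) → (Fin s → ℝ) × (Fin s → ℝ) → ℂ := fun τ p =>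
    ((mixedPartial (fun j => (τ j : ℕ)) f p.2 *
        ∏ j, taylorKer (min (τ j) n) (p.1 j) (p.2 j) : ℝ) : ℂ) * ∏ j, Φ j (p.1 j) with hT
  have hTi : ∀ τ, Integrable (T τ)
      ((cubeMeasure (Fin s)).prod (taylorMeasure (n + 1) fun j => (τ j : ℕ))) := by
    intro τ
    refine (integrable_taylor_term (hi τ)).ofReal.mul_bdd (c := 1)
      (Measurable.aestronglyMeasurable ?_) (Filter.Eventually.of_forall fun p => ?_)
    · exact Finset.measurable_fun_prod _ fun j _ =>
        (hΦm j).comp ((measurable_pi_apply j).comp measurable_fst)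
    · rw [norm_prod]
      exact Finset.prod_le_one (fun _ _ => norm_nonneg _) fun j _ => hΦ j _
  have h1 : ∫ x, (f x : ℂ) * ∏ j, Φ j (x j) ∂cubeMeasure (Fin s) =
      ∫ x, ∑ τ : Fin s → Fin (n + 2), ∫ t, T τ (x, t) ∂taylorMeasure (n + 1) (fun j => (τ j : ℕ))
        ∂cubeMeasure (Fin s) := by
    refine integral_congr_ae ?_
    filter_upwards [ae_eq_taylor hf hi] with x hx
    rw [hx, Complex.ofReal_sum, Finset.sum_mul]
    refine Finset.sum_congr rfl fun τ _ => ?_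
    rw [← integral_complex_ofReal, ← integral_mul_const]
  rw [h1, integral_finsetSum _ fun τ _ => (hTi τ).integral_prod_left]
  refine Finset.sum_congr rfl fun τ _ => ?_
  rw [integral_integral_swap (hTi τ)]
  refine integral_congr_ae ?_
  filter_upwards [ae_mem_taylorMeasure (n + 1) fun j => (τ j : ℕ)] with t ht
  have h2 : ∀ x, T τ (x, t) = (mixedPartial (fun j => (τ j : ℕ)) f t : ℂ) *
      ∏ j, ((taylorKer (min (τ j) n) (x j) (t j) : ℂ) * Φ j (x j)) := by
    intro x
    simp only [hT]
    push_cast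
    rw [Finset.prod_mul_distrib, mul_assoc]
  simp_rw [h2]
  rw [integral_const_mul, integral_fintype_prod_eq_prod
    (f := fun j u => (taylorKer (min (τ j) n) u (t j) : ℂ) * Φ j u)]
  congr 1
  exact Finset.prod_congr rfl fun j _ => integral_taylorKer_mul _ (hΦm j)
    (fun u _ => hΦ j u) ⟨(ht j trivial).1, (ht j trivial).2.le⟩

variable {p : ℕ} {F : Type*} [Field F] [Algebra (ZMod p) F] (θ : PowerBasis (ZMod p) F)
  {q : ℕ} [NeZero q] {φ : Fin q ≃ F}

/-- The decay of the Walsh coefficients. In each term of Taylor's formula the coordinates without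
remainder contribute values of iterated primitives of Walsh functions at `0`, and the others
oscillating kernels, which are tested against the differences of the remainder. -/
theorem norm_walshCoeff_le [Fact p.Prime] (hφ : φ 0 = 0) {n : ℕ} {lam : ℝ} (hlam : lam ≤ 1)
    {f : (Fin s → ℝ) → ℝ} (hf : HasMixedPartials (n + 1) f)
    (hi : ∀ τ : Fin s → Fin (n + 2),
      Integrable (anchored τ f) (cubeMeasure {j // j ∈ topSet τ}))
    {B : (τ : Fin s → Fin (n + 2)) → Finset {j // j ∈ topSet τ} → ℝ} (hB0 : ∀ τ w, 0 ≤ B τ w)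
    (hB : ∀ τ w, DiffBound lam (proj w (anchored τ f)) (B τ w)) (k : Fin s → ℕ) :
    ‖walshCoeff θ φ f k‖ ≤ (256 * (q : ℝ) ^ (n + 2)) ^ s * (∑ τ, ∑ w, B τ w) *
      (q : ℝ) ^ (-∑ j, mu q lam (n + 1) (k j)) := by
  have hq1 : 1 < q := one_lt_of_equiv φ
  have hq1' : (1 : ℝ) ≤ q := by exact_mod_cast hq1.le
  have hq' : (0 : ℝ) < q := by linarith
  set Φ : Fin s → ℝ → ℂ := fun j x => (starRingEnd ℂ) (wal θ φ (k j) x) with hΦdef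
  have hΦm : ∀ j, Measurable (Φ j) := fun j =>
    Complex.continuous_conj.measurable.comp (measurable_wal θ φ (k j))
  have hΦ : ∀ j t, ‖Φ j t‖ ≤ 1 := fun j t => by
    simp only [hΦdef, RCLike.norm_conj, norm_wal, le_refl]
  have hΦi : ∀ j a b, IntervalIntegrable (Φ j) volume a b := by
    intro j a b
    refine (intervalIntegrable_const (c := (1 : ℝ))).mono_fun (hΦm j).aestronglyMeasurable ?_
    exact Filter.Eventually.of_forall fun t => by simpa using hΦ j t
  have hkb : ∀ j, k j < q ^ k j := fun j => Nat.lt_pow_self hq1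
  have hprof : ∀ j, WalshProfile θ φ (k j) (k j) (Φ j) := fun j => walshProfile_wal θ hφ (hkb j)
  have h1 : walshCoeff θ φ f k = ∫ x, (f x : ℂ) * ∏ j, Φ j (x j) ∂cubeMeasure (Fin s) := by
    rw [walshCoeff, restrict_cube]
    simp only [walVec, map_prod, hΦdef]
  rw [h1, integral_mul_prod_taylor hf (fun τ => (integrable_anchored_iff τ f).1 (hi τ)) hΦm hΦ,
    Finset.mul_sum, Finset.sum_mul]
  refine (norm_sum_le _ _).trans (Finset.sum_le_sum fun τ _ => ?_)
  rw [integral_mixedPartial_mul_prod τ f fun j => bint^[min (τ j : ℕ) n + 1] (Φ j), norm_mul, norm_prod]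
  choose e M hosc hM using fun j =>
    WalshProfile.exists_oscBound θ hφ lam hlam (n + 1) (hkb j) (hΦi j) (fun t _ => hΦ j t) (hprof j)
  have htop : ∀ j : {j // j ∈ topSet τ}, min ((τ j : Fin (n + 2)) : ℕ) n + 1 = n + 1 := by
    intro j
    rw [(Finset.mem_filter.1 j.2).2, min_eq_right (Nat.le_succ n)]
  have h2 := norm_integral_mul_prod_osc_le hq1.le (hi τ) (hB0 τ) (hB τ)
    (K := fun j : {j // j ∈ topSet τ} => bint^[min (τ j : ℕ) n + 1] (Φ j)) (e := fun j => e j)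
    (M := fun j => M j) (fun j => by
      rw [Function.iterate_succ_apply']
      exact (continuous_bint (intervalIntegrable_bint_iterate (hΦi j) _)).measurable)
    (fun j => by rw [htop j]; exact hosc j)
  have hBs : 0 ≤ ∑ w, B τ w := Finset.sum_nonneg fun w _ => hB0 τ w
  set R : Fin s → ℝ := fun j => 256 * (q : ℝ) ^ (n + 2) * (q : ℝ) ^ (-mu q lam (n + 1) (k j))
    with hR
  have hR0 : ∀ j, 0 ≤ R j := fun j => by positivity
  have h3 : ∏ j : {j // j ∈ topSet τ}, 256 * (M j * (q : ℝ) ^ (-(lam * e j))) ≤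
      ∏ j : {j // j ∈ topSet τ}, R j := by
    refine Finset.prod_le_prod (fun j _ => ?_) fun j _ => ?_
    · have : 0 ≤ M j := (norm_nonneg _).trans ((hosc j).bound 0 (by simp))
      positivity
    · simp only [hR]
      rw [mul_assoc]
      refine mul_le_mul_of_nonneg_left ?_ (by norm_num)
      simpa only [mul_one] using hM j
  have h4 : ∏ j : {j // j ∉ topSet τ}, ‖bint^[min (τ j : ℕ) n + 1] (Φ j) 0‖ ≤
      ∏ j : {j // j ∉ topSet τ}, R j := by
    refine Finset.prod_le_prod (fun j _ => norm_nonneg _) fun j _ => ?_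
    have hjn : min ((τ j : Fin (n + 2)) : ℕ) n + 1 ≤ n + 1 := by
      have := min_le_right ((τ j : Fin (n + 2)) : ℕ) n
      omega
    refine (WalshProfile.norm_bint_iterate_zero_le θ hφ lam _ hjn (hkb j) (hΦi j)
      (fun t _ => hΦ j t) (hprof j)).trans ?_
    rw [mul_one]
    refine mul_le_mul_of_nonneg_right ?_ (by positivity)
    calc (q : ℝ) ^ (min ((τ j : Fin (n + 2)) : ℕ) n + 1) ≤ (q : ℝ) ^ (n + 2) :=
          pow_le_pow_right₀ hq1' (by omega)
      _ ≤ 256 * (q : ℝ) ^ (n + 2) := le_mul_of_one_le_left (by positivity) (by norm_num)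
  have h5 : ∏ j, R j =
      (256 * (q : ℝ) ^ (n + 2)) ^ s * (q : ℝ) ^ (-∑ j, mu q lam (n + 1) (k j)) := by
    rw [hR, Finset.prod_mul_distrib, Finset.prod_const, Finset.card_univ, Fintype.card_fin,
      ← Finset.sum_neg_distrib, Real.rpow_sum_of_pos hq']
  calc _ ≤ ((∏ j : {j // j ∈ topSet τ}, R j) * ∑ w, B τ w) * ∏ j : {j // j ∉ topSet τ}, R j := by
        refine mul_le_mul (h2.trans (mul_le_mul_of_nonneg_right h3 hBs)) h4
          (Finset.prod_nonneg fun _ _ => norm_nonneg _)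
          (mul_nonneg (Finset.prod_nonneg fun j _ => hR0 j) hBs)
    _ = (∏ j, R j) * ∑ w, B τ w := by
        rw [← prod_mem_mul_prod_notMem (topSet τ) R]
        ring
    _ = _ := by
        rw [h5]
        ring

end Coefficients

/-! ### Comparison of the norms -/

section Norms

variable {s : ℕ}

theorem rWeight_natCast_add (q δ : ℕ) {lam : ℝ} (h0 : 0 < lam) (h1 : lam ≤ 1) (k : Fin s → ℕ) :
    rWeight q (δ + lam) k = (q : ℝ) ^ (-∑ j, mu q lam δ (k j)) := by
  have h : ⌈(δ : ℝ) + lam⌉₊ = δ + 1 := by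
    rw [Nat.ceil_eq_iff (Nat.succ_ne_zero δ)]
    rw [Nat.succ_sub_one]
    push_cast
    constructor <;> linarith
  rw [rWeight, h, Nat.add_sub_cancel, add_sub_cancel_left]

variable {p : ℕ} {F : Type*} [Field F] [Algebra (ZMod p) F] {θ : PowerBasis (ZMod p) F}
  {q : ℕ} [NeZero q] {φ : Fin q ≃ F}

theorem walshNorm_le {ϑ A : ℝ} (γ : Finset (Fin s) → ℝ≥0) {f : (Fin s → ℝ) → ℝ}
    (h : ∀ k, ‖walshCoeff θ φ f k‖ ≤ A * rWeight q ϑ k) :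
    walshNorm θ φ ϑ γ f ≤ (∑ u, (γ u)⁻¹ : ℝ≥0) * ENNReal.ofReal A := by
  have hq : (0 : ℝ) < q := Nat.cast_pos.2 (NeZero.pos q)
  refine iSup₂_le fun u hu => mul_le_mul' ?_ (iSup₂_le fun k _ => ENNReal.ofReal_le_ofReal ?_)
  · rw [← ENNReal.coe_inv hu]
    exact_mod_cast Finset.single_le_sum (f := fun u => (γ u)⁻¹) (fun _ _ => zero_le)
      (Finset.mem_univ u)
  · exact (div_le_iff₀ (Real.rpow_pos_of_pos hq _)).2 (h k)

/-- The individual terms of a weighted sum of `r`-th powers. Weights equal to `0` are allowed: the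
corresponding terms vanish if the sum is finite. -/
theorem rpow_le_of_weighted_sum {T : Type*} [Fintype T] {S : T → ℝ≥0∞} {g : T → ℝ≥0} {G : ℝ≥0}
    (hG : 1 ≤ G) (hg : ∀ t, g t ≤ G) {r : ℝ} (hr : 1 ≤ r)
    (hN : (∑ t, S t / (g t : ℝ≥0∞)) ^ (1 / r) ≠ ⊤) (t : T) :
    S t ^ (1 / r) ≤ G * (∑ t, S t / (g t : ℝ≥0∞)) ^ (1 / r) := by
  have hr0 : 0 < r := by linarith
  have hr1 : 0 < 1 / r := by positivity
  set X := ∑ t, S t / (g t : ℝ≥0∞) with hX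
  have hXt : X ≠ ⊤ := fun h => hN (by rw [h, ENNReal.top_rpow_of_pos hr1])
  have h1 : S t / (g t : ℝ≥0∞) ≤ X :=
    Finset.single_le_sum (f := fun t => S t / (g t : ℝ≥0∞)) (fun _ _ => zero_le)
      (Finset.mem_univ t)
  have h2 : S t ≤ X * g t :=
    (ENNReal.div_le_iff_le_mul (Or.inr hXt) (Or.inl ENNReal.coe_ne_top)).1 h1
  calc S t ^ (1 / r) ≤ (X * G) ^ (1 / r) :=
        ENNReal.rpow_le_rpow (h2.trans (by gcongr; exact hg t)) hr1.le
    _ = (G : ℝ≥0∞) ^ (1 / r) * X ^ (1 / r) := by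
        rw [ENNReal.mul_rpow_of_nonneg _ _ hr1.le, mul_comm]
    _ ≤ (G : ℝ≥0∞) * X ^ (1 / r) := by
        gcongr
        calc (G : ℝ≥0∞) ^ (1 / r) ≤ (G : ℝ≥0∞) ^ (1 : ℝ) :=
              ENNReal.rpow_le_rpow_of_exponent_le (by exact_mod_cast hG)
                ((div_le_one hr0).2 hr)
          _ = G := ENNReal.rpow_one _

theorem vitaliVar_le_hkVar {ι : Type*} [Fintype ι] [DecidableEq ι] {lam pp qq : ℝ} (hqq : 0 < qq)
    (f : (ι → ℝ) → ℝ) (w : Finset ι) :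
    vitaliVar lam pp (proj w f) ≤ hkVar lam pp qq f := by
  unfold hkVar
  split_ifs with h
  · calc vitaliVar lam pp (proj w f) = (vitaliVar lam pp (proj w f) ^ qq) ^ (1 / qq) := by
          rw [← ENNReal.rpow_mul, mul_one_div_cancel hqq.ne', ENNReal.rpow_one]
      _ ≤ _ := ENNReal.rpow_le_rpow (Finset.single_le_sum
          (f := fun w => vitaliVar lam pp (proj w f) ^ qq) (fun _ _ => zero_le)
          (Finset.mem_univ w)) (by positivity)
  · exact le_top

theorem integrable_of_hkVar_ne_top {ι : Type*} [Fintype ι] [DecidableEq ι] {lam pp qq : ℝ}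
    {f : (ι → ℝ) → ℝ} (h : hkVar lam pp qq f ≠ ⊤) : Integrable f (cubeMeasure ι) := by
  rw [← restrict_cube]
  by_contra hf
  exact h (if_neg hf)

/-- An upper bound for all the weights which is at least `1`. -/
noncomputable def weightBound (γ : Finset (Fin s) → ℝ≥0) : ℝ≥0 := 1 + ∑ u, γ u

theorem le_weightBound (γ : Finset (Fin s) → ℝ≥0) (u : Finset (Fin s)) : γ u ≤ weightBound γ :=
  (Finset.single_le_sum (f := γ) (fun _ _ => zero_le) (Finset.mem_univ u)).trans
    (le_add_of_nonneg_left zero_le_one)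

/-- The constant by which the Walsh norm is bounded. -/
noncomputable def walshConst (q n : ℕ) (γ : Finset (Fin s) → ℝ≥0) : ℝ≥0 :=
  (∑ u, (γ u)⁻¹) * ((256 * (q : ℝ≥0) ^ (n + 2)) ^ s *
    (∑ τ : Fin s → Fin (n + 2), ∑ _w : Finset {j // j ∈ topSet τ}, weightBound γ)) + 1

/-- The estimate of the Walsh norm in terms of any quantity that controls, for each term of Taylor's
formula, the differences of the remainder and of its projections. -/
theorem walshNorm_le_of_diffBound [Fact p.Prime] (hφ : φ 0 = 0) {n : ℕ}
    (γ : Finset (Fin s) → ℝ≥0) {lam : ℝ} (h0 : 0 < lam) (hlam : lam ≤ 1) {f : (Fin s → ℝ) → ℝ}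
    (hf : HasMixedPartials (n + 1) f)
    (hi : ∀ τ : Fin s → Fin (n + 2),
      Integrable (anchored τ f) (cubeMeasure {j // j ∈ topSet τ}))
    {B : (τ : Fin s → Fin (n + 2)) → Finset {j // j ∈ topSet τ} → ℝ} (hB0 : ∀ τ w, 0 ≤ B τ w)
    (hB : ∀ τ w, DiffBound lam (proj w (anchored τ f)) (B τ w)) {N : ℝ≥0∞}
    (hN : ∀ τ w, ENNReal.ofReal (B τ w) ≤ weightBound γ * N) :
    walshNorm θ φ ((n + 1 : ℕ) + lam) γ f ≤ walshConst q n γ * N := by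
  rcases eq_or_ne N ⊤ with rfl | hNt
  · rw [ENNReal.mul_top (by simp [walshConst])]
    exact le_top
  lift N to ℝ≥0 using hNt
  have hBN : ∀ τ w, B τ w ≤ weightBound γ * N := fun τ w => by
    have h := hN τ w
    rw [← ENNReal.coe_mul, ENNReal.ofReal_le_coe] at h
    exact_mod_cast h
  set A : ℝ≥0 := (256 * (q : ℝ≥0) ^ (n + 2)) ^ s *
    (∑ τ : Fin s → Fin (n + 2), ∑ _w : Finset {j // j ∈ topSet τ}, weightBound γ) with hA
  have h1 : ∀ k, ‖walshCoeff θ φ f k‖ ≤ ((A * N : ℝ≥0) : ℝ) * rWeight q ((n + 1 : ℕ) + lam) k := by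
    intro k
    rw [rWeight_natCast_add q (n + 1) h0 hlam]
    refine (norm_walshCoeff_le θ hφ hlam hf hi hB0 hB k).trans ?_
    refine mul_le_mul_of_nonneg_right ?_ (by positivity)
    rw [hA]
    push_cast
    rw [mul_assoc, Finset.sum_mul]
    simp_rw [Finset.sum_mul]
    gcongr with τ _ w _
    exact hBN τ w
  calc walshNorm θ φ ((n + 1 : ℕ) + lam) γ f
      ≤ (∑ u, (γ u)⁻¹ : ℝ≥0) * ENNReal.ofReal ((A * N : ℝ≥0) : ℝ) := walshNorm_le γ h1
    _ = (((∑ u, (γ u)⁻¹) * A * N : ℝ≥0) : ℝ≥0∞) := by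
        rw [ENNReal.ofReal_coe_nnreal, ← ENNReal.coe_mul, ← mul_assoc]
    _ ≤ ((walshConst q n γ * N : ℝ≥0) : ℝ≥0∞) := by
        rw [ENNReal.coe_le_coe]
        exact mul_le_mul_of_nonneg_right (le_add_of_nonneg_right zero_le_one) zero_le
    _ = _ := ENNReal.coe_mul _ _

theorem walshNorm_le_smoothN [Fact p.Prime] (hφ : φ 0 = 0) {n : ℕ}
    (γ : Finset (Fin s) → ℝ≥0) {lam pp qq rr : ℝ} (h0 : 0 < lam) (hlam : lam ≤ 1) (hpp : 1 ≤ pp)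
    (hqq : 1 ≤ qq) (hrr : 1 ≤ rr) {f : (Fin s → ℝ) → ℝ} (hf : HasMixedPartials (n + 1) f)
    (hN : smoothN (n + 1) lam pp qq rr γ f ≠ ⊤) :
    MemLp f 2 (volume.restrict (cube (Fin s))) ∧ walshNorm θ φ ((n + 1 : ℕ) + lam) γ f ≤
      walshConst q n γ * smoothN (n + 1) lam pp qq rr γ f := by
  have hrr0 : rr ≠ 0 := by linarith
  have h1 : ∀ τ : Fin s → Fin (n + 2), hkVar lam pp qq (anchored τ f) ≤
      weightBound γ * smoothN (n + 1) lam pp qq rr γ f := by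
    intro τ
    have h := rpow_le_of_weighted_sum (g := fun τ : Fin s → Fin (n + 2) => γ (posSet τ))
      (le_add_of_nonneg_right zero_le) (fun τ => le_weightBound γ _) hrr hN τ
    rwa [← ENNReal.rpow_mul, mul_one_div_cancel hrr0, ENNReal.rpow_one] at h
  have ht : ∀ τ : Fin s → Fin (n + 2), hkVar lam pp qq (anchored τ f) ≠ ⊤ := fun τ =>
    ne_top_of_le_ne_top (ENNReal.mul_ne_top ENNReal.coe_ne_top hN) (h1 τ)
  have hV : ∀ (τ : Fin s → Fin (n + 2)) w, vitaliVar lam pp (proj w (anchored τ f)) ≤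
      hkVar lam pp qq (anchored τ f) := fun τ w => vitaliVar_le_hkVar (by linarith) _ w
  have hVt := fun τ w => ne_top_of_le_ne_top (ht τ) (hV τ w)
  have hi := fun τ => integrable_of_hkVar_ne_top (ht τ)
  refine ⟨memLp_two_of_hasMixedPartials hf hi, walshNorm_le_of_diffBound hφ γ h0 hlam hf hi
    (fun _ _ => ENNReal.toReal_nonneg) (fun τ w => diffBound_of_vitaliVar h0 hlam hpp (hVt τ w))
    fun τ w => ?_⟩
  rw [ENNReal.ofReal_toReal (hVt τ w)]
  exact (hV τ w).trans (h1 τ)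

theorem walshNorm_le_sobolevNorm [Fact p.Prime] (hφ : φ 0 = 0) {n : ℕ}
    (γ : Finset (Fin s) → ℝ≥0) {f : (Fin s → ℝ) → ℝ} (hf : HasMixedPartials (n + 1) f)
    (hN : sobolevNorm (n + 1) γ f ≠ ⊤) :
    MemLp f 2 (volume.restrict (cube (Fin s))) ∧ walshNorm θ φ ((n + 1 : ℕ) + 1) γ f ≤
      walshConst q n γ * sobolevNorm (n + 1) γ f := by
  have h1 : ∀ (τ : Fin s → Fin (n + 2)) w, mixedSeminormSq w (anchored τ f) ^ (1 / 2 : ℝ) ≤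
      weightBound γ * sobolevNorm (n + 1) γ f := by
    intro τ w
    have h := rpow_le_of_weighted_sum (g := fun τ : Fin s → Fin (n + 2) => γ (posSet τ))
      (le_add_of_nonneg_right zero_le) (fun τ => le_weightBound γ _) one_le_two hN τ
    exact (ENNReal.rpow_le_rpow (Finset.single_le_sum
      (f := fun w => mixedSeminormSq w (anchored τ f)) (fun _ _ => zero_le)
      (Finset.mem_univ w)) (by norm_num)).trans h
  have ht : ∀ (τ : Fin s → Fin (n + 2)) w, mixedSeminormSq w (anchored τ f) ≠ ⊤ := by
    intro τ w h
    have h2 := h1 τ w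
    rw [h, ENNReal.top_rpow_of_pos (by norm_num), top_le_iff] at h2
    exact ENNReal.mul_ne_top ENNReal.coe_ne_top hN h2
  have hi := fun τ => integrable_of_mixedSeminormSq_empty (ht τ ∅)
  refine ⟨memLp_two_of_hasMixedPartials hf hi, walshNorm_le_of_diffBound hφ γ one_pos le_rfl hf hi
    (fun _ _ => Real.sqrt_nonneg _) (fun τ w => diffBound_of_mixedSeminormSq (hi τ) (ht τ w))
    fun τ w => ?_⟩
  rw [Real.sqrt_eq_rpow, ENNReal.toReal_rpow, ENNReal.ofReal_toReal
    (ENNReal.rpow_ne_top_of_nonneg (by norm_num) (ht τ w))]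
  exact h1 τ w

end Norms

end WalshSmooth

open WalshSmooth in
theorem mainTheorem2 {p : ℕ} [Fact p.Prime] {F : Type*} [Field F] [Algebra (ZMod p) F]
    (θ : PowerBasis (ZMod p) F) {q : ℕ} [NeZero q] (φ : Fin q ≃ F) (hφ : φ 0 = 0)
    (s δ : ℕ) (hδ : 1 ≤ δ) (γ : Finset (Fin s) → ℝ≥0) :
    ∃ C : ℝ≥0, 0 < C ∧
      (∀ lam pp qq rr : ℝ, 0 < lam → lam ≤ 1 → 1 ≤ pp → 1 ≤ qq → 1 ≤ rr →
        ∀ f : (Fin s → ℝ) → ℝ, HasMixedPartials δ f →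
          walshNorm θ φ (δ + lam) γ f ≤ C * smoothN δ lam pp qq rr γ f ∧
          (smoothN δ lam pp qq rr γ f < ⊤ → CoeffVanish θ φ γ f →
            MemWalshSpace θ φ (δ + lam) γ f)) ∧
      (∀ f : (Fin s → ℝ) → ℝ, HasMixedPartials δ f →
          walshNorm θ φ (δ + 1) γ f ≤ C * sobolevNorm δ γ f ∧
          (sobolevNorm δ γ f < ⊤ → CoeffVanish θ φ γ f →
            MemWalshSpace θ φ (δ + 1) γ f)) := by
  obtain ⟨n, rfl⟩ : ∃ n, δ = n + 1 := ⟨δ - 1, by omega⟩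
  have hC : 0 < walshConst q n γ := lt_of_lt_of_le one_pos (le_add_of_nonneg_left zero_le)
  refine ⟨walshConst q n γ, hC, ?_, ?_⟩
  · intro lam pp qq rr h0 hlam hpp hqq hrr f hf
    refine ⟨?_, fun hN hv => ?_⟩
    · rcases eq_or_ne (smoothN (n + 1) lam pp qq rr γ f) ⊤ with h | hN
      · rw [h, ENNReal.mul_top (ENNReal.coe_ne_zero.2 hC.ne')]
        exact le_top
      · exact (walshNorm_le_smoothN hφ γ h0 hlam hpp hqq hrr hf hN).2
    · obtain ⟨h1, h2⟩ := walshNorm_le_smoothN (θ := θ) hφ γ h0 hlam hpp hqq hrr hf hN.ne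
      exact ⟨h1, hv, h2.trans_lt (ENNReal.mul_lt_top ENNReal.coe_lt_top hN)⟩
  · intro f hf
    refine ⟨?_, fun hN hv => ?_⟩
    · rcases eq_or_ne (sobolevNorm (n + 1) γ f) ⊤ with h | hN
      · rw [h, ENNReal.mul_top (ENNReal.coe_ne_zero.2 hC.ne')]
        exact le_top
      · exact (walshNorm_le_sobolevNorm hφ γ hf hN).2
    · obtain ⟨h1, h2⟩ := walshNorm_le_sobolevNorm (θ := θ) hφ γ hf hN.ne
      exact ⟨h1, hv, h2.trans_lt (ENNReal.mul_lt_top ENNReal.coe_lt_top hN)⟩
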